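/- Let $H>\tfrac12$, $T>0$, let $B$ be a one-dimensional Brownian motion, and consider the model $X_t=x_0+\int_0^t K(t,r)V(X_r)\circ dB_r$ with $K(t,r)=(t-r)^{H-1/2}$, together with a function $G$, where $G\in C^4(\mathbb R)$ and $V\in C^3(\mathbb R)$. For $n\ge 1$ let $\mathcal S_n$ be the set of $\vec\kappa=(\kappa_1,\dots,\kappa_n)$ with $\kappa_l\in\{0,\dots,l-1\}$. For $\vec\kappa\in\mathcal S_n$ let $c_\alpha=\#\{l:\kappa_l=\alpha\}$ and put, with $t_0:=T$, $$\mathcal V_0(\vec\kappa;x)=G^{(c_0)}(x)\prod_{\alpha=1}^n V^{(c_\alpha)}(x),\qquad \mathcal K(\vec\kappa;\vec t\,)=\prod_{l=1}^n K(t_{\kappa_l},t_l).$$ Let $\bar{\mathbb V}_N$ be the set of all functions $\mathcal V_0(\vec\kappa;\cdot)$ with $\vec\kappa\in\mathcal S_n$, $1\le n\le N$, $n$ even, and for $\phi\in\bar{\mathbb V}_N$ let $$\bar\Gamma^\phi_N=\sum_{\substack{1\le n\le N\\ n\ \mathrm{even}}}\ \sum_{\vec\kappa\in\mathcal S_n}\mathbf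 1_{\{\mathcal V_0(\vec\kappa;\cdot)=\phi\}}\int_{0\le t_n\le\cdots\le t_1\le T}\mathcal K(\vec\kappa;\vec t\,)\circ dB_{t_n}\circ\cdots\circ dB_{t_1},$$ where the integrals are iterated Stratonovich integrals (limits in $L^2$ of trapezoidal sums as the mesh of the partition tends to $0$). Let $$\phi_1=G^{(4)}V^4,\quad \phi_2=G^{(3)}V'V^3,\quad \phi_3=G''V''V^3,\quad \phi_4=G''(V')^2V^2,$$ $$\phi_5=G'V^{(3)}V^3,\quad \phi_6=G'V''V'V^2,\quad \phi_7=G'(V')^3V .$$ (i) If none of $\phi_1,\dots,\phi_7$ equals one of the functions $G''V^2$, $G'V'V$, then $\bar{\mathbb V}_5\setminus\bar{\mathbb V}_3=\{\phi_1,\dots,\phi_7\}$. (ii) Let $\alpha\in\{1,\dots,7\}$ be such that $\phi_\alpha$ differs, as a function, from the six other $\phi_\beta$ and from $G''V^2$ and $G'V'V$. Then, for $N\in\{4,5\}$, the random variable $\bar\Gamma^{\phi_\alpha}_N$ exists, is integrable, and $\gamma^{\phi_\alpha}:=\mathbb E[\bar\Gamma^{\phi_\alpha}_N]$ is given by $$\gamma^{\phi_1}=\frac{T^{4H}}{32H^2},\qquad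 \gamma^{\phi_2}=\frac{T^{4H}}{4H}\,\mathrm B\!\left(2H,H+\tfrac12\right),\qquad \gamma^{\phi_3}=\gamma^{\phi_4}=\frac{T^{4H}}{4H}\,\mathrm B(2H,2H+1),$$ $$\gamma^{\phi_5}=\gamma^{\phi_6}=\gamma^{\phi_7}=0,$$ where $\mathrm B(a,b)=\int_0^1(1-t)^{a-1}t^{b-1}\,dt$. -/

import Mathlib

open MeasureTheory ProbabilityTheory
open scoped NNReal

noncomputable section

namespace VolterraSignature

/-! ### Iterated Stratonovich integrals against a Brownian motion -/

section Stratonovich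

variable {Ω : Type*} [MeasurableSpace Ω]

/-- The trapezoidal sum of `Y` against `B` along the points `τ 0, …, τ k`. -/
def trapezoidSum (B Y : ℝ≥0 → Ω → ℝ) (k : ℕ) (τ : ℕ → ℝ≥0) (ω : Ω) : ℝ :=
  ∑ i ∈ Finset.range k,
    (Y (τ i) ω + Y (τ (i + 1)) ω) / 2 * (B (τ (i + 1)) ω - B (τ i) ω)

/-- `I` is (a version of) the Stratonovich integral `∫_0^s Y_t ∘ dB_t`: the trapezoidal sums along
the partitions `0 = τ 0 ≤ ⋯ ≤ τ k = s` converge to `I` in `L²(P)` as the mesh tends to `0`. -/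
def IsStratonovichIntegral (B : ℝ≥0 → Ω → ℝ) (P : Measure Ω) (s : ℝ≥0) (Y : ℝ≥0 → Ω → ℝ)
    (I : Ω → ℝ) : Prop :=
  MemLp I 2 P ∧
    ∀ ε : ℝ, 0 < ε → ∃ δ : ℝ, 0 < δ ∧
      ∀ (k : ℕ) (τ : ℕ → ℝ≥0), Monotone τ → τ 0 = 0 → τ k = s →
        (∀ i < k, (τ (i + 1) : ℝ) - (τ i : ℝ) ≤ δ) →
          eLpNorm (fun ω => trapezoidSum B Y k τ ω - I ω) 2 P ≤ ENNReal.ofReal ε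

/-- `I` is (a version of) the iterated Stratonovich integral
`∫_{0 ≤ t_n ≤ ⋯ ≤ t_1 ≤ s} f(t_1, …, t_n) ∘ dB_{t_n} ∘ ⋯ ∘ dB_{t_1}`
of a deterministic integrand: one integrates over `t_n` first and over `t_1` last, and
`Y t` below is the inner integral over `0 ≤ t_n ≤ ⋯ ≤ t_2 ≤ t` for `t_1 = t`. -/
def IsIteratedStratonovich (B : ℝ≥0 → Ω → ℝ) (P : Measure Ω) :
    (n : ℕ) → ((Fin n → ℝ≥0) → ℝ) → ℝ≥0 → (Ω → ℝ) → Prop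
  | 0, f, _, I => I =ᵐ[P] fun _ => f Fin.elim0
  | n + 1, f, s, I =>
      ∃ Y : ℝ≥0 → Ω → ℝ,
        (∀ t ≤ s, IsIteratedStratonovich B P n
          (fun r : Fin n → ℝ≥0 => f (Fin.cons t r)) t (Y t)) ∧
        IsStratonovichIntegral B P s Y I

end Stratonovich

/-! ### The index maps, kernels and coefficient functions of the one dimensional model -/

/-- The index maps `κ = (κ_1, …, κ_n)` with `κ_l ∈ {0, …, l - 1}`. The entry `κ l` with
`l : Fin n` is the mathematical `κ_{l+1} ∈ {0, …, l}`. -/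
abbrev IndexMap (n : ℕ) : Type := (l : Fin n) → Fin (l.val + 1)

/-- The number of elements of `{l ∈ {1, …, n} : κ_l = a}`, for `a ∈ {0, …, n}`. -/
def IndexMap.count {n : ℕ} (κ : IndexMap n) (a : ℕ) : ℕ :=
  (Finset.univ.filter fun l : Fin n => (κ l : ℕ) = a).card

/-- The kernel `K(t, r) = (t - r)^{H - 1/2}`, used for `r ≤ t`. -/
def volterraKernel (H : ℝ) (t r : ℝ≥0) : ℝ := ((t : ℝ) - (r : ℝ)) ^ (H - 1 / 2)

/-- `∏_{l=1}^n K(t_{κ_l}, t_l)`, where `t_0 = T`. -/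
def kernelProd (H : ℝ) (T : ℝ≥0) {n : ℕ} (κ : IndexMap n) (t : Fin n → ℝ≥0) : ℝ :=
  ∏ l : Fin n,
    volterraKernel H
      ((Fin.cons T t : Fin (n + 1) → ℝ≥0) (Fin.castLE (by omega) (κ l))) (t l)

/-- The function `x ↦ (∏_{a=1}^n V^{(c_a)}(x)) · G^{(c_0)}(x)`, where `c_a` is the number of
`l` with `κ_l = a`. -/
def coeffFun (G V : ℝ → ℝ) {n : ℕ} (κ : IndexMap n) : ℝ → ℝ := fun x =>
  (∏ a : Fin n, iteratedDeriv (κ.count (a.val + 1)) V x) * iteratedDeriv (κ.count 0) G x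

/-- The orders `1 ≤ n ≤ N` which carry an index `j = (1, …, 1) ∈ {1}^n` in which `1` occurs an
even number of times (the model has no `dt` term, so the index `0` does not occur). -/
def evenOrders (N : ℕ) : Finset ℕ := (Finset.Icc 1 N).filter fun n => Even n

/-- The set of coefficient functions of even order at most `N`. -/
def coeffSet (G V : ℝ → ℝ) (N : ℕ) : Set (ℝ → ℝ) :=
  {φ | ∃ n ∈ evenOrders N, ∃ κ : IndexMap n, coeffFun G V κ = φ}

open Classical in
/-- `Γ` is (a version of) the signature component of `φ` at order `N`: the sum, over all even
orders `n ≤ N` and all index maps `κ` whose coefficient function is `φ`, of the iterated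
Stratonovich integrals of `kernelProd H T κ` over `0 ≤ t_n ≤ ⋯ ≤ t_1 ≤ T`. -/
def IsSignatureComponent {Ω : Type*} [MeasurableSpace Ω] (B : ℝ≥0 → Ω → ℝ) (P : Measure Ω)
    (H : ℝ) (T : ℝ≥0) (G V : ℝ → ℝ) (N : ℕ) (φ : ℝ → ℝ) (Γ : Ω → ℝ) : Prop :=
  ∃ J : (n : ℕ) → IndexMap n → Ω → ℝ,
    (∀ n ∈ evenOrders N, ∀ κ : IndexMap n,
      IsIteratedStratonovich B P n (kernelProd H T κ) T (J n κ)) ∧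
    Γ =ᵐ[P] fun ω =>
      ∑ n ∈ evenOrders N, ∑ κ : IndexMap n, if coeffFun G V κ = φ then J n κ ω else 0

/-! ### The explicit functions and values -/

/-- The two functions of order two: `G'' V²` and `G' V' V`. -/
def orderTwoFun (G V : ℝ → ℝ) : Fin 2 → ℝ → ℝ :=
  ![fun x => iteratedDeriv 2 G x * V x ^ 2,
    fun x => deriv G x * deriv V x * V x]

/-- The seven functions of order four. -/
def orderFourFun (G V : ℝ → ℝ) : Fin 7 → ℝ → ℝ :=
  ![fun x => iteratedDeriv 4 G x * V x ^ 4,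
    fun x => iteratedDeriv 3 G x * deriv V x * V x ^ 3,
    fun x => iteratedDeriv 2 G x * iteratedDeriv 2 V x * V x ^ 3,
    fun x => iteratedDeriv 2 G x * deriv V x ^ 2 * V x ^ 2,
    fun x => deriv G x * iteratedDeriv 3 V x * V x ^ 3,
    fun x => deriv G x * iteratedDeriv 2 V x * deriv V x * V x ^ 2,
    fun x => deriv G x * deriv V x ^ 3 * V x]

/-- The Beta function `∫_0^1 (1 - t)^{a-1} t^{b-1} dt`, for `a, b > 0`. -/
def betaFun (a b : ℝ) : ℝ := ∫ t in (0 : ℝ)..1, (1 - t) ^ (a - 1) * t ^ (b - 1)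

/-- The seven expected signature components of order four. -/
def orderFourValue (H : ℝ) (T : ℝ≥0) : Fin 7 → ℝ :=
  ![(T : ℝ) ^ (4 * H) / (32 * H ^ 2),
    (T : ℝ) ^ (4 * H) / (4 * H) * betaFun (2 * H) (H + 1 / 2),
    (T : ℝ) ^ (4 * H) / (4 * H) * betaFun (2 * H) (2 * (H + 1 / 2)),
    (T : ℝ) ^ (4 * H) / (4 * H) * betaFun (2 * H) (2 * (H + 1 / 2)),
    0, 0, 0]

end VolterraSignature

end

/-!
Itô calculus in `L⁴` shows that a Stratonovich integral differs from the Itô integral by half of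
the quadratic covariation of the integrand with `B`. Iterating this writes an iterated
Stratonovich integral of a continuous kernel explicitly in terms of Itô integrals and time
integrals. An Itô integral has mean zero, so of the expectation of a fourfold integral only the
term survives in which both adjacent pairs of Brownian increments are contracted: a quarter of
the time integral of `f (t, t, r, r)` over `r ≤ t ≤ T`. For a kernel product, `f (t, t, r, r)`
is a product of powers of `T - t`, `T - r` and `t - r`, or zero when one of the factors is
`K(t, t)` or `K(r, r)`; its integral is a Beta integral, and it remains to count the index maps
with a given coefficient function.
-/

noncomputable section

namespace VolterraSignature

open Filter Topology

/-! ### Brownian increments and products with them in `L⁴` -/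

section Gaussian

lemma integral_pow_eq_iteratedDeriv_exp (v : ℝ≥0) (n : ℕ) :
    ∫ x, x ^ n ∂(gaussianReal 0 v) = iteratedDeriv n (fun t => Real.exp (v * t ^ 2 / 2)) 0 := by
  have hmgf : mgf (fun x => x) (gaussianReal 0 v) = fun t => Real.exp (v * t ^ 2 / 2) := by
    simp [mgf_fun_id_gaussianReal]
  rw [← hmgf, iteratedDeriv_mgf_zero] <;> simp

lemma integral_pow_add_two_gaussianReal (v : ℝ≥0) (n : ℕ) :
    ∫ x, x ^ (n + 2) ∂(gaussianReal 0 v) = (n + 1) * v * ∫ x, x ^ n ∂(gaussianReal 0 v) := by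
  set φ : ℝ → ℝ := fun t => Real.exp (v * t ^ 2 / 2) with hφ
  have hderiv : deriv φ = fun t => t * (v * φ t) := by
    ext t
    have hexponent : HasDerivAt (fun t : ℝ => v * t ^ 2 / 2) (v * t) t := by
      refine (((hasDerivAt_pow 2 t).const_mul (v : ℝ)).div_const 2).congr_deriv ?_
      norm_num
      ring
    rw [hφ, hexponent.exp.deriv]
    ring
  have hleibniz : iteratedDeriv (n + 1) (fun t => t * (v * φ t)) 0 =
      (n + 1) * iteratedDeriv n (fun t => v * φ t) 0 := by
    have h := iteratedDeriv_mul (n := n + 1) (x := 0) (f := fun t : ℝ => t)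
      (g := fun t => v * φ t) (by fun_prop) (by fun_prop)
    have hid (i : ℕ) : iteratedDeriv i (fun t : ℝ => t) 0 = if i = 1 then 1 else 0 := by
      rw [show (fun t : ℝ => t) = id from rfl, iteratedDeriv_id]
      split_ifs <;> simp_all
    rw [show (fun t => t * (v * φ t)) = (fun t => t) * fun t => v * φ t from rfl, h,
      Finset.sum_eq_single 1 (fun i _ hi => by simp [hid, hi]) (fun h => by simp at h)]
    simp [hid]
  rw [integral_pow_eq_iteratedDeriv_exp, integral_pow_eq_iteratedDeriv_exp, ← hφ,
    iteratedDeriv_succ', hderiv, hleibniz, iteratedDeriv_const_mul_field, mul_assoc]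

lemma integral_pow_two_gaussianReal (v : ℝ≥0) : ∫ x, x ^ 2 ∂(gaussianReal 0 v) = v := by
  simpa using integral_pow_add_two_gaussianReal v 0

lemma integral_pow_three_gaussianReal (v : ℝ≥0) : ∫ x, x ^ 3 ∂(gaussianReal 0 v) = 0 := by
  simpa using integral_pow_add_two_gaussianReal v 1

lemma integral_pow_four_gaussianReal (v : ℝ≥0) :
    ∫ x, x ^ 4 ∂(gaussianReal 0 v) = 3 * (v : ℝ) ^ 2 := by
  rw [integral_pow_add_two_gaussianReal v 2, integral_pow_two_gaussianReal]
  push_cast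
  ring

end Gaussian

section FilteredBrownian

variable {Ω : Type*} {mΩ : MeasurableSpace Ω} {ℱ : Filtration ℝ≥0 mΩ} {B : ℝ≥0 → Ω → ℝ}
  {P : Measure Ω} {a b : ℝ≥0}

/-- `B` is a Brownian motion with respect to the filtration `ℱ`, in the sense needed for
stochastic integration: adapted, with Gaussian increments that are independent of the past.
Neither a value of `B 0` nor continuity of the paths is prescribed. -/
structure IsFilteredBrownian (ℱ : Filtration ℝ≥0 mΩ) (B : ℝ≥0 → Ω → ℝ) (P : Measure Ω) :
    Prop where
  measurable_at : ∀ t, Measurable[ℱ t] (B t)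
  hasLaw_increment : ∀ ⦃a b⦄, a ≤ b → HasLaw (fun ω => B b ω - B a ω) (gaussianReal 0 (b - a)) P
  indep_increment : ∀ ⦃a b⦄, a ≤ b →
    Indep (ℱ a) (MeasurableSpace.comap (fun ω => B b ω - B a ω) inferInstance) P

lemma isFilteredBrownian_natural (hB : IsPreBrownianReal B P)
    (hm : ∀ t, Measurable (B t)) :
    IsFilteredBrownian (Filtration.natural B fun t => (hm t).stronglyMeasurable) B P where
  measurable_at t :=
    (Filtration.stronglyAdapted_natural (fun t => (hm t).stronglyMeasurable) t).measurable
  hasLaw_increment a b hab := by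
    have hdist : nndist b.1 a.1 = b - a := by
      apply NNReal.coe_injective
      rw [coe_nndist, Real.dist_eq, NNReal.coe_sub hab]
      exact abs_of_nonneg (sub_nonneg.2 (NNReal.coe_le_coe.2 hab))
    exact hdist ▸ hB.hasLaw_sub b a
  indep_increment a b hab := by
    have h := (hB.indepFun_shift a).comp (measurable_pi_apply (b - a)) measurable_id
    rw [Filtration.natural_eq_comap]
    simpa [Function.comp_def, add_tsub_cancel_of_le hab, IndepFun_iff_Indep] using h.symm

namespace IsFilteredBrownian

lemma isProbabilityMeasure (hB : IsFilteredBrownian ℱ B P) : IsProbabilityMeasure P :=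
  (hB.hasLaw_increment le_rfl : HasLaw _ (gaussianReal 0 ((0 : ℝ≥0) - 0)) P).isProbabilityMeasure

lemma measurable_increment (hB : IsFilteredBrownian ℱ B P) (hab : a ≤ b) :
    Measurable[ℱ b] fun ω => B b ω - B a ω :=
  (hB.measurable_at b).sub ((hB.measurable_at a).mono (ℱ.mono hab) le_rfl)

lemma integral_increment_pow (hB : IsFilteredBrownian ℱ B P) (hab : a ≤ b) (n : ℕ) :
    ∫ ω, (B b ω - B a ω) ^ n ∂P = ∫ x, x ^ n ∂(gaussianReal 0 (b - a)) := by
  have h := hB.hasLaw_increment hab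
  rw [← h.map_eq, integral_map h.aemeasurable (by fun_prop)]

lemma integral_increment (hB : IsFilteredBrownian ℱ B P) (hab : a ≤ b) :
    ∫ ω, (B b ω - B a ω) ∂P = 0 := by
  simpa using hB.integral_increment_pow hab 1

lemma integral_increment_sq (hB : IsFilteredBrownian ℱ B P) (hab : a ≤ b) :
    ∫ ω, (B b ω - B a ω) ^ 2 ∂P = (b : ℝ) - a := by
  rw [hB.integral_increment_pow hab, integral_pow_two_gaussianReal, NNReal.coe_sub hab]

lemma integral_increment_four (hB : IsFilteredBrownian ℱ B P) (hab : a ≤ b) :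
    ∫ ω, (B b ω - B a ω) ^ 4 ∂P = 3 * ((b : ℝ) - a) ^ 2 := by
  rw [hB.integral_increment_pow hab, integral_pow_four_gaussianReal, NNReal.coe_sub hab]

lemma memLp_increment (hB : IsFilteredBrownian ℱ B P) (hab : a ≤ b) (p : ℝ≥0) :
    MemLp (fun ω => B b ω - B a ω) p P := by
  have h := hB.hasLaw_increment hab
  have hid := memLp_id_gaussianReal (μ := 0) (v := b - a) p
  rw [← h.map_eq] at hid
  exact (memLp_map_measure_iff (by fun_prop) h.aemeasurable).1 hid

lemma integrable_increment_pow (hB : IsFilteredBrownian ℱ B P) (hab : a ≤ b) (n : ℕ) :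
    Integrable (fun ω => (B b ω - B a ω) ^ n) P := by
  have := hB.isProbabilityMeasure
  refine (integrable_norm_iff ((hB.memLp_increment hab 1).1.pow n)).1 ?_
  simpa using (hB.memLp_increment hab n).integrable_norm_pow'

variable {X : Ω → ℝ} {g : ℝ → ℝ}

lemma exists_indepFun_increment (hB : IsFilteredBrownian ℱ B P) (hab : a ≤ b)
    (hX : AEStronglyMeasurable[ℱ a] X P) (hg : Measurable g) :
    ∃ X' : Ω → ℝ, StronglyMeasurable X' ∧ X =ᵐ[P] X' ∧
      IndepFun X' (fun ω => g (B b ω - B a ω)) P := by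
  obtain ⟨X', hX', hXX'⟩ := hX
  refine ⟨X', hX'.mono (ℱ.le a), hXX', ?_⟩
  have hindep : IndepFun X' (fun ω => B b ω - B a ω) P :=
    indep_of_indep_of_le_left (hB.indep_increment hab) hX'.measurable.comap_le
  exact hindep.comp measurable_id hg

lemma integral_mul_increment (hB : IsFilteredBrownian ℱ B P) (hab : a ≤ b)
    (hX : AEStronglyMeasurable[ℱ a] X P) (hg : Measurable g) :
    ∫ ω, X ω * g (B b ω - B a ω) ∂P = (∫ ω, X ω ∂P) * ∫ ω, g (B b ω - B a ω) ∂P := by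
  obtain ⟨X', hX', hXX', hindep⟩ := hB.exists_indepFun_increment hab hX hg
  have hmul : (fun ω => X ω * g (B b ω - B a ω)) =ᵐ[P] fun ω => X' ω * g (B b ω - B a ω) :=
    hXX'.mul .rfl
  rw [integral_congr_ae hmul, integral_congr_ae hXX']
  exact hindep.integral_fun_mul_eq_mul_integral hX'.aestronglyMeasurable
    (hg.comp ((hB.measurable_increment hab).mono (ℱ.le b) le_rfl)).aestronglyMeasurable

lemma integrable_mul_increment (hB : IsFilteredBrownian ℱ B P) (hab : a ≤ b)
    (hX : AEStronglyMeasurable[ℱ a] X P) (hXi : Integrable X P) (hg : Measurable g)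
    (hgi : Integrable (fun ω => g (B b ω - B a ω)) P) :
    Integrable (fun ω => X ω * g (B b ω - B a ω)) P := by
  obtain ⟨X', -, hXX', hindep⟩ := hB.exists_indepFun_increment hab hX hg
  exact (hindep.integrable_mul (hXi.congr hXX') hgi).congr (hXX'.symm.mul .rfl)

end IsFilteredBrownian

end FilteredBrownian

instance fact_one_le_four_ennreal : Fact ((1 : ENNReal) ≤ 4) := ⟨by norm_num⟩

section FourthMoment

variable {Ω : Type*} {mΩ : MeasurableSpace Ω} {P : Measure Ω}

lemma integrable_coeFn_Lp_four [IsFiniteMeasure P] (X : Lp ℝ 4 P) : Integrable X P :=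
  (Lp.memLp X).integrable (by norm_num)

lemma memLp_four_iff {f : Ω → ℝ} (hf : AEStronglyMeasurable f P) :
    MemLp f 4 P ↔ Integrable (fun ω => f ω ^ 4) P := by
  rw [← integrable_norm_rpow_iff hf (by norm_num) (by norm_num)]
  refine integrable_congr (.of_forall fun ω => ?_)
  have hexponent : (4 : ENNReal).toReal = ((4 : ℕ) : ℝ) := by norm_num
  simp only [hexponent, Real.rpow_natCast, Real.norm_eq_abs]
  exact (even_two_mul 2).pow_abs (f ω)

lemma norm_pow_four (X : Lp ℝ 4 P) : ‖X‖ ^ 4 = ∫ ω, X ω ^ 4 ∂P := by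
  have hexponent : (4 : ENNReal).toReal = ((4 : ℕ) : ℝ) := by norm_num
  have hpow (x : ℝ) : ‖x‖ ^ ((4 : ℕ) : ℝ) = x ^ 4 := by
    rw [Real.rpow_natCast, Real.norm_eq_abs]
    exact (even_two_mul 2).pow_abs x
  have hnonneg : 0 ≤ ∫ ω, X ω ^ 4 ∂P := integral_nonneg fun ω => by positivity
  rw [Lp.norm_def, (Lp.memLp X).eLpNorm_eq_integral_rpow_norm (by norm_num) (by norm_num)]
  simp only [hexponent, hpow]
  rw [ENNReal.toReal_ofReal (by positivity), ← Real.rpow_natCast, ← Real.rpow_mul hnonneg]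
  norm_num

lemma integrable_pow_mul_pow {f g : Ω → ℝ} (hf : MemLp f 4 P) (hg : MemLp g 4 P) {i j : ℕ}
    (hij : i + j = 4) : Integrable (fun ω => f ω ^ i * g ω ^ j) P := by
  refine Integrable.mono' (((memLp_four_iff hf.1).1 hf).add ((memLp_four_iff hg.1).1 hg))
    ((hf.1.pow i).mul (hg.1.pow j)) (.of_forall fun ω => ?_)
  calc ‖f ω ^ i * g ω ^ j‖
      = |f ω| ^ i * |g ω| ^ j := by simp
    _ ≤ max |f ω| |g ω| ^ i * max |f ω| |g ω| ^ j := by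
      gcongr
      exacts [le_max_left _ _, le_max_right _ _]
    _ = max |f ω| |g ω| ^ 4 := by rw [← pow_add, hij]
    _ ≤ |f ω| ^ 4 + |g ω| ^ 4 := by
      rcases max_cases |f ω| |g ω| with h | h <;> rw [h.1]
      · exact le_add_of_nonneg_right (by positivity)
      · exact le_add_of_nonneg_left (by positivity)
    _ = f ω ^ 4 + g ω ^ 4 := by rw [Even.pow_abs (by decide), Even.pow_abs (by decide)]

lemma integral_sq_mul_sq_le (X Y : Lp ℝ 4 P) :
    ∫ ω, X ω ^ 2 * Y ω ^ 2 ∂P ≤ ‖X‖ ^ 2 * ‖Y‖ ^ 2 := by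
  have hmem (Z : Lp ℝ 4 P) : MemLp (fun ω => Z ω ^ 2) (ENNReal.ofReal 2) P := by
    have h := (memLp_four_iff (Lp.memLp Z).1).1 (Lp.memLp Z)
    rw [show ENNReal.ofReal 2 = 2 by norm_num]
    refine (memLp_two_iff_integrable_sq ((Lp.memLp Z).1.pow 2)).2 (h.congr ?_)
    exact .of_forall fun ω => by simp only [Pi.pow_apply]; ring
  have hnorm (Z : Lp ℝ 4 P) : (∫ ω, (Z ω ^ 2) ^ (2 : ℝ) ∂P) ^ (1 / (2 : ℝ)) = ‖Z‖ ^ 2 := by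
    have hpow (ω : Ω) : (Z ω ^ 2) ^ (2 : ℝ) = Z ω ^ 4 := by
      rw [Real.rpow_two]; ring
    simp only [hpow]
    rw [← norm_pow_four, ← Real.sqrt_eq_rpow, show ‖Z‖ ^ 4 = (‖Z‖ ^ 2) ^ 2 by ring,
      Real.sqrt_sq (by positivity)]
  have h := integral_mul_le_Lp_mul_Lq_of_nonneg (μ := P) (p := 2) (q := 2)
    Real.HolderConjugate.two_two (f := fun ω => X ω ^ 2) (g := fun ω => Y ω ^ 2)
    (.of_forall fun ω => by positivity) (.of_forall fun ω => by positivity) (hmem X) (hmem Y)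
  rwa [hnorm, hnorm] at h

end FourthMoment

section MulIncr

variable {Ω : Type*} {mΩ : MeasurableSpace Ω} {ℱ : Filtration ℝ≥0 mΩ} {B : ℝ≥0 → Ω → ℝ}
  {P : Measure Ω} {a b c : ℝ≥0} {M X Y : Lp ℝ 4 P}

/-- The elements of `L⁴(P)` that are measurable with respect to the past of `t`. -/
def pastL4 (ℱ : Filtration ℝ≥0 mΩ) (P : Measure Ω) (t : ℝ≥0) : Submodule ℝ (Lp ℝ 4 P) :=
  lpMeas ℝ ℝ (ℱ t) 4 P

lemma mem_pastL4 {t : ℝ≥0} : X ∈ pastL4 ℱ P t ↔ AEStronglyMeasurable[ℱ t] X P :=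
  mem_lpMeas_iff_aestronglyMeasurable

lemma pastL4_mono (hab : a ≤ b) : pastL4 ℱ P a ≤ pastL4 ℱ P b := fun _ hX =>
  mem_pastL4.2 ((mem_pastL4.1 hX).mono (ℱ.mono hab))

lemma isClosed_pastL4 (t : ℝ≥0) : IsClosed (pastL4 ℱ P t : Set (Lp ℝ 4 P)) := by
  convert isClosed_aestronglyMeasurable (F := ℝ) (p := 4) (μ := P) (ℱ.le t) using 1
  ext X
  exact mem_pastL4

/-- The product `X (B_b - B_a)` as an element of `L⁴(P)`, with value `0` if the product is not
in `L⁴(P)`. -/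
def mulIncr (B : ℝ≥0 → Ω → ℝ) (a b : ℝ≥0) (X : Lp ℝ 4 P) : Lp ℝ 4 P :=
  open Classical in
  if h : MemLp (fun ω => X ω * (B b ω - B a ω)) 4 P then h.toLp else 0

lemma mulIncr_self (a : ℝ≥0) (X : Lp ℝ 4 P) : mulIncr B a a X = 0 := by
  have h : MemLp (fun ω => X ω * (B a ω - B a ω)) 4 P := by simp
  rw [mulIncr, dif_pos h]
  simp only [sub_self, mul_zero]
  exact MemLp.toLp_zero _

lemma memLp_mul_increment (hB : IsFilteredBrownian ℱ B P) (hab : a ≤ b)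
    (hX : X ∈ pastL4 ℱ P a) : MemLp (fun ω => X ω * (B b ω - B a ω)) 4 P := by
  refine (memLp_four_iff ((Lp.aestronglyMeasurable X).mul
    ((hB.measurable_increment hab).mono (ℱ.le b) le_rfl).aestronglyMeasurable)).2 ?_
  simpa only [Pi.mul_apply, mul_pow] using
    hB.integrable_mul_increment hab (X := fun ω => X ω ^ 4) (g := fun x => x ^ 4)
      ((mem_pastL4.1 hX).pow 4) ((memLp_four_iff (Lp.memLp X).1).1 (Lp.memLp X)) (by fun_prop)
      (hB.integrable_increment_pow hab 4)

lemma coeFn_mulIncr (hB : IsFilteredBrownian ℱ B P) (hab : a ≤ b) (hX : X ∈ pastL4 ℱ P a) :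
    mulIncr B a b X =ᵐ[P] fun ω => X ω * (B b ω - B a ω) := by
  rw [mulIncr, dif_pos (memLp_mul_increment hB hab hX)]
  exact MemLp.coeFn_toLp _

lemma mulIncr_mem (hB : IsFilteredBrownian ℱ B P) (hab : a ≤ b) (hX : X ∈ pastL4 ℱ P a) :
    mulIncr B a b X ∈ pastL4 ℱ P b :=
  mem_pastL4.2 ((((mem_pastL4.1 hX).mono (ℱ.mono hab)).mul
    (hB.measurable_increment hab).aestronglyMeasurable).congr (coeFn_mulIncr hB hab hX).symm)

lemma mulIncr_add (hB : IsFilteredBrownian ℱ B P) (hab : a ≤ b) (hX : X ∈ pastL4 ℱ P a)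
    (hY : Y ∈ pastL4 ℱ P a) : mulIncr B a b (X + Y) = mulIncr B a b X + mulIncr B a b Y := by
  apply Lp.ext
  filter_upwards [coeFn_mulIncr hB hab (add_mem hX hY), coeFn_mulIncr hB hab hX,
    coeFn_mulIncr hB hab hY, Lp.coeFn_add X Y,
    Lp.coeFn_add (mulIncr B a b X) (mulIncr B a b Y)] with ω hXY hX' hY' hadd hadd'
  rw [hXY, hadd', Pi.add_apply, hX', hY', hadd, Pi.add_apply]
  ring

lemma mulIncr_sub (hB : IsFilteredBrownian ℱ B P) (hab : a ≤ b) (hX : X ∈ pastL4 ℱ P a)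
    (hY : Y ∈ pastL4 ℱ P a) : mulIncr B a b (X - Y) = mulIncr B a b X - mulIncr B a b Y := by
  have h := mulIncr_add hB hab (sub_mem hX hY) hY
  rw [sub_add_cancel] at h
  rw [h, add_sub_cancel_right]

lemma mulIncr_zero (hB : IsFilteredBrownian ℱ B P) (hab : a ≤ b) :
    mulIncr B a b (0 : Lp ℝ 4 P) = 0 := by
  simpa using mulIncr_sub hB hab (zero_mem (pastL4 ℱ P a)) (zero_mem (pastL4 ℱ P a))

lemma mulIncr_trans (hB : IsFilteredBrownian ℱ B P) (hab : a ≤ b) (hbc : b ≤ c)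
    (hX : X ∈ pastL4 ℱ P a) : mulIncr B a c X = mulIncr B a b X + mulIncr B b c X := by
  apply Lp.ext
  filter_upwards [coeFn_mulIncr hB (hab.trans hbc) hX, coeFn_mulIncr hB hab hX,
    coeFn_mulIncr hB hbc (pastL4_mono hab hX),
    Lp.coeFn_add (mulIncr B a b X) (mulIncr B b c X)] with ω hac hab' hbc' hadd
  rw [hac, hadd, Pi.add_apply, hab', hbc']
  ring

lemma integral_mulIncr (hB : IsFilteredBrownian ℱ B P) (hab : a ≤ b) (hX : X ∈ pastL4 ℱ P a) :
    ∫ ω, mulIncr B a b X ω ∂P = 0 := by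
  rw [integral_congr_ae (coeFn_mulIncr hB hab hX),
    hB.integral_mul_increment hab (mem_pastL4.1 hX) (g := fun x => x) measurable_id,
    hB.integral_increment hab, mul_zero]

lemma integral_add_mulIncr_pow_four (hB : IsFilteredBrownian ℱ B P) (hab : a ≤ b)
    (hM : M ∈ pastL4 ℱ P a) (hX : X ∈ pastL4 ℱ P a) :
    ∫ ω, (M + mulIncr B a b X) ω ^ 4 ∂P =
      ∑ m ∈ Finset.range 5, (∫ ω, M ω ^ m * X ω ^ (4 - m) ∂P) *
        (∫ x, x ^ (4 - m) ∂(gaussianReal 0 (b - a))) * (Nat.choose 4 m : ℝ) := by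
  have hmeas (m : ℕ) : AEStronglyMeasurable[ℱ a] (fun ω => M ω ^ m * X ω ^ (4 - m)) P :=
    ((mem_pastL4.1 hM).pow m).mul ((mem_pastL4.1 hX).pow (4 - m))
  have hint {m : ℕ} (hm : m ∈ Finset.range 5) :
      Integrable (fun ω => M ω ^ m * X ω ^ (4 - m) * (B b ω - B a ω) ^ (4 - m)) P :=
    hB.integrable_mul_increment hab (g := fun x => x ^ (4 - m)) (hmeas m)
      (integrable_pow_mul_pow (Lp.memLp M) (Lp.memLp X)
        (Nat.add_sub_of_le (Finset.mem_range_succ_iff.1 hm)))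
      (by fun_prop) (hB.integrable_increment_pow hab _)
  have hexpand : (fun ω => (M + mulIncr B a b X) ω ^ 4) =ᵐ[P] fun ω =>
      ∑ m ∈ Finset.range 5,
        M ω ^ m * X ω ^ (4 - m) * (B b ω - B a ω) ^ (4 - m) * (Nat.choose 4 m : ℝ) := by
    filter_upwards [coeFn_mulIncr hB hab hX, Lp.coeFn_add M (mulIncr B a b X)] with ω hmul hadd
    rw [hadd, Pi.add_apply, hmul, add_pow]
    simp only [mul_pow, mul_assoc]
  rw [integral_congr_ae hexpand, integral_finsetSum _ fun m hm => (hint hm).mul_const _]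
  refine Finset.sum_congr rfl fun m _ => ?_
  rw [integral_mul_const, hB.integral_mul_increment hab (g := fun x => x ^ (4 - m)) (hmeas m)
    (by fun_prop), hB.integral_increment_pow hab]

lemma norm_add_mulIncr_sq_le (hB : IsFilteredBrownian ℱ B P) (hab : a ≤ b)
    (hM : M ∈ pastL4 ℱ P a) (hX : X ∈ pastL4 ℱ P a) :
    ‖M + mulIncr B a b X‖ ^ 2 ≤ ‖M‖ ^ 2 + 3 * ‖X‖ ^ 2 * ((b : ℝ) - a) := by
  have hba : (0 : ℝ) ≤ (b : ℝ) - a := sub_nonneg.2 (NNReal.coe_le_coe.2 hab)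
  have hfour : ‖M + mulIncr B a b X‖ ^ 4 =
      ‖M‖ ^ 4 + 6 * ((b : ℝ) - a) * ∫ ω, M ω ^ 2 * X ω ^ 2 ∂P +
        3 * ((b : ℝ) - a) ^ 2 * ‖X‖ ^ 4 := by
    simp only [norm_pow_four, integral_add_mulIncr_pow_four hB hab hM hX,
      Finset.sum_range_succ, Finset.sum_range_zero, Nat.sub_zero, Nat.reduceSub,
      integral_pow_four_gaussianReal, integral_pow_three_gaussianReal,
      integral_pow_two_gaussianReal, pow_one, integral_id_gaussianReal, pow_zero, mul_one, one_mul,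
      integral_const, probReal_univ, smul_eq_mul, NNReal.coe_sub hab]
    norm_num [Nat.choose]
    ring
  have hcross := mul_le_mul_of_nonneg_left (integral_sq_mul_sq_le M X)
    (mul_nonneg (by norm_num : (0 : ℝ) ≤ 6) hba)
  have hnonneg : 0 ≤ ‖X‖ ^ 4 * ((b : ℝ) - a) ^ 2 := by positivity
  refine le_of_sq_le_sq ?_ (by positivity)
  calc (‖M + mulIncr B a b X‖ ^ 2) ^ 2
      = ‖M‖ ^ 4 + 6 * ((b : ℝ) - a) * ∫ ω, M ω ^ 2 * X ω ^ 2 ∂P +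
          3 * ((b : ℝ) - a) ^ 2 * ‖X‖ ^ 4 := by rw [← hfour]; ring
    _ ≤ (‖M‖ ^ 2 + 3 * ‖X‖ ^ 2 * ((b : ℝ) - a)) ^ 2 := by nlinarith

end MulIncr

/-! ### Martingale increments and the Itô integral in `L⁴` -/

section MartingaleIncrement

variable {Ω : Type*} {mΩ : MeasurableSpace Ω} {ℱ : Filtration ℝ≥0 mΩ} {B : ℝ≥0 → Ω → ℝ}
  {P : Measure Ω} [IsProbabilityMeasure P] {a b c : ℝ≥0} {d e : ℝ} {D E X : Lp ℝ 4 P}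

lemma norm_integral_le_norm_Lp_four (X : Lp ℝ 4 P) : ‖∫ ω, X ω ∂P‖ ≤ ‖X‖ := by
  have hX := Lp.aestronglyMeasurable X
  calc ‖∫ ω, X ω ∂P‖
      ≤ ∫ ω, ‖X ω‖ ∂P := norm_integral_le_integral_norm _
    _ = (eLpNorm X 1 P).toReal := by
      rw [integral_norm_eq_lintegral_enorm hX, eLpNorm_one_eq_lintegral_enorm]
    _ ≤ ‖X‖ := by
      rw [Lp.norm_def]
      exact ENNReal.toReal_mono (Lp.eLpNorm_ne_top X)
        (eLpNorm_le_eLpNorm_of_exponent_le (by norm_num) hX)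

variable (P) in
/-- The expectation as a continuous linear functional on `L⁴(P)`. -/
def expect : Lp ℝ 4 P →L[ℝ] ℝ :=
  LinearMap.mkContinuous
    { toFun := fun X => ∫ ω, X ω ∂P
      map_add' := fun X Y => by
        rw [integral_congr_ae (Lp.coeFn_add X Y)]
        exact integral_add (integrable_coeFn_Lp_four X) (integrable_coeFn_Lp_four Y)
      map_smul' := fun c X => by
        rw [integral_congr_ae (Lp.coeFn_smul c X)]
        exact integral_const_mul c _ }
    1 fun X => by
      rw [one_mul]
      exact norm_integral_le_norm_Lp_four X

lemma expect_apply (X : Lp ℝ 4 P) : expect P X = ∫ ω, X ω ∂P := rfl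

/-- `D` behaves like the increment over `[a, b]` of an `L⁴` martingale with respect to `ℱ`: it is
known at time `b`, has mean zero, and adding it to something known at time `a` increases the
square of the `L⁴` norm by at most `d`, which replaces the orthogonality of increments in `L²`. -/
structure IsMartingaleIncrement (ℱ : Filtration ℝ≥0 mΩ) (a b : ℝ≥0) (d : ℝ) (D : Lp ℝ 4 P) :
    Prop where
  mem : D ∈ pastL4 ℱ P b
  mean : expect P D = 0
  norm_add_sq_le : ∀ M ∈ pastL4 ℱ P a, ‖M + D‖ ^ 2 ≤ ‖M‖ ^ 2 + d

lemma isMartingaleIncrement_zero (a b : ℝ≥0) : IsMartingaleIncrement ℱ a b 0 (0 : Lp ℝ 4 P) :=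
  ⟨zero_mem _, map_zero _, fun M _ => by simp⟩

lemma isMartingaleIncrement_mulIncr (hB : IsFilteredBrownian ℱ B P) (hab : a ≤ b)
    (hX : X ∈ pastL4 ℱ P a) :
    IsMartingaleIncrement ℱ a b (3 * ‖X‖ ^ 2 * ((b : ℝ) - a)) (mulIncr B a b X) :=
  ⟨mulIncr_mem hB hab hX, integral_mulIncr hB hab hX,
    fun _ hM => norm_add_mulIncr_sq_le hB hab hM hX⟩

namespace IsMartingaleIncrement

lemma norm_sq_le (h : IsMartingaleIncrement ℱ a b d D) : ‖D‖ ^ 2 ≤ d := by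
  simpa using h.norm_add_sq_le 0 (zero_mem _)

lemma mono (h : IsMartingaleIncrement ℱ a b d D) (hde : d ≤ e) :
    IsMartingaleIncrement ℱ a b e D :=
  ⟨h.mem, h.mean, fun M hM => (h.norm_add_sq_le M hM).trans (by gcongr)⟩

lemma trans (hab : a ≤ b) (hbc : b ≤ c) (hD : IsMartingaleIncrement ℱ a b d D)
    (hE : IsMartingaleIncrement ℱ b c e E) : IsMartingaleIncrement ℱ a c (d + e) (D + E) where
  mem := add_mem (pastL4_mono hbc hD.mem) hE.mem
  mean := by rw [map_add, hD.mean, hE.mean, add_zero]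
  norm_add_sq_le M hM := by
    have hMD := hD.norm_add_sq_le M hM
    have hMDE := hE.norm_add_sq_le (M + D) (add_mem (pastL4_mono hab hM) hD.mem)
    rw [add_assoc] at hMDE
    linarith

lemma sum {τ : ℕ → ℝ≥0} (hτ : Monotone τ) {C : ℝ} {D : ℕ → Lp ℝ 4 P} (N : ℕ)
    (h : ∀ k < N, IsMartingaleIncrement ℱ (τ k) (τ (k + 1)) (C * ((τ (k + 1) : ℝ) - τ k)) (D k)) :
    IsMartingaleIncrement ℱ (τ 0) (τ N) (C * ((τ N : ℝ) - τ 0)) (∑ k ∈ Finset.range N, D k) := by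
  induction N with
  | zero => simpa using isMartingaleIncrement_zero (P := P) (ℱ := ℱ) (τ 0) (τ 0)
  | succ N ih =>
    rw [Finset.sum_range_succ]
    exact ((ih fun k hk => h k (hk.trans N.lt_succ_self)).trans (hτ N.zero_le) (hτ N.le_succ)
      (h N N.lt_succ_self)).mono (le_of_eq (by ring))

lemma of_tendsto {D : ℕ → Lp ℝ 4 P} (hD : Tendsto D atTop (𝓝 E))
    (h : ∀ᶠ n in atTop, IsMartingaleIncrement ℱ a b d (D n)) :
    IsMartingaleIncrement ℱ a b d E where
  mem := (isClosed_pastL4 b).mem_of_tendsto hD (h.mono fun _ hn => hn.mem)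
  mean := tendsto_nhds_unique (((expect P).continuous.tendsto E).comp hD)
    (tendsto_const_nhds.congr' (h.mono fun _ hn => hn.mean.symm))
  norm_add_sq_le M hM := le_of_tendsto ((tendsto_const_nhds.add hD).norm.pow 2)
    (h.mono fun _ hn => hn.norm_add_sq_le M hM)

lemma of_forall_pos {c : ℝ}
    (h : ∀ ε : ℝ, 0 < ε → IsMartingaleIncrement ℱ a b (3 * (c + ε) ^ 2 * ((b : ℝ) - a)) D) :
    IsMartingaleIncrement ℱ a b (3 * c ^ 2 * ((b : ℝ) - a)) D where
  mem := (h 1 one_pos).mem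
  mean := (h 1 one_pos).mean
  norm_add_sq_le M hM := by
    have hlim : Tendsto (fun ε : ℝ => ‖M‖ ^ 2 + 3 * (c + ε) ^ 2 * ((b : ℝ) - a)) (𝓝[>] 0)
        (𝓝 (‖M‖ ^ 2 + 3 * (c + 0) ^ 2 * ((b : ℝ) - a))) :=
      (Continuous.tendsto (by fun_prop) 0).mono_left nhdsWithin_le_nhds
    rw [add_zero] at hlim
    refine ge_of_tendsto hlim ?_
    filter_upwards [self_mem_nhdsWithin] with ε hε
    exact (h ε hε).norm_add_sq_le M hM

end IsMartingaleIncrement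

end MartingaleIncrement

section Grid

/-- The projection of `x` to the interval `[a, b]`. -/
def clip (a b x : ℝ≥0) : ℝ≥0 := max a (min x b)

lemma clip_mono (a b : ℝ≥0) : Monotone (clip a b) := fun _ _ h =>
  max_le_max le_rfl (min_le_min h le_rfl)

lemma clip_le {a b : ℝ≥0} (hab : a ≤ b) (x : ℝ≥0) : clip a b x ≤ b :=
  max_le hab (min_le_right _ _)

lemma clip_zero (a b : ℝ≥0) : clip a b 0 = a := by simp [clip]

lemma clip_of_ge {a b x : ℝ≥0} (hab : a ≤ b) (hx : b ≤ x) : clip a b x = b := by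
  simp [clip, hx, hab]

lemma clip_eq_or_of_le {a b p q : ℝ≥0} (hab : a ≤ b) (hpq : p ≤ q) :
    clip a b p = clip a b q ∨ (p ≤ clip a b p ∧ p ≤ b ∧ a ≤ q) := by
  rcases le_total b p with hbp | hpb
  · exact .inl (by rw [clip_of_ge hab hbp, clip_of_ge hab (hbp.trans hpq)])
  rcases le_total q a with hqa | haq
  · refine .inl ?_
    rw [clip, clip, max_eq_left ((min_le_left _ _).trans (hpq.trans hqa)),
      max_eq_left ((min_le_left _ _).trans hqa)]
  · exact .inr ⟨le_max_of_le_right (le_min le_rfl hpb), hpb, haq⟩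

/-- The `k`-th point of the grid of mesh `1 / (n + 1)`. -/
def gridPt (n k : ℕ) : ℝ≥0 := k / (n + 1)

lemma gridPt_mono (n : ℕ) : Monotone (gridPt n) := fun k l h => by
  unfold gridPt
  gcongr

lemma gridPt_zero (n : ℕ) : gridPt n 0 = 0 := by simp [gridPt]

lemma gridPt_last (n : ℕ) : gridPt n ((n + 1) ^ 2) = n + 1 := by
  unfold gridPt
  push_cast
  field_simp

lemma gridPt_succ (n k : ℕ) : gridPt n (k + 1) = gridPt n k + 1 / (n + 1) := by
  unfold gridPt
  push_cast
  rw [add_div]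

lemma eventually_le_and_one_div_le (t : ℝ≥0) {δ : ℝ} (hδ : 0 < δ) :
    ∀ᶠ n : ℕ in atTop, t ≤ n + 1 ∧ 1 / ((n : ℝ) + 1) ≤ δ := by
  filter_upwards [(tendsto_natCast_atTop_atTop (R := ℝ≥0)).eventually_ge_atTop t,
    tendsto_one_div_add_atTop_nhds_zero_nat.eventually_le_const hδ] with n ht hn
  exact ⟨ht.trans (by simp), hn⟩

end Grid

section GridSum

variable {Ω : Type*} {mΩ : MeasurableSpace Ω} {ℱ : Filtration ℝ≥0 mΩ} {B : ℝ≥0 → Ω → ℝ}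
  {P : Measure Ω} {a b c : ℝ≥0} {X : Lp ℝ 4 P} {Y Z : ℝ≥0 → Lp ℝ 4 P}

lemma mulIncr_clip_trans (hB : IsFilteredBrownian ℱ B P) {p q : ℝ≥0} (hab : a ≤ b) (hbc : b ≤ c)
    (hpq : p ≤ q) (hX : X ∈ pastL4 ℱ P p) :
    mulIncr B (clip a c p) (clip a c q) X =
      mulIncr B (clip a b p) (clip a b q) X + mulIncr B (clip b c p) (clip b c q) X := by
  have hbelow {x : ℝ≥0} (hx : x ≤ b) : clip a c x = clip a b x ∧ clip b c x = b := by
    simp [clip, hx, hx.trans hbc]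
  have habove {x : ℝ≥0} (hx : b ≤ x) : clip a c x = clip b c x ∧ clip a b x = b := by
    have hxc : b ≤ min x c := le_min hx hbc
    simp [clip, hx, hab, hxc, hab.trans hxc]
  rcases le_total q b with hq | hq
  · rw [(hbelow hq).1, (hbelow hq).2, (hbelow (hpq.trans hq)).1, (hbelow (hpq.trans hq)).2,
      mulIncr_self, add_zero]
  rcases le_total b p with hp | hp
  · rw [(habove hq).1, (habove hq).2, (habove hp).1, (habove hp).2, mulIncr_self, zero_add]
  rw [(habove hq).1, (habove hq).2, (hbelow hp).1, (hbelow hp).2]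
  exact mulIncr_trans hB (clip_le hab p) (le_max_left _ _)
    (pastL4_mono (le_max_of_le_right (le_min le_rfl hp)) hX)

lemma sum_mulIncr (hB : IsFilteredBrownian ℱ B P) {τ : ℕ → ℝ≥0} (hτ : Monotone τ)
    (hX : X ∈ pastL4 ℱ P (τ 0)) (N : ℕ) :
    ∑ k ∈ Finset.range N, mulIncr B (τ k) (τ (k + 1)) X = mulIncr B (τ 0) (τ N) X := by
  induction N with
  | zero => simp [mulIncr_self]
  | succ N ih =>
    rw [Finset.sum_range_succ, ih, ← mulIncr_trans hB (hτ N.zero_le) (hτ N.le_succ) hX]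

/-- The left-point sums of `Y` against `B` over `[a, b]` along the grid of mesh `1 / (n + 1)`; they
only cover the part of `[a, b]` below `n + 1`. -/
def gridSum (B : ℝ≥0 → Ω → ℝ) (Y : ℝ≥0 → Lp ℝ 4 P) (n : ℕ) (a b : ℝ≥0) : Lp ℝ 4 P :=
  ∑ k ∈ Finset.range ((n + 1) ^ 2),
    mulIncr B (clip a b (gridPt n k)) (clip a b (gridPt n (k + 1))) (Y (gridPt n k))

lemma gridSum_self (Y : ℝ≥0 → Lp ℝ 4 P) (n : ℕ) (a : ℝ≥0) : gridSum B Y n a a = 0 := by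
  have h (x : ℝ≥0) : clip a a x = a := by simp [clip]
  simp [gridSum, h, mulIncr_self]

lemma gridSum_trans (hB : IsFilteredBrownian ℱ B P) (hY : ∀ t, Y t ∈ pastL4 ℱ P t) (n : ℕ)
    (hab : a ≤ b) (hbc : b ≤ c) :
    gridSum B Y n a c = gridSum B Y n a b + gridSum B Y n b c := by
  unfold gridSum
  rw [← Finset.sum_add_distrib]
  exact Finset.sum_congr rfl fun k _ =>
    mulIncr_clip_trans hB hab hbc (gridPt_mono n k.le_succ) (hY _)

lemma sum_gridSum (hB : IsFilteredBrownian ℱ B P) (hY : ∀ t, Y t ∈ pastL4 ℱ P t) (n : ℕ)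
    {τ : ℕ → ℝ≥0} (hτ : Monotone τ) (N : ℕ) :
    ∑ k ∈ Finset.range N, gridSum B Y n (τ k) (τ (k + 1)) = gridSum B Y n (τ 0) (τ N) := by
  induction N with
  | zero => simp [gridSum_self]
  | succ N ih =>
    rw [Finset.sum_range_succ, ih, ← gridSum_trans hB hY n (hτ N.zero_le) (hτ N.le_succ)]

lemma gridSum_sub (hB : IsFilteredBrownian ℱ B P) (hY : ∀ t, Y t ∈ pastL4 ℱ P t)
    (hZ : ∀ t, Z t ∈ pastL4 ℱ P t) (n : ℕ) (hab : a ≤ b) :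
    gridSum B (fun t => Y t - Z t) n a b = gridSum B Y n a b - gridSum B Z n a b := by
  unfold gridSum
  rw [← Finset.sum_sub_distrib]
  refine Finset.sum_congr rfl fun k _ => ?_
  have hk := gridPt_mono n k.le_succ
  rcases clip_eq_or_of_le hab hk with heq | ⟨hle, -, -⟩
  · rw [heq]; simp only [mulIncr_self, sub_zero]
  · exact mulIncr_sub hB (clip_mono a b hk) (pastL4_mono hle (hY _)) (pastL4_mono hle (hZ _))

lemma gridSum_mem (hB : IsFilteredBrownian ℱ B P) (hY : ∀ t, Y t ∈ pastL4 ℱ P t) (n : ℕ)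
    (hab : a ≤ b) : gridSum B Y n a b ∈ pastL4 ℱ P b := by
  refine sum_mem fun k _ => ?_
  have hk := gridPt_mono n k.le_succ
  rcases clip_eq_or_of_le hab hk with heq | ⟨hle, -, -⟩
  · rw [heq, mulIncr_self]
    exact zero_mem _
  · exact pastL4_mono (clip_le hab _) (mulIncr_mem hB (clip_mono a b hk) (pastL4_mono hle (hY _)))

variable [IsProbabilityMeasure P]

lemma IsMartingaleIncrement.sum_grid {n : ℕ} (hab : a ≤ b) (hb : b ≤ n + 1) {C : ℝ}
    {D : ℕ → Lp ℝ 4 P}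
    (hzero : ∀ k, clip a b (gridPt n k) = clip a b (gridPt n (k + 1)) → D k = 0)
    (h : ∀ k, gridPt n k ≤ clip a b (gridPt n k) → gridPt n k ≤ b → a ≤ gridPt n (k + 1) →
      IsMartingaleIncrement ℱ (clip a b (gridPt n k)) (clip a b (gridPt n (k + 1)))
        (C * ((clip a b (gridPt n (k + 1)) : ℝ) - clip a b (gridPt n k))) (D k)) :
    IsMartingaleIncrement ℱ a b (C * ((b : ℝ) - a)) (∑ k ∈ Finset.range ((n + 1) ^ 2), D k) := by
  have hsum := IsMartingaleIncrement.sum ((clip_mono a b).comp (gridPt_mono n)) (ℱ := ℱ) (C := C)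
    (D := D) ((n + 1) ^ 2) fun k _ => ?_
  · simpa only [Function.comp_apply, gridPt_zero, clip_zero, gridPt_last, clip_of_ge hab hb]
      using hsum
  · rcases clip_eq_or_of_le hab (gridPt_mono n k.le_succ) with heq | ⟨hle, hkb, hak⟩
    · rw [hzero k heq, Function.comp_apply, Function.comp_apply, ← heq, sub_self, mul_zero]
      exact isMartingaleIncrement_zero _ _
    · exact h k hle hkb hak

lemma isMartingaleIncrement_gridSum_sub_mulIncr (hB : IsFilteredBrownian ℱ B P)
    (hY : ∀ t, Y t ∈ pastL4 ℱ P t) {n : ℕ} (hab : a ≤ b) (hb : b ≤ n + 1)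
    (hX : X ∈ pastL4 ℱ P a) {c : ℝ} (hc : ∀ r ≤ b, a ≤ r + 1 / (n + 1) → ‖Y r - X‖ ≤ c) :
    IsMartingaleIncrement ℱ a b (3 * c ^ 2 * ((b : ℝ) - a))
      (gridSum B Y n a b - mulIncr B a b X) := by
  set τ : ℕ → ℝ≥0 := fun k => clip a b (gridPt n k) with hτ
  have hmono : Monotone τ := (clip_mono a b).comp (gridPt_mono n)
  have hτ0 : τ 0 = a := by simp only [hτ, gridPt_zero, clip_zero]
  have hτN : τ ((n + 1) ^ 2) = b := by simp only [hτ, gridPt_last, clip_of_ge hab hb]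
  have hdiff : gridSum B Y n a b - mulIncr B a b X = ∑ k ∈ Finset.range ((n + 1) ^ 2),
      (mulIncr B (τ k) (τ (k + 1)) (Y (gridPt n k)) - mulIncr B (τ k) (τ (k + 1)) X) := by
    rw [Finset.sum_sub_distrib, sum_mulIncr hB hmono (by rwa [hτ0]), hτ0, hτN]
    rfl
  rw [hdiff]
  refine IsMartingaleIncrement.sum_grid hab hb (fun k hk => ?_) fun k hle hkb hak => ?_
  · have hk' : τ k = τ (k + 1) := hk
    rw [← hk', mulIncr_self, mulIncr_self, sub_zero]
  · have hXk : X ∈ pastL4 ℱ P (τ k) := pastL4_mono (le_max_left _ _) hX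
    have hYk : Y (gridPt n k) ∈ pastL4 ℱ P (τ k) := pastL4_mono hle (hY _)
    rw [← mulIncr_sub hB (hmono k.le_succ) hYk hXk]
    refine (isMartingaleIncrement_mulIncr hB (hmono k.le_succ) (sub_mem hYk hXk)).mono ?_
    have hstep : (0 : ℝ) ≤ (τ (k + 1) : ℝ) - τ k :=
      sub_nonneg.2 (NNReal.coe_le_coe.2 (hmono k.le_succ))
    have hclose := hc _ hkb (by rwa [← gridPt_succ])
    gcongr

lemma isMartingaleIncrement_gridSum_sub_gridSum (hB : IsFilteredBrownian ℱ B P)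
    (hY : ∀ t, Y t ∈ pastL4 ℱ P t) {m n : ℕ} {t : ℝ≥0} (hm : t ≤ m + 1) (hn : t ≤ n + 1)
    {c δ : ℝ} (hmδ : 1 / ((m : ℝ) + 1) ≤ δ) (hnδ : 1 / ((n : ℝ) + 1) ≤ δ)
    (hmod : ∀ r ≤ t, ∀ s ≤ t, |(r : ℝ) - s| ≤ δ → ‖Y r - Y s‖ ≤ c) :
    IsMartingaleIncrement ℱ 0 t (3 * c ^ 2 * (t : ℝ)) (gridSum B Y m 0 t - gridSum B Y n 0 t) := by
  set τ : ℕ → ℝ≥0 := fun k => clip 0 t (gridPt n k) with hτ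
  have hmono : Monotone τ := (clip_mono 0 t).comp (gridPt_mono n)
  have hτ0 : τ 0 = 0 := by simp only [hτ, gridPt_zero, clip_zero]
  have hτN : τ ((n + 1) ^ 2) = t := by simp only [hτ, gridPt_last, clip_of_ge zero_le hn]
  have hdiff : gridSum B Y m 0 t - gridSum B Y n 0 t = ∑ k ∈ Finset.range ((n + 1) ^ 2),
      (gridSum B Y m (τ k) (τ (k + 1)) - mulIncr B (τ k) (τ (k + 1)) (Y (gridPt n k))) := by
    rw [Finset.sum_sub_distrib, sum_gridSum hB hY m hmono, hτ0, hτN]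
    rfl
  rw [hdiff, ← sub_zero (t : ℝ), ← NNReal.coe_zero]
  refine IsMartingaleIncrement.sum_grid zero_le hn (fun k hk => ?_) fun k hle hkt _ => ?_
  · have hk' : τ k = τ (k + 1) := hk
    rw [← hk', mulIncr_self, gridSum_self, sub_zero]
  · refine isMartingaleIncrement_gridSum_sub_mulIncr hB hY (hmono k.le_succ)
      ((clip_le zero_le _).trans hm) (pastL4_mono hle (hY _)) fun r hr hr' => ?_
    refine hmod r (hr.trans (clip_le zero_le _)) _ hkt (abs_le.2 ⟨?_, ?_⟩)
    · have hlow : (gridPt n k : ℝ) ≤ r + 1 / (m + 1) := by exact_mod_cast hle.trans hr'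
      linarith [hlow]
    · have hr'' : r ≤ gridPt n k + 1 / (n + 1) := by
        rw [← gridPt_succ]
        exact hr.trans (max_le zero_le (min_le_left _ _))
      have hupp : (r : ℝ) ≤ gridPt n k + 1 / (n + 1) := by exact_mod_cast hr''
      linarith [hupp]

end GridSum

section Ito

lemma exists_modulus {E : Type*} [SeminormedAddCommGroup E] {Y : ℝ≥0 → E} (hY : Continuous Y)
    (T : ℝ≥0) {ε : ℝ} (hε : 0 < ε) :
    ∃ δ : ℝ, 0 < δ ∧ ∀ r ≤ T, ∀ s ≤ T, |(r : ℝ) - s| ≤ δ → ‖Y r - Y s‖ ≤ ε := by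
  have hunif := (isCompact_Icc (a := 0) (b := T)).uniformContinuousOn_of_continuous
    hY.continuousOn
  obtain ⟨δ, hδ, h⟩ := Metric.uniformContinuousOn_iff.1 hunif ε hε
  refine ⟨δ / 2, half_pos hδ, fun r hr s hs hrs => ?_⟩
  rw [← dist_eq_norm]
  exact (h r ⟨zero_le, hr⟩ s ⟨zero_le, hs⟩ (by rw [NNReal.dist_eq]; linarith)).le

variable {Ω : Type*} {mΩ : MeasurableSpace Ω} {ℱ : Filtration ℝ≥0 mΩ} {B : ℝ≥0 → Ω → ℝ}
  {P : Measure Ω} {a b t : ℝ≥0} {X : Lp ℝ 4 P} {Y Z : ℝ≥0 → Lp ℝ 4 P}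

/-- `Y` is adapted to `ℱ` and continuous as a map to `L⁴(P)`; these are the integrands of the
Itô integral. -/
structure IsContinuousAdapted (ℱ : Filtration ℝ≥0 mΩ) (Y : ℝ≥0 → Lp ℝ 4 P) : Prop where
  mem : ∀ t, Y t ∈ pastL4 ℱ P t
  continuous : Continuous Y

lemma IsContinuousAdapted.sub (hY : IsContinuousAdapted ℱ Y) (hZ : IsContinuousAdapted ℱ Z) :
    IsContinuousAdapted ℱ fun t => Y t - Z t :=
  ⟨fun t => sub_mem (hY.mem t) (hZ.mem t), hY.continuous.sub hZ.continuous⟩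

/-- The Itô integral `∫_0^t Y dB`. -/
def ito (B : ℝ≥0 → Ω → ℝ) (Y : ℝ≥0 → Lp ℝ 4 P) (t : ℝ≥0) : Lp ℝ 4 P :=
  limUnder atTop fun n => gridSum B Y n 0 t

variable [IsProbabilityMeasure P]

lemma cauchySeq_gridSum (hB : IsFilteredBrownian ℱ B P) (hY : IsContinuousAdapted ℱ Y)
    (t : ℝ≥0) : CauchySeq fun n => gridSum B Y n 0 t := by
  rw [Metric.cauchySeq_iff']
  intro ε hε
  obtain ⟨c, hc, hcε⟩ : ∃ c : ℝ, 0 < c ∧ 3 * c ^ 2 * t < ε ^ 2 := by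
    have hsmall : ∀ᶠ c : ℝ in 𝓝[>] 0, 3 * c ^ 2 * t < ε ^ 2 :=
      nhdsWithin_le_nhds (ContinuousAt.eventually_lt (f := fun c : ℝ => 3 * c ^ 2 * t)
        (g := fun _ => ε ^ 2) (by fun_prop) (by fun_prop) (by simp [hε]))
    have hpos : ∀ᶠ c : ℝ in 𝓝[>] 0, 0 < c := self_mem_nhdsWithin
    exact (hpos.and hsmall).exists
  obtain ⟨δ, hδ, hmod⟩ := exists_modulus hY.continuous t hc
  obtain ⟨N, hN⟩ := eventually_atTop.1 (eventually_le_and_one_div_le t hδ)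
  refine ⟨N, fun n hn => ?_⟩
  have hincr := isMartingaleIncrement_gridSum_sub_gridSum hB hY.mem (hN n hn).1 (hN N le_rfl).1
    (hN n hn).2 (hN N le_rfl).2 hmod
  rw [dist_eq_norm]
  exact lt_of_pow_lt_pow_left₀ 2 hε.le (hincr.norm_sq_le.trans_lt hcε)

lemma tendsto_gridSum (hB : IsFilteredBrownian ℱ B P) (hY : IsContinuousAdapted ℱ Y) (t : ℝ≥0) :
    Tendsto (fun n => gridSum B Y n 0 t) atTop (𝓝 (ito B Y t)) :=
  (cauchySeq_gridSum hB hY t).tendsto_limUnder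

lemma ito_mem (hB : IsFilteredBrownian ℱ B P) (hY : IsContinuousAdapted ℱ Y) (t : ℝ≥0) :
    ito B Y t ∈ pastL4 ℱ P t :=
  (isClosed_pastL4 t).mem_of_tendsto (tendsto_gridSum hB hY t)
    (.of_forall fun n => gridSum_mem hB hY.mem n zero_le)

lemma ito_zero (hB : IsFilteredBrownian ℱ B P) (hY : IsContinuousAdapted ℱ Y) : ito B Y 0 = 0 :=
  tendsto_nhds_unique (tendsto_gridSum hB hY 0) (by simp [gridSum_self])

lemma ito_sub (hB : IsFilteredBrownian ℱ B P) (hY : IsContinuousAdapted ℱ Y)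
    (hZ : IsContinuousAdapted ℱ Z) (t : ℝ≥0) :
    ito B (fun s => Y s - Z s) t = ito B Y t - ito B Z t := by
  refine tendsto_nhds_unique (tendsto_gridSum hB (hY.sub hZ) t) ?_
  simp_rw [gridSum_sub hB hY.mem hZ.mem _ (zero_le (a := t))]
  exact (tendsto_gridSum hB hY t).sub (tendsto_gridSum hB hZ t)

lemma isMartingaleIncrement_ito_sub_mulIncr (hB : IsFilteredBrownian ℱ B P)
    (hY : IsContinuousAdapted ℱ Y) (hab : a ≤ b) (hX : X ∈ pastL4 ℱ P a) {c : ℝ}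
    (hc : ∀ r, a ≤ r → r ≤ b → ‖Y r - X‖ ≤ c) :
    IsMartingaleIncrement ℱ a b (3 * c ^ 2 * ((b : ℝ) - a))
      (ito B Y b - ito B Y a - mulIncr B a b X) := by
  refine IsMartingaleIncrement.of_forall_pos fun ε hε => ?_
  have hlim : Tendsto (fun n => gridSum B Y n a b - mulIncr B a b X) atTop
      (𝓝 (ito B Y b - ito B Y a - mulIncr B a b X)) := by
    refine Tendsto.sub_const ?_ _
    refine ((tendsto_gridSum hB hY b).sub (tendsto_gridSum hB hY a)).congr fun n => ?_
    rw [gridSum_trans hB hY.mem n zero_le hab, add_sub_cancel_left]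
  refine IsMartingaleIncrement.of_tendsto hlim ?_
  obtain ⟨δ, hδ, hmod⟩ := exists_modulus hY.continuous b hε
  filter_upwards [eventually_le_and_one_div_le b hδ] with n ⟨hb, hn⟩
  refine isMartingaleIncrement_gridSum_sub_mulIncr hB hY.mem hab hb hX fun r hr hr' => ?_
  rcases le_total a r with har | hra
  · exact (hc r har hr).trans (by linarith)
  · have hupp : (r : ℝ) ≤ a := hra
    have hlow : (a : ℝ) ≤ r + 1 / (n + 1) := by exact_mod_cast hr'
    calc ‖Y r - X‖ = ‖(Y a - X) + (Y r - Y a)‖ := by congr 1; abel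
      _ ≤ ‖Y a - X‖ + ‖Y r - Y a‖ := norm_add_le _ _
      _ ≤ c + ε := add_le_add (hc a le_rfl hab)
        (hmod r hr a hab (abs_le.2 ⟨by linarith [hlow], by linarith [hupp]⟩))

lemma isMartingaleIncrement_ito_sub (hB : IsFilteredBrownian ℱ B P)
    (hY : IsContinuousAdapted ℱ Y) (hab : a ≤ b) {c : ℝ}
    (hc : ∀ r, a ≤ r → r ≤ b → ‖Y r‖ ≤ c) :
    IsMartingaleIncrement ℱ a b (3 * c ^ 2 * ((b : ℝ) - a)) (ito B Y b - ito B Y a) := by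
  have h := isMartingaleIncrement_ito_sub_mulIncr hB hY hab (zero_mem (pastL4 ℱ P a)) (c := c)
    (by simpa using hc)
  rwa [mulIncr_zero hB hab, sub_zero] at h

lemma expect_ito (hB : IsFilteredBrownian ℱ B P) (hY : IsContinuousAdapted ℱ Y) (t : ℝ≥0) :
    expect P (ito B Y t) = 0 := by
  obtain ⟨c, hc⟩ :=
    (isCompact_Icc (a := 0) (b := t)).exists_bound_of_continuousOn hY.continuous.continuousOn
  have h := isMartingaleIncrement_ito_sub hB hY (zero_le (a := t)) fun r h0 ht => hc r ⟨h0, ht⟩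
  rw [ito_zero hB hY, sub_zero] at h
  exact h.mean

end Ito

/-! ### Iterated Stratonovich integrals as sums of iterated Itô and time integrals -/

section TimeIntegral

variable {E : Type*} [NormedAddCommGroup E] {a b t : ℝ≥0} {Y Z : ℝ≥0 → E}

lemma intervalIntegrable_comp_toNNReal (hZ : Continuous Z) (x y : ℝ) :
    IntervalIntegrable (fun r : ℝ => Z r.toNNReal) volume x y :=
  (hZ.comp continuous_real_toNNReal).intervalIntegrable x y

lemma toNNReal_mem_Icc (hab : a ≤ b) {r : ℝ} (hr : r ∈ Set.uIoc (a : ℝ) b) :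
    r.toNNReal ∈ Set.Icc a b := by
  rw [Set.uIoc_of_le (NNReal.coe_le_coe.2 hab)] at hr
  exact ⟨NNReal.le_toNNReal_of_coe_le hr.1.le, Real.toNNReal_le_iff_le_coe.2 hr.2⟩

variable [NormedSpace ℝ E]

/-- The integral `∫_0^t Z_r dr`. -/
def timeInt (Z : ℝ≥0 → E) (t : ℝ≥0) : E := ∫ r in (0 : ℝ)..t, Z r.toNNReal

lemma timeInt_zero (Z : ℝ≥0 → E) : timeInt Z 0 = 0 := by simp [timeInt]

lemma timeInt_sub (hY : Continuous Y) (hZ : Continuous Z) (t : ℝ≥0) :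
    timeInt (fun s => Y s - Z s) t = timeInt Y t - timeInt Z t :=
  intervalIntegral.integral_sub (intervalIntegrable_comp_toNNReal hY _ _)
    (intervalIntegrable_comp_toNNReal hZ _ _)

lemma norm_timeInt_sub_timeInt_le (hZ : Continuous Z) (hab : a ≤ b) {c : ℝ}
    (hc : ∀ r, a ≤ r → r ≤ b → ‖Z r‖ ≤ c) :
    ‖timeInt Z b - timeInt Z a‖ ≤ c * ((b : ℝ) - a) := by
  have hsub : timeInt Z b - timeInt Z a = ∫ r in (a : ℝ)..b, Z r.toNNReal :=
    intervalIntegral.integral_interval_sub_left (intervalIntegrable_comp_toNNReal hZ _ _)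
      (intervalIntegrable_comp_toNNReal hZ _ _)
  have hle := intervalIntegral.norm_integral_le_of_norm_le_const (a := (a : ℝ)) (b := b)
    (f := fun r : ℝ => Z r.toNNReal) fun r hr =>
      hc _ (toNNReal_mem_Icc hab hr).1 (toNNReal_mem_Icc hab hr).2
  rwa [← hsub, abs_of_nonneg (sub_nonneg.2 (NNReal.coe_le_coe.2 hab))] at hle

lemma norm_timeInt_sub_timeInt_sub_smul_le [CompleteSpace E] (hZ : Continuous Z) (hab : a ≤ b)
    {X : E} {c : ℝ} (hc : ∀ r, a ≤ r → r ≤ b → ‖Z r - X‖ ≤ c) :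
    ‖timeInt Z b - timeInt Z a - ((b : ℝ) - a) • X‖ ≤ c * ((b : ℝ) - a) := by
  have hconst (t : ℝ≥0) : timeInt (fun _ => X) t = (t : ℝ) • X := by simp [timeInt]
  have h := norm_timeInt_sub_timeInt_le (Z := fun r => Z r - X) (hZ.sub continuous_const) hab hc
  rw [timeInt_sub hZ continuous_const, timeInt_sub hZ continuous_const, hconst, hconst] at h
  convert h using 2
  rw [sub_smul]
  abel

variable {Ω : Type*} {mΩ : MeasurableSpace Ω} {ℱ : Filtration ℝ≥0 mΩ} {P : Measure Ω}

lemma timeInt_mem {Z : ℝ≥0 → Lp ℝ 4 P} (hZ : IsContinuousAdapted ℱ Z) (t : ℝ≥0) :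
    timeInt Z t ∈ pastL4 ℱ P t := by
  have : CompleteSpace (pastL4 ℱ P t) := (isClosed_pastL4 t).completeSpace_coe
  let Zt : ℝ → pastL4 ℱ P t := fun r =>
    ⟨Z (min r.toNNReal t), pastL4_mono (min_le_right _ _) (hZ.mem _)⟩
  have hZt : Continuous Zt := Continuous.subtype_mk
    (hZ.continuous.comp (continuous_real_toNNReal.min continuous_const)) _
  have hcoe : timeInt Z t = ∫ r in (0 : ℝ)..t, (pastL4 ℱ P t).subtypeL (Zt r) := by
    refine intervalIntegral.integral_congr_ae (.of_forall fun r hr => ?_)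
    simp [Zt, (toNNReal_mem_Icc (zero_le (a := t)) hr).2]
  rw [hcoe, (pastL4 ℱ P t).subtypeL.intervalIntegral_comp_comm (hZt.intervalIntegrable 0 t)]
  exact (∫ r in (0 : ℝ)..t, Zt r).2

lemma expect_timeInt [IsProbabilityMeasure P] {Z : ℝ≥0 → Lp ℝ 4 P} (hZ : Continuous Z)
    (t : ℝ≥0) : expect P (timeInt Z t) = timeInt (fun r => expect P (Z r)) t :=
  ((expect P).intervalIntegral_comp_comm (intervalIntegrable_comp_toNNReal hZ _ _)).symm

end TimeIntegral

section VolterraOp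

variable {Ω : Type*} {mΩ : MeasurableSpace Ω} {ℱ : Filtration ℝ≥0 mΩ} {P : Measure Ω}
  {B : ℝ≥0 → Ω → ℝ} {n m : ℕ}

/-- A linear operation turning continuous functions of `n` variables into adapted processes which
are Hölder continuous of exponent `1/2` in `L⁴`, locally uniformly in terms of the supremum of the
function. -/
structure IsVolterraOp (ℱ : Filtration ℝ≥0 mΩ) (Φ : ((Fin n → ℝ≥0) → ℝ) → ℝ≥0 → Lp ℝ 4 P) :
    Prop where
  mem : ∀ f, Continuous f → ∀ s, Φ f s ∈ pastL4 ℱ P s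
  sub : ∀ f g, Continuous f → Continuous g → ∀ s, Φ (fun x => f x - g x) s = Φ f s - Φ g s
  bound : ∀ T : ℝ≥0, ∃ C : ℝ, 0 ≤ C ∧ ∀ f, Continuous f → ∀ M : ℝ,
    (∀ x, (∀ i, x i ≤ T) → |f x| ≤ M) →
      ‖Φ f 0‖ ≤ C * M ∧
      ∀ a b, a ≤ b → b ≤ T → ‖Φ f b - Φ f a‖ ≤ C * M * √((b : ℝ) - a)

lemma isCompact_cube (n : ℕ) (T : ℝ≥0) : IsCompact {x : Fin n → ℝ≥0 | ∀ i, x i ≤ T} := by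
  have h : {x : Fin n → ℝ≥0 | ∀ i, x i ≤ T} = Set.Icc 0 (fun _ => T) := by
    ext x
    simp [Set.mem_Icc, Pi.le_def]
  rw [h]
  exact isCompact_Icc

lemma eventually_forall_cube_abs_sub_le {α : Type*} [TopologicalSpace α]
    {F : α → (Fin n → ℝ≥0) → ℝ} (hF : Continuous (Function.uncurry F)) (u : α) (T : ℝ≥0) {ε : ℝ}
    (hε : 0 < ε) : ∀ᶠ v in 𝓝 u, ∀ x, (∀ i, x i ≤ T) → |F v x - F u x| ≤ ε := by
  obtain ⟨s, hs, h⟩ := (isCompact_cube n T).mem_uniformity_of_prod (s := Set.univ)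
    hF.continuousOn (Set.mem_univ u) (Metric.dist_mem_uniformity hε)
  rw [nhdsWithin_univ] at hs
  filter_upwards [hs] with v hv x hx
  have hdist := h v hv x hx
  rw [Set.mem_ofPred_eq, Real.dist_eq] at hdist
  exact hdist.le

namespace IsVolterraOp

variable {Φ Ψ : ((Fin n → ℝ≥0) → ℝ) → ℝ≥0 → Lp ℝ 4 P}

lemma exists_norm_le (hΦ : IsVolterraOp ℱ Φ) (T : ℝ≥0) :
    ∃ C : ℝ, 0 ≤ C ∧ ∀ f, Continuous f → ∀ M : ℝ, (∀ x, (∀ i, x i ≤ T) → |f x| ≤ M) →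
      ∀ s ≤ T, ‖Φ f s‖ ≤ C * M := by
  obtain ⟨C, hC, hbound⟩ := hΦ.bound T
  refine ⟨C * (1 + √T), by positivity, fun f hf M hM s hs => ?_⟩
  have hM0 : 0 ≤ M := (abs_nonneg _).trans (hM 0 fun _ => zero_le)
  obtain ⟨hzero, hincr⟩ := hbound f hf M hM
  have hs' : √(s : ℝ) ≤ √T := Real.sqrt_le_sqrt hs
  have hincr' := hincr 0 s zero_le hs
  rw [NNReal.coe_zero, sub_zero] at hincr'
  calc ‖Φ f s‖ = ‖Φ f 0 + (Φ f s - Φ f 0)‖ := by rw [add_sub_cancel]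
    _ ≤ ‖Φ f 0‖ + ‖Φ f s - Φ f 0‖ := norm_add_le _ _
    _ ≤ C * M + C * M * √T := add_le_add hzero (hincr'.trans (by gcongr))
    _ = C * (1 + √T) * M := by ring

lemma continuous_apply (hΦ : IsVolterraOp ℱ Φ) {f : (Fin n → ℝ≥0) → ℝ} (hf : Continuous f) :
    Continuous (Φ f) := by
  rw [continuous_iff_continuousAt]
  intro r
  obtain ⟨C, -, hbound⟩ := hΦ.bound (r + 1)
  obtain ⟨M, hM⟩ := (isCompact_cube n (r + 1)).exists_bound_of_continuousOn hf.continuousOn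
  have hincr := (hbound f hf M fun x hx => hM x hx).2
  have hlim : Tendsto (fun s : ℝ≥0 => C * M * √|(s : ℝ) - r|) (𝓝 r) (𝓝 0) :=
    (Continuous.tendsto (by fun_prop) r).trans_eq (by simp)
  have hr : r < r + 1 := lt_add_of_pos_right r one_pos
  rw [ContinuousAt, tendsto_iff_norm_sub_tendsto_zero]
  refine squeeze_zero' (.of_forall fun _ => norm_nonneg _) ?_ hlim
  filter_upwards [eventually_le_nhds hr] with s hs
  rcases le_total r s with hrs | hsr
  · rw [abs_of_nonneg (sub_nonneg.2 (NNReal.coe_le_coe.2 hrs))]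
    exact hincr r s hrs hs
  · rw [norm_sub_rev, abs_sub_comm, abs_of_nonneg (sub_nonneg.2 (NNReal.coe_le_coe.2 hsr))]
    exact hincr s r hsr hr.le

lemma continuous (hΦ : IsVolterraOp ℱ Φ) {α : Type*} [TopologicalSpace α]
    {F : α → (Fin n → ℝ≥0) → ℝ} (hF : Continuous (Function.uncurry F)) :
    Continuous fun p : α × ℝ≥0 => Φ (F p.1) p.2 := by
  have hFu (u : α) : Continuous (F u) := hF.comp (Continuous.prodMk_right u)
  rw [continuous_iff_continuousAt]
  rintro ⟨u, r⟩
  obtain ⟨C, hC, hbound⟩ := hΦ.exists_norm_le (r + 1)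
  have hfun : Tendsto (fun p : α × ℝ≥0 => Φ (F p.1) p.2 - Φ (F u) p.2) (𝓝 (u, r)) (𝓝 0) := by
    rw [Metric.tendsto_nhds]
    intro ε hε
    have hδ : 0 < ε / (C + 1) := by positivity
    filter_upwards [(continuous_fst.tendsto (u, r)).eventually
        (eventually_forall_cube_abs_sub_le hF u (r + 1) hδ),
      (continuous_snd.tendsto (u, r)).eventually
        (eventually_le_nhds (lt_add_of_pos_right r one_pos))] with p hp hpr
    rw [dist_zero_right, ← hΦ.sub _ _ (hFu _) (hFu _)]
    refine (hbound _ ((hFu _).sub (hFu _)) _ hp _ hpr).trans_lt ?_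
    rw [mul_div_assoc', div_lt_iff₀ (by positivity)]
    linarith
  have htime : Tendsto (fun p : α × ℝ≥0 => Φ (F u) p.2) (𝓝 (u, r)) (𝓝 (Φ (F u) r)) :=
    ((hΦ.continuous_apply (hFu u)).comp continuous_snd).tendsto (u, r)
  simpa [ContinuousAt] using hfun.add htime

lemma isContinuousAdapted (hΦ : IsVolterraOp ℱ Φ) {F : ℝ≥0 → (Fin n → ℝ≥0) → ℝ}
    (hF : Continuous (Function.uncurry F)) : IsContinuousAdapted ℱ fun t => Φ (F t) t :=
  ⟨fun t => hΦ.mem _ (hF.comp (Continuous.prodMk_right t)) t,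
    (hΦ.continuous hF).comp (continuous_id.prodMk continuous_id)⟩

lemma add (hΦ : IsVolterraOp ℱ Φ) (hΨ : IsVolterraOp ℱ Ψ) :
    IsVolterraOp ℱ fun f s => Φ f s + Ψ f s where
  mem f hf s := add_mem (hΦ.mem f hf s) (hΨ.mem f hf s)
  sub f g hf hg s := by rw [hΦ.sub f g hf hg, hΨ.sub f g hf hg]; abel
  bound T := by
    obtain ⟨C, hC, hboundΦ⟩ := hΦ.bound T
    obtain ⟨D, hD, hboundΨ⟩ := hΨ.bound T
    refine ⟨C + D, add_nonneg hC hD, fun f hf M hM => ?_⟩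
    obtain ⟨hΦ0, hΦincr⟩ := hboundΦ f hf M hM
    obtain ⟨hΨ0, hΨincr⟩ := hboundΨ f hf M hM
    refine ⟨?_, fun a b hab hb => ?_⟩
    · rw [add_mul]
      exact (norm_add_le _ _).trans (add_le_add hΦ0 hΨ0)
    · rw [add_sub_add_comm, add_mul, add_mul]
      exact (norm_add_le _ _).trans (add_le_add (hΦincr a b hab hb) (hΨincr a b hab hb))

lemma const_smul (hΦ : IsVolterraOp ℱ Φ) (c : ℝ) : IsVolterraOp ℱ fun f s => c • Φ f s where
  mem f hf s := Submodule.smul_mem _ c (hΦ.mem f hf s)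
  sub f g hf hg s := by rw [hΦ.sub f g hf hg, smul_sub]
  bound T := by
    obtain ⟨C, hC, hbound⟩ := hΦ.bound T
    refine ⟨‖c‖ * C, by positivity, fun f hf M hM => ?_⟩
    obtain ⟨hzero, hincr⟩ := hbound f hf M hM
    refine ⟨?_, fun a b hab hb => ?_⟩
    · rw [norm_smul, mul_assoc]
      gcongr
    · rw [← smul_sub, norm_smul, mul_assoc, mul_assoc, ← mul_assoc C]
      exact mul_le_mul_of_nonneg_left (hincr a b hab hb) (norm_nonneg c)

lemma timeInt (hΦ : IsVolterraOp ℱ Φ) {σ : ℝ≥0 → (Fin n → ℝ≥0) → Fin m → ℝ≥0}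
    (hσ : Continuous (Function.uncurry σ))
    (hσT : ∀ T, ∀ t ≤ T, ∀ x, (∀ i, x i ≤ T) → ∀ i, σ t x i ≤ T) :
    IsVolterraOp ℱ fun (f : (Fin m → ℝ≥0) → ℝ) s =>
      timeInt (fun t => Φ (fun x => f (σ t x)) t) s := by
  have hfσ {f : (Fin m → ℝ≥0) → ℝ} (hf : Continuous f) (t : ℝ≥0) :
      Continuous fun x => f (σ t x) := (hf.comp hσ).comp (Continuous.prodMk_right t)
  have hZ {f : (Fin m → ℝ≥0) → ℝ} (hf : Continuous f) :
      IsContinuousAdapted ℱ fun t => Φ (fun x => f (σ t x)) t :=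
    hΦ.isContinuousAdapted (F := fun t x => f (σ t x)) (hf.comp hσ)
  refine ⟨fun f hf s => timeInt_mem (hZ hf) s, fun f g hf hg s => ?_, fun T => ?_⟩
  · simp_rw [hΦ.sub _ _ (hfσ hf _) (hfσ hg _)]
    exact timeInt_sub (hZ hf).continuous (hZ hg).continuous s
  · obtain ⟨C, hC, hbound⟩ := hΦ.exists_norm_le T
    refine ⟨C * √T, by positivity, fun f hf M hM => ?_⟩
    have hM0 : 0 ≤ M := (abs_nonneg _).trans (hM 0 fun _ => zero_le)
    refine ⟨?_, fun a b hab hb => ?_⟩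
    · rw [timeInt_zero, norm_zero]
      positivity
    · have hle := norm_timeInt_sub_timeInt_le (hZ hf).continuous hab fun r _ hr =>
        hbound _ (hfσ hf r) M (fun x hx => hM _ (hσT T r (hr.trans hb) x hx)) r (hr.trans hb)
      have hba : (0 : ℝ) ≤ (b : ℝ) - a := sub_nonneg.2 (NNReal.coe_le_coe.2 hab)
      have hbT : (b : ℝ) - a ≤ T := (sub_le_self _ a.2).trans (NNReal.coe_le_coe.2 hb)
      calc _ ≤ C * M * ((b : ℝ) - a) := hle
        _ = C * M * (√((b : ℝ) - a) * √((b : ℝ) - a)) := by rw [Real.mul_self_sqrt hba]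
        _ ≤ C * M * (√T * √((b : ℝ) - a)) := by gcongr
        _ = C * √T * M * √((b : ℝ) - a) := by ring

variable [IsProbabilityMeasure P]

lemma const : IsVolterraOp ℱ fun (f : (Fin 0 → ℝ≥0) → ℝ) (_ : ℝ≥0) =>
    Lp.const 4 P (f Fin.elim0) where
  mem f _ s := mem_pastL4.2 (stronglyMeasurable_const.aestronglyMeasurable.congr
    (Lp.coeFn_const 4 P (f Fin.elim0)).symm)
  sub f g _ _ _ := map_sub _ _ _
  bound T := by
    refine ⟨1, zero_le_one, fun f _ M hM => ?_⟩
    have hM' : |f Fin.elim0| ≤ M := hM _ fun i => i.elim0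
    refine ⟨?_, fun a b _ _ => ?_⟩
    · have h := Lp.norm_const_le (μ := P) (p := 4) (c := f Fin.elim0)
      rw [probReal_univ, Real.one_rpow, mul_one] at h
      rw [one_mul]
      exact h.trans hM'
    · rw [sub_self, norm_zero]
      have hM0 := (abs_nonneg _).trans hM'
      positivity

lemma ito (hB : IsFilteredBrownian ℱ B P) (hΦ : IsVolterraOp ℱ Φ)
    {σ : ℝ≥0 → (Fin n → ℝ≥0) → Fin m → ℝ≥0} (hσ : Continuous (Function.uncurry σ))
    (hσT : ∀ T, ∀ t ≤ T, ∀ x, (∀ i, x i ≤ T) → ∀ i, σ t x i ≤ T) :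
    IsVolterraOp ℱ fun (f : (Fin m → ℝ≥0) → ℝ) s =>
      ito B (fun t => Φ (fun x => f (σ t x)) t) s := by
  have hfσ {f : (Fin m → ℝ≥0) → ℝ} (hf : Continuous f) (t : ℝ≥0) :
      Continuous fun x => f (σ t x) := (hf.comp hσ).comp (Continuous.prodMk_right t)
  have hY {f : (Fin m → ℝ≥0) → ℝ} (hf : Continuous f) :
      IsContinuousAdapted ℱ fun t => Φ (fun x => f (σ t x)) t :=
    hΦ.isContinuousAdapted (F := fun t x => f (σ t x)) (hf.comp hσ)
  refine ⟨fun f hf s => ito_mem hB (hY hf) s, fun f g hf hg s => ?_, fun T => ?_⟩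
  · simp_rw [hΦ.sub _ _ (hfσ hf _) (hfσ hg _)]
    exact ito_sub hB (hY hf) (hY hg) s
  · obtain ⟨C, hC, hbound⟩ := hΦ.exists_norm_le T
    refine ⟨2 * C, by positivity, fun f hf M hM => ?_⟩
    have hM0 : 0 ≤ M := (abs_nonneg _).trans (hM 0 fun _ => zero_le)
    refine ⟨?_, fun a b hab hb => ?_⟩
    · rw [ito_zero hB (hY hf), norm_zero]
      positivity
    · have hle := (isMartingaleIncrement_ito_sub hB (hY hf) hab fun r _ hr =>
        hbound _ (hfσ hf r) M (fun x hx => hM _ (hσT T r (hr.trans hb) x hx)) r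
          (hr.trans hb)).norm_sq_le
      have hba : (0 : ℝ) ≤ (b : ℝ) - a := sub_nonneg.2 (NNReal.coe_le_coe.2 hab)
      refine le_of_sq_le_sq (hle.trans ?_) (by positivity)
      rw [mul_pow (2 * C * M), Real.sq_sqrt hba]
      gcongr
      linarith [sq_nonneg (C * M)]

end IsVolterraOp

end VolterraOp

section Strat

variable {Ω : Type*} {mΩ : MeasurableSpace Ω} {ℱ : Filtration ℝ≥0 mΩ} {P : Measure Ω}
  [IsProbabilityMeasure P] {B : ℝ≥0 → Ω → ℝ}

variable (P) in
/-- The iterated Stratonovich integral of a continuous function, defined through the conversion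
to iterated Itô integrals: the correction term is half the time integral over the diagonal on
which the two outermost variables agree. -/
def strat (B : ℝ≥0 → Ω → ℝ) : (n : ℕ) → ((Fin n → ℝ≥0) → ℝ) → ℝ≥0 → Lp ℝ 4 P
  | 0, f, _ => Lp.const 4 P (f Fin.elim0)
  | 1, f, s => ito B (fun t => strat B 0 (fun x => f (Fin.cons t x : Fin 1 → ℝ≥0)) t) s
  | n + 2, f, s =>
      ito B (fun t => strat B (n + 1) (fun x => f (Fin.cons t x : Fin (n + 2) → ℝ≥0)) t) s
        + (1 / 2 : ℝ) • timeInt (fun t => strat B n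
            (fun x => f (Fin.cons t (Fin.cons t x : Fin (n + 1) → ℝ≥0) : Fin (n + 2) → ℝ≥0)) t) s

lemma continuous_finCons (n : ℕ) : Continuous
    (Function.uncurry fun (t : ℝ≥0) (x : Fin n → ℝ≥0) => (Fin.cons t x : Fin (n + 1) → ℝ≥0)) :=
  Continuous.finCons (A := fun _ => ℝ≥0) continuous_fst continuous_snd

lemma finCons_le {n : ℕ} {T t : ℝ≥0} (ht : t ≤ T) {x : Fin n → ℝ≥0} (hx : ∀ i, x i ≤ T)
    (i : Fin (n + 1)) : (Fin.cons t x : Fin (n + 1) → ℝ≥0) i ≤ T := by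
  cases i using Fin.cases with
  | zero => exact ht
  | succ j => exact hx j

lemma continuous_finCons_finCons (n : ℕ) : Continuous (Function.uncurry
    fun (t : ℝ≥0) (x : Fin n → ℝ≥0) =>
      (Fin.cons t (Fin.cons t x : Fin (n + 1) → ℝ≥0) : Fin (n + 2) → ℝ≥0)) :=
  Continuous.finCons (A := fun _ => ℝ≥0) continuous_fst (continuous_finCons n)

lemma isVolterraOp_strat (hB : IsFilteredBrownian ℱ B P) :
    ∀ n, IsVolterraOp ℱ (strat P B n)
  | 0 => by
    simpa only [strat] using IsVolterraOp.const
  | 1 => by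
    simpa only [strat] using (isVolterraOp_strat hB 0).ito hB (continuous_finCons 0)
      fun _ _ ht _ hx => finCons_le ht hx
  | n + 2 => by
    simpa only [strat] using ((isVolterraOp_strat hB (n + 1)).ito hB (continuous_finCons _)
      fun _ _ ht _ hx => finCons_le ht hx).add
      (((isVolterraOp_strat hB n).timeInt (continuous_finCons_finCons n)
        fun _ _ ht _ hx => finCons_le ht (finCons_le ht hx)).const_smul (1 / 2))

end Strat

/-! ### Convergence of trapezoidal sums -/

section SecondMoment

variable {Ω : Type*} {mΩ : MeasurableSpace Ω} {ℱ : Filtration ℝ≥0 mΩ} {B : ℝ≥0 → Ω → ℝ}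
  {P : Measure Ω} {a b : ℝ≥0} {X Z : Lp ℝ 4 P}

instance holderTriple_four_four_two : ENNReal.HolderTriple 4 4 2 := ⟨by
  have hfour : (4 : ENNReal) = 2 * 2 := by norm_num
  rw [hfour, ENNReal.mul_inv (by simp) (by simp), ← two_mul, ← mul_assoc,
    ENNReal.mul_inv_cancel (by simp) (by simp), one_mul]⟩

lemma eLpNorm_two_le_of_integral_sq_le {f : Ω → ℝ} (hf : MemLp f 2 P) {c : ℝ} (hc : 0 ≤ c)
    (h : ∫ ω, f ω ^ 2 ∂P ≤ c ^ 2) : eLpNorm f 2 P ≤ ENNReal.ofReal c := by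
  rw [hf.eLpNorm_eq_integral_rpow_norm (by norm_num) (by norm_num)]
  simp only [ENNReal.toReal_ofNat, Real.rpow_two, Real.norm_eq_abs, sq_abs]
  rw [← one_div, ← Real.sqrt_eq_rpow]
  exact ENNReal.ofReal_le_ofReal ((Real.sqrt_le_left hc).2 h)

lemma eLpNorm_four_coeFn (X : Lp ℝ 4 P) : eLpNorm X 4 P = ENNReal.ofReal ‖X‖ := by
  rw [Lp.norm_def, ENNReal.ofReal_toReal (Lp.eLpNorm_ne_top X)]

lemma memLp_two_coeFn [IsFiniteMeasure P] (X : Lp ℝ 4 P) : MemLp X 2 P :=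
  (Lp.memLp X).mono_exponent (by norm_num)

lemma eLpNorm_two_coeFn_le [IsProbabilityMeasure P] (X : Lp ℝ 4 P) :
    eLpNorm X 2 P ≤ ENNReal.ofReal ‖X‖ :=
  eLpNorm_four_coeFn X ▸
    eLpNorm_le_eLpNorm_of_exponent_le (by norm_num) (Lp.aestronglyMeasurable X)

lemma integral_sq_le [IsProbabilityMeasure P] (X : Lp ℝ 4 P) : ∫ ω, X ω ^ 2 ∂P ≤ ‖X‖ ^ 2 := by
  have hconst : ∫ ω, X ω ^ 2 * (Lp.const 4 P (1 : ℝ)) ω ^ 2 ∂P = ∫ ω, X ω ^ 2 ∂P := by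
    simp
  have hnorm : ‖Lp.const 4 P (1 : ℝ)‖ ≤ 1 := by
    simpa using Lp.norm_const_le (μ := P) (p := 4) (c := (1 : ℝ))
  rw [← hconst]
  exact (integral_sq_mul_sq_le X _).trans
    (mul_le_of_le_one_right (by positivity) (pow_le_one₀ (norm_nonneg _) hnorm))

lemma memLp_four_increment (hB : IsFilteredBrownian ℱ B P) (hab : a ≤ b) :
    MemLp (fun ω => B b ω - B a ω) 4 P := by
  simpa using hB.memLp_increment hab 4

lemma memLp_two_mul_increment (hB : IsFilteredBrownian ℱ B P) (hab : a ≤ b) (X : Lp ℝ 4 P) :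
    MemLp (fun ω => X ω * (B b ω - B a ω)) 2 P :=
  MemLp.mul' (memLp_four_increment hB hab) (Lp.memLp X)

lemma eLpNorm_four_increment_le (hB : IsFilteredBrownian ℱ B P) (hab : a ≤ b) :
    eLpNorm (fun ω => B b ω - B a ω) 4 P ≤ ENNReal.ofReal (2 * √((b : ℝ) - a)) := by
  have hD := memLp_four_increment hB hab
  have hba : (0 : ℝ) ≤ (b : ℝ) - a := sub_nonneg.2 (NNReal.coe_le_coe.2 hab)
  rw [← ENNReal.ofReal_toReal hD.eLpNorm_ne_top, ← Lp.norm_toLp _ hD]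
  refine ENNReal.ofReal_le_ofReal (le_of_pow_le_pow_left₀ (n := 4) (by norm_num) (by positivity) ?_)
  calc ‖hD.toLp‖ ^ 4
      = ∫ ω, (B b ω - B a ω) ^ 4 ∂P := by
        rw [norm_pow_four]
        exact integral_congr_ae (hD.coeFn_toLp.fun_comp (· ^ 4))
    _ = 3 * ((b : ℝ) - a) ^ 2 := hB.integral_increment_four hab
    _ ≤ 16 * ((b : ℝ) - a) ^ 2 := by gcongr; norm_num
    _ = (2 * √((b : ℝ) - a)) ^ 4 := by
        rw [mul_pow, show 4 = 2 * 2 by rfl, pow_mul (√_), Real.sq_sqrt hba]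
        norm_num

lemma eLpNorm_mul_increment_le (hB : IsFilteredBrownian ℱ B P) (hab : a ≤ b) (X : Lp ℝ 4 P) :
    eLpNorm (fun ω => X ω * (B b ω - B a ω)) 2 P
      ≤ ENNReal.ofReal (‖X‖ * (2 * √((b : ℝ) - a))) := by
  rw [ENNReal.ofReal_mul (norm_nonneg X), ← eLpNorm_four_coeFn]
  exact (eLpNorm_smul_le_mul_eLpNorm (memLp_four_increment hB hab).1
    (Lp.aestronglyMeasurable X)).trans (by gcongr; exact eLpNorm_four_increment_le hB hab)

/-- The compensated square `(ΔB)² - Δt` of the increment of `B` over `[a, b]`. -/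
def compensatedSquare (B : ℝ≥0 → Ω → ℝ) (a b : ℝ≥0) (ω : Ω) : ℝ :=
  (B b ω - B a ω) ^ 2 - ((b : ℝ) - a)

lemma integrable_compensatedSquare_sq (hB : IsFilteredBrownian ℱ B P) (hab : a ≤ b) :
    Integrable (fun ω => compensatedSquare B a b ω ^ 2) P := by
  have := hB.isProbabilityMeasure
  have hsq : MemLp (fun ω => (B b ω - B a ω) * (B b ω - B a ω)) 2 P :=
    MemLp.mul' (memLp_four_increment hB hab) (memLp_four_increment hB hab)
  refine (hsq.sub (memLp_const ((b : ℝ) - a))).integrable_sq.congr (.of_forall fun ω => ?_)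
  simp only [Pi.sub_apply, compensatedSquare, sq (B b ω - B a ω)]

lemma integral_compensatedSquare (hB : IsFilteredBrownian ℱ B P) (hab : a ≤ b) :
    ∫ ω, compensatedSquare B a b ω ∂P = 0 := by
  have := hB.isProbabilityMeasure
  simp only [compensatedSquare]
  rw [integral_sub (hB.integrable_increment_pow hab 2) (integrable_const _),
    hB.integral_increment_sq hab, integral_const, probReal_univ, one_smul, sub_self]

lemma integral_compensatedSquare_sq (hB : IsFilteredBrownian ℱ B P) (hab : a ≤ b) :
    ∫ ω, compensatedSquare B a b ω ^ 2 ∂P = 2 * ((b : ℝ) - a) ^ 2 := by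
  have := hB.isProbabilityMeasure
  have hexpand (ω : Ω) : compensatedSquare B a b ω ^ 2 = (B b ω - B a ω) ^ 4
      - 2 * ((b : ℝ) - a) * (B b ω - B a ω) ^ 2 + ((b : ℝ) - a) ^ 2 := by
    rw [compensatedSquare]
    ring
  have hfour := hB.integrable_increment_pow hab 4
  have htwo := (hB.integrable_increment_pow hab 2).const_mul (2 * ((b : ℝ) - a))
  simp only [hexpand]
  rw [integral_add (hfour.sub' htwo) (integrable_const _), integral_sub hfour htwo,
    integral_const_mul, hB.integral_increment_four hab, hB.integral_increment_sq hab,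
    integral_const, probReal_univ, one_smul]
  ring

lemma aestronglyMeasurable_mul_compensatedSquare (hB : IsFilteredBrownian ℱ B P) (hab : a ≤ b)
    (hZ : Z ∈ pastL4 ℱ P a) :
    AEStronglyMeasurable[ℱ b] (fun ω => Z ω * compensatedSquare B a b ω) P :=
  ((mem_pastL4.1 hZ).mono (ℱ.mono hab)).mul
    (((hB.measurable_increment hab).pow_const 2).sub_const _).aestronglyMeasurable

lemma integrable_sq_mul_compensatedSquare_sq (hB : IsFilteredBrownian ℱ B P) (hab : a ≤ b)
    (hZ : Z ∈ pastL4 ℱ P a) :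
    Integrable (fun ω => Z ω ^ 2 * compensatedSquare B a b ω ^ 2) P :=
  have := hB.isProbabilityMeasure
  hB.integrable_mul_increment hab (g := fun x => (x ^ 2 - ((b : ℝ) - a)) ^ 2)
    ((mem_pastL4.1 hZ).pow 2) (memLp_two_coeFn Z).integrable_sq (by fun_prop)
    (integrable_compensatedSquare_sq hB hab)

lemma memLp_two_mul_compensatedSquare (hB : IsFilteredBrownian ℱ B P) (hab : a ≤ b)
    (hZ : Z ∈ pastL4 ℱ P a) : MemLp (fun ω => Z ω * compensatedSquare B a b ω) 2 P := by
  rw [memLp_two_iff_integrable_sq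
    ((aestronglyMeasurable_mul_compensatedSquare hB hab hZ).mono (ℱ.le b))]
  simpa only [mul_pow] using integrable_sq_mul_compensatedSquare_sq hB hab hZ

lemma integral_add_mul_compensatedSquare_sq (hB : IsFilteredBrownian ℱ B P) (hab : a ≤ b)
    {M : Ω → ℝ} (hMa : AEStronglyMeasurable[ℱ a] M P) (hM : MemLp M 2 P)
    (hZ : Z ∈ pastL4 ℱ P a) :
    ∫ ω, (M ω + Z ω * compensatedSquare B a b ω) ^ 2 ∂P
      = ∫ ω, M ω ^ 2 ∂P + (∫ ω, Z ω ^ 2 ∂P) * (2 * ((b : ℝ) - a) ^ 2) := by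
  have := hB.isProbabilityMeasure
  have hexpand (ω : Ω) : (M ω + Z ω * compensatedSquare B a b ω) ^ 2 = M ω ^ 2
      + 2 * (M ω * (Z ω * compensatedSquare B a b ω))
      + Z ω ^ 2 * compensatedSquare B a b ω ^ 2 := by
    ring
  have hcross : ∫ ω, M ω * (Z ω * compensatedSquare B a b ω) ∂P = 0 := by
    have h := hB.integral_mul_increment hab (g := fun x => x ^ 2 - ((b : ℝ) - a))
      (hMa.mul (mem_pastL4.1 hZ)) (by fun_prop)
    simp only [Pi.mul_apply, mul_assoc] at h
    exact h.trans (mul_eq_zero_of_right _ (integral_compensatedSquare hB hab))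
  have hsq : ∫ ω, Z ω ^ 2 * compensatedSquare B a b ω ^ 2 ∂P
      = (∫ ω, Z ω ^ 2 ∂P) * (2 * ((b : ℝ) - a) ^ 2) := by
    rw [← integral_compensatedSquare_sq hB hab]
    exact hB.integral_mul_increment hab (g := fun x => (x ^ 2 - ((b : ℝ) - a)) ^ 2)
      ((mem_pastL4.1 hZ).pow 2) (by fun_prop)
  have hcrossInt : Integrable (fun ω => 2 * (M ω * (Z ω * compensatedSquare B a b ω))) P :=
    (hM.integrable_mul (memLp_two_mul_compensatedSquare hB hab hZ)).const_mul 2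
  simp only [hexpand]
  rw [integral_add (hM.integrable_sq.fun_add hcrossInt)
      (integrable_sq_mul_compensatedSquare_sq hB hab hZ),
    integral_add hM.integrable_sq hcrossInt, integral_const_mul, hcross, hsq, mul_zero, add_zero]

variable {τ : ℕ → ℝ≥0} {W : ℕ → Lp ℝ 4 P}

lemma memLp_two_sum_mul_compensatedSquare (hB : IsFilteredBrownian ℱ B P) (hτ : Monotone τ)
    (hW : ∀ i, W i ∈ pastL4 ℱ P (τ i)) (N : ℕ) :
    MemLp (fun ω => ∑ i ∈ Finset.range N, W i ω * compensatedSquare B (τ i) (τ (i + 1)) ω) 2 P :=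
  memLp_finsetSum _ fun i _ => memLp_two_mul_compensatedSquare hB (hτ i.le_succ) (hW i)

lemma integral_sum_mul_compensatedSquare_sq_le (hB : IsFilteredBrownian ℱ B P)
    (hτ : Monotone τ) (hW : ∀ i, W i ∈ pastL4 ℱ P (τ i)) (N : ℕ) :
    ∫ ω, (∑ i ∈ Finset.range N, W i ω * compensatedSquare B (τ i) (τ (i + 1)) ω) ^ 2 ∂P
      ≤ ∑ i ∈ Finset.range N, ‖W i‖ ^ 2 * (2 * ((τ (i + 1) : ℝ) - τ i) ^ 2) := by
  have := hB.isProbabilityMeasure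
  induction N with
  | zero => simp
  | succ N ih =>
    have hadapted : AEStronglyMeasurable[ℱ (τ N)] (fun ω => ∑ i ∈ Finset.range N,
        W i ω * compensatedSquare B (τ i) (τ (i + 1)) ω) P := by
      rw [← Finset.sum_fn]
      exact Finset.sum_induction _ (AEStronglyMeasurable[ℱ (τ N)] · P) (fun _ _ => .add)
        stronglyMeasurable_zero.aestronglyMeasurable fun i hi =>
          (aestronglyMeasurable_mul_compensatedSquare hB (hτ i.le_succ) (hW i)).mono
            (ℱ.mono (hτ (Finset.mem_range.1 hi)))
    simp only [Finset.sum_range_succ]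
    rw [integral_add_mul_compensatedSquare_sq hB (hτ N.le_succ) hadapted
      (memLp_two_sum_mul_compensatedSquare hB hτ hW N) (hW N)]
    gcongr
    exact integral_sq_le (W N)

end SecondMoment

section Trapezoid

variable {Ω : Type*} {mΩ : MeasurableSpace Ω} {ℱ : Filtration ℝ≥0 mΩ} {B : ℝ≥0 → Ω → ℝ}
  {P : Measure Ω} {a b : ℝ≥0}

lemma sum_coe_sub_coe (τ : ℕ → ℝ≥0) (N : ℕ) :
    ∑ i ∈ Finset.range N, ((τ (i + 1) : ℝ) - τ i) = (τ N : ℝ) - τ 0 :=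
  Finset.sum_range_sub (fun i => (τ i : ℝ)) N

lemma coe_sub_coe_nonneg {τ : ℕ → ℝ≥0} (hτ : Monotone τ) (i : ℕ) :
    (0 : ℝ) ≤ (τ (i + 1) : ℝ) - τ i :=
  sub_nonneg.2 (NNReal.coe_le_coe.2 (hτ i.le_succ))

lemma trapezoid_cell (hB : IsFilteredBrownian ℱ B P) (hab : a ≤ b) {Ya Yb Z A R : Lp ℝ 4 P}
    (hY : Ya ∈ pastL4 ℱ P a) (hZ : Z ∈ pastL4 ℱ P a) (hA : A ∈ pastL4 ℱ P a)
    (h : Yb - Ya = A + mulIncr B a b Z + R) :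
    ∀ᵐ ω ∂P, (Ya ω + Yb ω) / 2 * (B b ω - B a ω) =
      (mulIncr B a b Ya + (1 / 2 : ℝ) • (mulIncr B a b A + ((b : ℝ) - a) • Z)) ω
        + 1 / 2 * (R ω * (B b ω - B a ω) + Z ω * compensatedSquare B a b ω) := by
  rw [sub_eq_iff_eq_add] at h
  filter_upwards [coeFn_mulIncr hB hab hY, coeFn_mulIncr hB hab hZ, coeFn_mulIncr hB hab hA,
    Lp.coeFn_add (A + mulIncr B a b Z + R) Ya, Lp.coeFn_add (A + mulIncr B a b Z) R,
    Lp.coeFn_add A (mulIncr B a b Z),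
    Lp.coeFn_add (mulIncr B a b Ya) ((1 / 2 : ℝ) • (mulIncr B a b A + ((b : ℝ) - a) • Z)),
    Lp.coeFn_smul (1 / 2 : ℝ) (mulIncr B a b A + ((b : ℝ) - a) • Z),
    Lp.coeFn_add (mulIncr B a b A) (((b : ℝ) - a) • Z), Lp.coeFn_smul ((b : ℝ) - a) Z]
    with ω h1 h2 h3 h4 h5 h6 h7 h8 h9 h10
  simp only [h, h4, h5, h6, h7, h8, h9, h10, Pi.add_apply, Pi.smul_apply, smul_eq_mul, h1, h2, h3,
    compensatedSquare]
  ring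

variable {τ : ℕ → ℝ≥0} {N : ℕ} {c : ℝ} {X : ℕ → Lp ℝ 4 P} {Y Z : ℝ≥0 → Lp ℝ 4 P}

lemma eLpNorm_add_half_smul_add_le {f g q : Ω → ℝ} (hf : AEStronglyMeasurable f P)
    (hg : AEStronglyMeasurable g P) (hq : AEStronglyMeasurable q P) :
    eLpNorm (f + (1 / 2 : ℝ) • (g + q)) 2 P
      ≤ eLpNorm f 2 P + ENNReal.ofReal (1 / 2) * (eLpNorm g 2 P + eLpNorm q 2 P) := by
  refine (eLpNorm_add_le hf ((hg.add hq).const_smul _) (by norm_num)).trans ?_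
  rw [eLpNorm_const_smul, ← Real.enorm_eq_ofReal (by norm_num)]
  gcongr
  exact eLpNorm_add_le hg hq (by norm_num)

lemma eLpNorm_sum_mul_increment_le (hB : IsFilteredBrownian ℱ B P) (hτ : Monotone τ) (hc : 0 ≤ c)
    (hX : ∀ i < N, ‖X i‖ ≤ c * √((τ (i + 1) : ℝ) - τ i)) :
    eLpNorm (fun ω => ∑ i ∈ Finset.range N, X i ω * (B (τ (i + 1)) ω - B (τ i) ω)) 2 P
      ≤ ENNReal.ofReal (2 * c * ((τ N : ℝ) - τ 0)) := by
  rw [← Finset.sum_fn, ← sum_coe_sub_coe, Finset.mul_sum, ENNReal.ofReal_sum_of_nonneg fun i _ =>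
    mul_nonneg (by positivity) (coe_sub_coe_nonneg hτ i)]
  refine (eLpNorm_sum_le (fun i _ => (memLp_two_mul_increment hB (hτ i.le_succ) (X i)).1)
    (by norm_num)).trans (Finset.sum_le_sum fun i hi => ?_)
  refine (eLpNorm_mul_increment_le hB (hτ i.le_succ) (X i)).trans (ENNReal.ofReal_le_ofReal ?_)
  calc ‖X i‖ * (2 * √((τ (i + 1) : ℝ) - τ i))
      ≤ c * √((τ (i + 1) : ℝ) - τ i) * (2 * √((τ (i + 1) : ℝ) - τ i)) := by
        gcongr
        exact hX i (Finset.mem_range.1 hi)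
    _ = 2 * c * (√((τ (i + 1) : ℝ) - τ i) * √((τ (i + 1) : ℝ) - τ i)) := by ring
    _ = 2 * c * ((τ (i + 1) : ℝ) - τ i) := by rw [Real.mul_self_sqrt (coe_sub_coe_nonneg hτ i)]

lemma eLpNorm_sum_mul_compensatedSquare_le (hB : IsFilteredBrownian ℱ B P) (hτ : Monotone τ)
    (hX : ∀ i, X i ∈ pastL4 ℱ P (τ i)) {K δ : ℝ} (hK0 : 0 ≤ K) (hK : ∀ i < N, ‖X i‖ ≤ K)
    (hδ : ∀ i < N, (τ (i + 1) : ℝ) - τ i ≤ δ) :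
    eLpNorm (fun ω => ∑ i ∈ Finset.range N, X i ω * compensatedSquare B (τ i) (τ (i + 1)) ω) 2 P
      ≤ ENNReal.ofReal (2 * (K * √(δ * ((τ N : ℝ) - τ 0)))) := by
  refine eLpNorm_two_le_of_integral_sq_le (memLp_two_sum_mul_compensatedSquare hB hτ hX N)
    (by positivity) ?_
  have hcell : ∀ i ∈ Finset.range N, ‖X i‖ ^ 2 * (2 * ((τ (i + 1) : ℝ) - τ i) ^ 2)
      ≤ 2 * K ^ 2 * (δ * ((τ (i + 1) : ℝ) - τ i)) := fun i hi => by
    have hd := coe_sub_coe_nonneg hτ i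
    calc ‖X i‖ ^ 2 * (2 * ((τ (i + 1) : ℝ) - τ i) ^ 2)
        = 2 * ‖X i‖ ^ 2 * (((τ (i + 1) : ℝ) - τ i) * ((τ (i + 1) : ℝ) - τ i)) := by ring
      _ ≤ 2 * K ^ 2 * (δ * ((τ (i + 1) : ℝ) - τ i)) := by
        gcongr
        exacts [hK i (Finset.mem_range.1 hi), hδ i (Finset.mem_range.1 hi)]
  have hsum : ∑ i ∈ Finset.range N, δ * ((τ (i + 1) : ℝ) - τ i) = δ * ((τ N : ℝ) - τ 0) := by
    rw [← Finset.mul_sum, sum_coe_sub_coe]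
  have hδsum : 0 ≤ δ * ((τ N : ℝ) - τ 0) := hsum ▸ Finset.sum_nonneg fun i hi =>
    mul_nonneg ((coe_sub_coe_nonneg hτ i).trans (hδ i (Finset.mem_range.1 hi)))
      (coe_sub_coe_nonneg hτ i)
  calc ∫ ω, (∑ i ∈ Finset.range N, X i ω * compensatedSquare B (τ i) (τ (i + 1)) ω) ^ 2 ∂P
      ≤ ∑ i ∈ Finset.range N, ‖X i‖ ^ 2 * (2 * ((τ (i + 1) : ℝ) - τ i) ^ 2) :=
        integral_sum_mul_compensatedSquare_sq_le hB hτ hX N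
    _ ≤ 2 * K ^ 2 * (δ * ((τ N : ℝ) - τ 0)) := by
        rw [← hsum, Finset.mul_sum]
        exact Finset.sum_le_sum hcell
    _ ≤ 4 * K ^ 2 * (δ * ((τ N : ℝ) - τ 0)) := by gcongr; norm_num
    _ = (2 * (K * √(δ * ((τ N : ℝ) - τ 0)))) ^ 2 := by
        rw [mul_pow, mul_pow, Real.sq_sqrt hδsum]
        ring

lemma norm_sum_timeInt_sub_smul_le (hZ : Continuous Z) (hτ : Monotone τ)
    (hosc : ∀ i < N, ∀ r, τ i ≤ r → r ≤ τ (i + 1) → ‖Z r - Z (τ i)‖ ≤ c) :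
    ‖∑ i ∈ Finset.range N, (timeInt Z (τ (i + 1)) - timeInt Z (τ i)
      - ((τ (i + 1) : ℝ) - τ i) • Z (τ i))‖ ≤ c * ((τ N : ℝ) - τ 0) := by
  rw [← sum_coe_sub_coe, Finset.mul_sum]
  exact norm_sum_le_of_le _ fun i hi => norm_timeInt_sub_timeInt_sub_smul_le hZ (hτ i.le_succ)
    (hosc i (Finset.mem_range.1 hi))

/-- The increment of `Y` over `[a, b]` is that of `∫ Z dB` to first order, up to a part `A` known at
time `a` and of size `c` and a remainder `R` of size `c √(b - a)`. -/
structure IsCellExpansion (ℱ : Filtration ℝ≥0 mΩ) (B : ℝ≥0 → Ω → ℝ) (Y Z : ℝ≥0 → Lp ℝ 4 P)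
    (c : ℝ) (a b : ℝ≥0) (A R : Lp ℝ 4 P) : Prop where
  mem : A ∈ pastL4 ℱ P a
  norm_past_le : ‖A‖ ≤ c
  norm_remainder_le : ‖R‖ ≤ c * √((b : ℝ) - a)
  sub_eq : Y b - Y a = A + mulIncr B a b (Z a) + R

/-- `Y` is controlled by `B` up to time `s` with Gubinelli derivative `Z`: its increments have
expansions with arbitrarily small constants on short intervals. -/
def IsControlledBy (ℱ : Filtration ℝ≥0 mΩ) (B : ℝ≥0 → Ω → ℝ) (Y Z : ℝ≥0 → Lp ℝ 4 P)
    (s : ℝ≥0) : Prop :=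
  ∀ ε : ℝ, 0 < ε → ∃ δ : ℝ, 0 < δ ∧ ∀ a b : ℝ≥0, a ≤ b → b ≤ s → (b : ℝ) - a ≤ δ →
    ∃ A R : Lp ℝ 4 P, IsCellExpansion ℱ B Y Z ε a b A R

variable {A R : ℕ → Lp ℝ 4 P}

lemma trapezoidSum_ae_eq (hB : IsFilteredBrownian ℱ B P) (hY : IsContinuousAdapted ℱ Y)
    (hZ : IsContinuousAdapted ℱ Z) (hτ : Monotone τ)
    (hexp : ∀ i < N, IsCellExpansion ℱ B Y Z c (τ i) (τ (i + 1)) (A i) (R i)) :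
    ∀ᵐ ω ∂P, trapezoidSum B (fun t ω => Y t ω) N τ ω =
      (∑ i ∈ Finset.range N, (mulIncr B (τ i) (τ (i + 1)) (Y (τ i)) + (1 / 2 : ℝ) •
        (mulIncr B (τ i) (τ (i + 1)) (A i) + ((τ (i + 1) : ℝ) - τ i) • Z (τ i))) : Lp ℝ 4 P) ω
      + 1 / 2 * (∑ i ∈ Finset.range N, R i ω * (B (τ (i + 1)) ω - B (τ i) ω)
        + ∑ i ∈ Finset.range N, Z (τ i) ω * compensatedSquare B (τ i) (τ (i + 1)) ω) := by
  have hcell := (Finset.eventually_all (Finset.range N)).2 fun i hi =>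
    trapezoid_cell hB (hτ i.le_succ) (hY.mem _) (hZ.mem _) (hexp i (Finset.mem_range.1 hi)).mem
      (hexp i (Finset.mem_range.1 hi)).sub_eq
  filter_upwards [hcell, Lp.coeFn_fun_finsetSum (Finset.range N) fun i =>
    mulIncr B (τ i) (τ (i + 1)) (Y (τ i)) + (1 / 2 : ℝ) •
      (mulIncr B (τ i) (τ (i + 1)) (A i) + ((τ (i + 1) : ℝ) - τ i) • Z (τ i))] with ω hω hsum
  rw [hsum, trapezoidSum, Finset.sum_congr rfl hω, Finset.sum_add_distrib, ← Finset.mul_sum,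
    Finset.sum_add_distrib]

lemma exists_modulus_partition (hY : Continuous Y) (s : ℝ≥0) {ε : ℝ} (hε : 0 < ε) :
    ∃ δ : ℝ, 0 < δ ∧ ∀ (N : ℕ) (τ : ℕ → ℝ≥0), Monotone τ → τ N ≤ s →
      (∀ i < N, (τ (i + 1) : ℝ) - τ i ≤ δ) →
      ∀ i < N, ∀ r, τ i ≤ r → r ≤ τ (i + 1) → ‖Y r - Y (τ i)‖ ≤ ε := by
  obtain ⟨δ, hδ, h⟩ := exists_modulus hY s hε
  refine ⟨δ, hδ, fun N τ hτ hN hmesh i hi r hr hr' =>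
    h r (hr'.trans ((hτ hi).trans hN)) _ ((hτ hi.le).trans hN) ?_⟩
  rw [abs_of_nonneg (sub_nonneg.2 (NNReal.coe_le_coe.2 hr))]
  exact (sub_le_sub_right (NNReal.coe_le_coe.2 hr') _).trans (hmesh i hi)

lemma IsControlledBy.exists_cellExpansion {s : ℝ≥0} (h : IsControlledBy ℱ B Y Z s) {ε : ℝ}
    (hε : 0 < ε) :
    ∃ δ : ℝ, 0 < δ ∧ ∀ (N : ℕ) (τ : ℕ → ℝ≥0), Monotone τ → τ N ≤ s →
      (∀ i < N, (τ (i + 1) : ℝ) - τ i ≤ δ) →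
      ∃ A R : ℕ → Lp ℝ 4 P, ∀ i < N, IsCellExpansion ℱ B Y Z ε (τ i) (τ (i + 1)) (A i) (R i) := by
  obtain ⟨δ, hδ, h⟩ := h ε hε
  refine ⟨δ, hδ, fun N τ hτ hN hmesh => ?_⟩
  have hcells (i : ℕ) : ∃ A R : Lp ℝ 4 P, i < N →
      IsCellExpansion ℱ B Y Z ε (τ i) (τ (i + 1)) A R := by
    by_cases hi : i < N
    · obtain ⟨A, R, hAR⟩ := h _ _ (hτ i.le_succ) ((hτ hi).trans hN) (hmesh i hi)
      exact ⟨A, R, fun _ => hAR⟩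
    · exact ⟨0, 0, fun hi' => absurd hi' hi⟩
  choose A R hAR using hcells
  exact ⟨A, R, hAR⟩

variable [IsProbabilityMeasure P]

lemma IsMartingaleIncrement.norm_sum_le (hτ : Monotone τ) (hc : 0 ≤ c)
    (h : ∀ i < N, IsMartingaleIncrement ℱ (τ i) (τ (i + 1))
      (3 * c ^ 2 * ((τ (i + 1) : ℝ) - τ i)) (X i)) :
    ‖∑ i ∈ Finset.range N, X i‖ ≤ 2 * c * √((τ N : ℝ) - τ 0) := by
  have hN : (0 : ℝ) ≤ (τ N : ℝ) - τ 0 := sub_nonneg.2 (NNReal.coe_le_coe.2 (hτ N.zero_le))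
  refine le_of_sq_le_sq ?_ (by positivity)
  calc ‖∑ i ∈ Finset.range N, X i‖ ^ 2
      ≤ 3 * c ^ 2 * ((τ N : ℝ) - τ 0) := (IsMartingaleIncrement.sum hτ N h).norm_sq_le
    _ ≤ 4 * c ^ 2 * ((τ N : ℝ) - τ 0) := by gcongr; norm_num
    _ = (2 * c * √((τ N : ℝ) - τ 0)) ^ 2 := by
        rw [mul_pow, Real.sq_sqrt hN]
        ring

lemma norm_sum_ito_sub_mulIncr_le (hB : IsFilteredBrownian ℱ B P) (hY : IsContinuousAdapted ℱ Y)
    (hτ : Monotone τ) (hc : 0 ≤ c)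
    (hosc : ∀ i < N, ∀ r, τ i ≤ r → r ≤ τ (i + 1) → ‖Y r - Y (τ i)‖ ≤ c) :
    ‖∑ i ∈ Finset.range N, (ito B Y (τ (i + 1)) - ito B Y (τ i)
      - mulIncr B (τ i) (τ (i + 1)) (Y (τ i)))‖ ≤ 2 * c * √((τ N : ℝ) - τ 0) :=
  IsMartingaleIncrement.norm_sum_le hτ hc fun i hi =>
    isMartingaleIncrement_ito_sub_mulIncr hB hY (hτ i.le_succ) (hY.mem _) (hosc i hi)

lemma norm_sum_mulIncr_le (hB : IsFilteredBrownian ℱ B P) (hτ : Monotone τ) (hc : 0 ≤ c)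
    (hX : ∀ i < N, X i ∈ pastL4 ℱ P (τ i)) (hXc : ∀ i < N, ‖X i‖ ≤ c) :
    ‖∑ i ∈ Finset.range N, mulIncr B (τ i) (τ (i + 1)) (X i)‖ ≤ 2 * c * √((τ N : ℝ) - τ 0) :=
  IsMartingaleIncrement.norm_sum_le hτ hc fun i hi =>
    (isMartingaleIncrement_mulIncr hB (hτ i.le_succ) (hX i hi)).mono
      (by have := coe_sub_coe_nonneg hτ i; gcongr; exact hXc i hi)

lemma norm_sum_cell_sub_integrals_le (hB : IsFilteredBrownian ℱ B P)
    (hY : IsContinuousAdapted ℱ Y) (hZ : IsContinuousAdapted ℱ Z) (hτ : Monotone τ)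
    (h0 : τ 0 = 0) (hc : 0 ≤ c)
    (hexp : ∀ i < N, IsCellExpansion ℱ B Y Z c (τ i) (τ (i + 1)) (A i) (R i))
    (hYosc : ∀ i < N, ∀ r, τ i ≤ r → r ≤ τ (i + 1) → ‖Y r - Y (τ i)‖ ≤ c)
    (hZosc : ∀ i < N, ∀ r, τ i ≤ r → r ≤ τ (i + 1) → ‖Z r - Z (τ i)‖ ≤ c) :
    ‖∑ i ∈ Finset.range N, (mulIncr B (τ i) (τ (i + 1)) (Y (τ i)) + (1 / 2 : ℝ) •
        (mulIncr B (τ i) (τ (i + 1)) (A i) + ((τ (i + 1) : ℝ) - τ i) • Z (τ i)))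
      - (ito B Y (τ N) + (1 / 2 : ℝ) • timeInt Z (τ N))‖
      ≤ c * (3 * √(τ N : ℝ) + τ N) := by
  have hito := norm_sum_ito_sub_mulIncr_le hB hY hτ hc hYosc
  have hpast := norm_sum_mulIncr_le hB hτ hc (fun i hi => (hexp i hi).mem)
    fun i hi => (hexp i hi).norm_past_le
  have htime := norm_sum_timeInt_sub_smul_le hZ.continuous hτ hZosc
  rw [Finset.sum_sub_distrib, Finset.sum_range_sub fun i => ito B Y (τ i), h0, ito_zero hB hY]
    at hito
  rw [Finset.sum_sub_distrib, Finset.sum_range_sub fun i => timeInt Z (τ i), h0, timeInt_zero]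
    at htime
  rw [h0] at hpast
  simp only [NNReal.coe_zero, sub_zero] at hito hpast htime
  rw [Finset.sum_add_distrib, ← Finset.smul_sum, Finset.sum_add_distrib]
  set I := ∑ i ∈ Finset.range N, mulIncr B (τ i) (τ (i + 1)) (Y (τ i))
  set M := ∑ i ∈ Finset.range N, mulIncr B (τ i) (τ (i + 1)) (A i)
  set J := ∑ i ∈ Finset.range N, ((τ (i + 1) : ℝ) - τ i) • Z (τ i)
  have hsplit : I + (1 / 2 : ℝ) • (M + J) - (ito B Y (τ N) + (1 / 2 : ℝ) • timeInt Z (τ N))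
      = -(ito B Y (τ N) - I) + (1 / 2 : ℝ) • M - (1 / 2 : ℝ) • (timeInt Z (τ N) - J) := by
    module
  calc ‖I + (1 / 2 : ℝ) • (M + J) - (ito B Y (τ N) + (1 / 2 : ℝ) • timeInt Z (τ N))‖
      ≤ ‖ito B Y (τ N) - I‖ + 1 / 2 * ‖M‖ + 1 / 2 * ‖timeInt Z (τ N) - J‖ := by
        rw [hsplit]
        refine (norm_sub_le_of_le (norm_add_le _ _) le_rfl).trans_eq ?_
        rw [norm_neg, norm_smul, norm_smul, Real.norm_of_nonneg (by norm_num)]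
    _ ≤ c * (3 * √(τ N : ℝ) + τ N) := by
        linarith [norm_nonneg (timeInt Z (τ N) - J)]

lemma eLpNorm_trapezoidSum_sub_le (hB : IsFilteredBrownian ℱ B P)
    (hY : IsContinuousAdapted ℱ Y) (hZ : IsContinuousAdapted ℱ Z) (hτ : Monotone τ)
    (h0 : τ 0 = 0) (hc : 0 ≤ c)
    (hexp : ∀ i < N, IsCellExpansion ℱ B Y Z c (τ i) (τ (i + 1)) (A i) (R i))
    (hYosc : ∀ i < N, ∀ r, τ i ≤ r → r ≤ τ (i + 1) → ‖Y r - Y (τ i)‖ ≤ c)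
    (hZosc : ∀ i < N, ∀ r, τ i ≤ r → r ≤ τ (i + 1) → ‖Z r - Z (τ i)‖ ≤ c)
    {K δ : ℝ} (hK0 : 0 ≤ K) (hK : ∀ i < N, ‖Z (τ i)‖ ≤ K)
    (hδ : ∀ i < N, (τ (i + 1) : ℝ) - τ i ≤ δ) :
    eLpNorm (fun ω => trapezoidSum B (fun t ω => Y t ω) N τ ω
        - (ito B Y (τ N) + (1 / 2 : ℝ) • timeInt Z (τ N) : Lp ℝ 4 P) ω) 2 P
      ≤ ENNReal.ofReal (c * (3 * √(τ N : ℝ) + 2 * τ N) + K * √(δ * τ N)) := by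
  have hmain := norm_sum_cell_sub_integrals_le hB hY hZ hτ h0 hc hexp hYosc hZosc
  have hremainder := eLpNorm_sum_mul_increment_le hB hτ hc fun i hi => (hexp i hi).norm_remainder_le
  have hsquare := eLpNorm_sum_mul_compensatedSquare_le hB hτ (fun i => hZ.mem (τ i)) hK0 hK hδ
  rw [h0, NNReal.coe_zero, sub_zero] at hremainder hsquare
  set X : Lp ℝ 4 P := ∑ i ∈ Finset.range N, (mulIncr B (τ i) (τ (i + 1)) (Y (τ i)) + (1 / 2 : ℝ) •
    (mulIncr B (τ i) (τ (i + 1)) (A i) + ((τ (i + 1) : ℝ) - τ i) • Z (τ i)))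
  set I : Lp ℝ 4 P := ito B Y (τ N) + (1 / 2 : ℝ) • timeInt Z (τ N)
  set g : Ω → ℝ := fun ω => ∑ i ∈ Finset.range N, R i ω * (B (τ (i + 1)) ω - B (τ i) ω)
  set q : Ω → ℝ := fun ω => ∑ i ∈ Finset.range N,
    Z (τ i) ω * compensatedSquare B (τ i) (τ (i + 1)) ω
  have hgm : AEStronglyMeasurable g P := (memLp_finsetSum _ fun i _ =>
    memLp_two_mul_increment hB (hτ i.le_succ) (R i)).1
  have hqm : AEStronglyMeasurable q P :=
    (memLp_two_sum_mul_compensatedSquare hB hτ (fun i => hZ.mem (τ i)) N).1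
  have hsplit : (fun ω => trapezoidSum B (fun t ω => Y t ω) N τ ω - I ω) =ᵐ[P]
      ⇑(X - I) + (1 / 2 : ℝ) • (g + q) := by
    filter_upwards [trapezoidSum_ae_eq hB hY hZ hτ hexp, Lp.coeFn_sub X I] with ω hω hsub
    rw [hω, Pi.add_apply, hsub, Pi.smul_apply, Pi.add_apply, Pi.sub_apply, smul_eq_mul]
    ring
  calc eLpNorm (fun ω => trapezoidSum B (fun t ω => Y t ω) N τ ω - I ω) 2 P
      ≤ eLpNorm (X - I) 2 P + ENNReal.ofReal (1 / 2) * (eLpNorm g 2 P + eLpNorm q 2 P) := by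
        rw [eLpNorm_congr_ae hsplit]
        exact eLpNorm_add_half_smul_add_le (Lp.aestronglyMeasurable _) hgm hqm
    _ ≤ ENNReal.ofReal (c * (3 * √(τ N : ℝ) + τ N)) + ENNReal.ofReal (1 / 2) *
          (ENNReal.ofReal (2 * c * τ N) + ENNReal.ofReal (2 * (K * √(δ * τ N)))) := by
        gcongr
        exact (eLpNorm_two_coeFn_le _).trans (ENNReal.ofReal_le_ofReal hmain)
    _ = ENNReal.ofReal (c * (3 * √(τ N : ℝ) + 2 * τ N) + K * √(δ * τ N)) := by
        rw [← ENNReal.ofReal_add, ← ENNReal.ofReal_mul, ← ENNReal.ofReal_add] <;> try positivity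
        congr 1
        ring

/-- Conversion from Stratonovich to Itô form: the correction is half the bracket of `Y` and `B`. -/
theorem isStratonovichIntegral_of_isControlledBy (hB : IsFilteredBrownian ℱ B P)
    (hY : IsContinuousAdapted ℱ Y) (hZ : IsContinuousAdapted ℱ Z) {s : ℝ≥0}
    (hYZ : IsControlledBy ℱ B Y Z s) :
    IsStratonovichIntegral B P s (fun t ω => Y t ω)
      (ito B Y s + (1 / 2 : ℝ) • timeInt Z s : Lp ℝ 4 P) := by
  refine ⟨memLp_two_coeFn _, fun ε hε => ?_⟩
  obtain ⟨K, hK⟩ := (isCompact_Icc (a := 0) (b := s)).exists_bound_of_continuousOn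
    hZ.continuous.continuousOn
  have hK0 : 0 ≤ K := (norm_nonneg _).trans (hK 0 ⟨le_rfl, zero_le⟩)
  set c : ℝ := ε / 2 / (3 * √s + 2 * s + 1) with hc
  have hc0 : 0 < c := by positivity
  obtain ⟨δ₁, hδ₁, hYosc⟩ := exists_modulus_partition hY.continuous s hc0
  obtain ⟨δ₂, hδ₂, hZosc⟩ := exists_modulus_partition hZ.continuous s hc0
  obtain ⟨δ₃, hδ₃, hexp⟩ := hYZ.exists_cellExpansion hc0
  set δ₄ : ℝ := (ε / 2) ^ 2 / (K ^ 2 * s + 1) with hδ₄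
  refine ⟨min (min δ₁ δ₂) (min δ₃ δ₄), by positivity, fun N τ hτ h0 hN hmesh => ?_⟩
  simp only [le_min_iff] at hmesh
  obtain ⟨A, R, hAR⟩ := hexp N τ hτ hN.le fun i hi => (hmesh i hi).2.1
  have hbound := eLpNorm_trapezoidSum_sub_le hB hY hZ hτ h0 hc0.le hAR
    (hYosc N τ hτ hN.le fun i hi => (hmesh i hi).1.1)
    (hZosc N τ hτ hN.le fun i hi => (hmesh i hi).1.2)
    hK0 (fun i hi => hK _ ⟨zero_le, hN ▸ hτ hi.le⟩) (fun i hi => (hmesh i hi).2.2)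
  rw [hN] at hbound
  refine hbound.trans (ENNReal.ofReal_le_ofReal ?_)
  have hfirst : c * (3 * √s + 2 * s) ≤ ε / 2 := by
    rw [hc, div_mul_eq_mul_div, div_le_iff₀ (by positivity)]
    exact mul_le_mul_of_nonneg_left (by linarith) (by positivity)
  have hsecond : K * √(δ₄ * s) ≤ ε / 2 := by
    refine le_of_sq_le_sq ?_ (by positivity)
    rw [mul_pow, Real.sq_sqrt (by positivity), hδ₄, div_mul_eq_mul_div, mul_div_assoc',
      div_le_iff₀ (by positivity)]
    nlinarith [sq_nonneg (ε / 2)]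
  linarith

end Trapezoid

/-! ### Existence and expectation of the iterated Stratonovich integrals -/

section Existence

variable {Ω : Type*} {mΩ : MeasurableSpace Ω} {ℱ : Filtration ℝ≥0 mΩ} {P : Measure Ω}
  [IsProbabilityMeasure P] {B : ℝ≥0 → Ω → ℝ}

lemma exists_modulus_prod {E : Type*} [SeminormedAddCommGroup E] {G : ℝ≥0 × ℝ≥0 → E}
    (hG : Continuous G) (T : ℝ≥0) {ε : ℝ} (hε : 0 < ε) :
    ∃ δ : ℝ, 0 < δ ∧ ∀ u ≤ T, ∀ r ≤ T, ∀ v ≤ T, ∀ w ≤ T,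
      |(u : ℝ) - v| ≤ δ → |(r : ℝ) - w| ≤ δ → ‖G (u, r) - G (v, w)‖ ≤ ε := by
  have hcompact : IsCompact (Set.Icc 0 T ×ˢ Set.Icc 0 T) := isCompact_Icc.prod isCompact_Icc
  obtain ⟨δ, hδ, h⟩ := Metric.uniformContinuousOn_iff_le.1
    (hcompact.uniformContinuousOn_of_continuous hG.continuousOn) ε hε
  refine ⟨δ, hδ, fun u hu r hr v hv w hw huv hrw => ?_⟩
  rw [← dist_eq_norm]
  refine h (u, r) ⟨⟨zero_le, hu⟩, zero_le, hr⟩ (v, w) ⟨⟨zero_le, hv⟩, zero_le, hw⟩ ?_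
  rw [Prod.dist_eq, NNReal.dist_eq, NNReal.dist_eq]
  exact max_le huv hrw

lemma isCellExpansion_of_ito_add_timeInt (hB : IsFilteredBrownian ℱ B P)
    {Y Z W U : ℝ≥0 → Lp ℝ 4 P} {A : Lp ℝ 4 P} {a b : ℝ≥0} {ε K : ℝ} (hab : a ≤ b) (hε : 0 < ε)
    (hsub : Y b - Y a = A + (ito B W b - ito B W a) + (1 / 2 : ℝ) • (timeInt U b - timeInt U a))
    (hA : A ∈ pastL4 ℱ P a) (hAε : ‖A‖ ≤ ε) (hZ : Z a ∈ pastL4 ℱ P a)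
    (hW : IsContinuousAdapted ℱ W) (hWZ : ∀ r, a ≤ r → r ≤ b → ‖W r - Z a‖ ≤ ε / 4)
    (hU : Continuous U) (hUK : ∀ r, a ≤ r → r ≤ b → ‖U r‖ ≤ K)
    (hK : K * √((b : ℝ) - a) ≤ ε) :
    IsCellExpansion ℱ B Y Z ε a b A ((ito B W b - ito B W a - mulIncr B a b (Z a))
      + (1 / 2 : ℝ) • (timeInt U b - timeInt U a)) := by
  have hba : (0 : ℝ) ≤ (b : ℝ) - a := sub_nonneg.2 (NNReal.coe_le_coe.2 hab)
  have hito : ‖ito B W b - ito B W a - mulIncr B a b (Z a)‖ ≤ ε / 2 * √((b : ℝ) - a) := by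
    refine le_of_sq_le_sq
      ((isMartingaleIncrement_ito_sub_mulIncr hB hW hab hZ hWZ).norm_sq_le.trans ?_)
      (by positivity)
    rw [mul_pow, Real.sq_sqrt hba]
    nlinarith [mul_nonneg (sq_nonneg ε) hba]
  have htime : ‖(1 / 2 : ℝ) • (timeInt U b - timeInt U a)‖ ≤ ε / 2 * √((b : ℝ) - a) := by
    rw [norm_smul, Real.norm_of_nonneg (by norm_num)]
    calc 1 / 2 * ‖timeInt U b - timeInt U a‖
        ≤ 1 / 2 * (K * ((b : ℝ) - a)) := by
          gcongr
          exact norm_timeInt_sub_timeInt_le hU hab hUK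
      _ = 1 / 2 * (K * √((b : ℝ) - a) * √((b : ℝ) - a)) := by
          rw [mul_assoc K, Real.mul_self_sqrt hba]
      _ ≤ 1 / 2 * (ε * √((b : ℝ) - a)) := by gcongr
      _ = ε / 2 * √((b : ℝ) - a) := by ring
  refine ⟨hA, hAε, (norm_add_le_of_le hito htime).trans_eq (by ring), ?_⟩
  rw [hsub]
  abel

variable (P) in
/-- The density of the Stratonovich-to-Itô correction term of `strat P B (n + 1) f`, twice the
integrand of its time integral; there is none for a single integral. -/
def stratCorrection (B : ℝ≥0 → Ω → ℝ) :
    (n : ℕ) → ((Fin (n + 1) → ℝ≥0) → ℝ) → ℝ≥0 → Lp ℝ 4 P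
  | 0, _, _ => 0
  | n + 1, f, t =>
      strat P B n (fun x => f (Fin.cons t (Fin.cons t x : Fin (n + 1) → ℝ≥0))) t

lemma strat_succ (n : ℕ) (f : (Fin (n + 1) → ℝ≥0) → ℝ) (s : ℝ≥0) :
    strat P B (n + 1) f s = ito B (fun t => strat P B n (fun x => f (Fin.cons t x)) t) s
      + (1 / 2 : ℝ) • timeInt (stratCorrection P B n f) s := by
  cases n with
  | zero => simp [strat, timeInt, stratCorrection]
  | succ n => rw [strat]; rfl

lemma isContinuousAdapted_strat_cons (hB : IsFilteredBrownian ℱ B P) {n : ℕ}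
    {f : (Fin (n + 1) → ℝ≥0) → ℝ} (hf : Continuous f) :
    IsContinuousAdapted ℱ fun t => strat P B n (fun x => f (Fin.cons t x)) t :=
  (isVolterraOp_strat hB n).isContinuousAdapted (F := fun t x => f (Fin.cons t x))
    (hf.comp (continuous_finCons n))

lemma isContinuousAdapted_stratCorrection (hB : IsFilteredBrownian ℱ B P) {n : ℕ}
    {f : (Fin (n + 1) → ℝ≥0) → ℝ} (hf : Continuous f) :
    IsContinuousAdapted ℱ (stratCorrection P B n f) := by
  cases n with
  | zero => exact ⟨fun t => zero_mem _, continuous_const⟩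
  | succ n =>
    exact (isVolterraOp_strat hB n).isContinuousAdapted
      (F := fun t x => f (Fin.cons t (Fin.cons t x : Fin (n + 1) → ℝ≥0)))
      (hf.comp (continuous_finCons_finCons n))

lemma exists_norm_stratCorrection_le (hB : IsFilteredBrownian ℱ B P) (n : ℕ) (T : ℝ≥0) :
    ∃ C : ℝ, 0 ≤ C ∧ ∀ f, Continuous f → ∀ M : ℝ, (∀ x, (∀ i, x i ≤ T) → |f x| ≤ M) →
      ∀ t ≤ T, ‖stratCorrection P B n f t‖ ≤ C * M := by
  cases n with
  | zero => exact ⟨0, le_rfl, fun f _ M _ t _ => by simp [stratCorrection]⟩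
  | succ n =>
    obtain ⟨C, hC, hbound⟩ := (isVolterraOp_strat hB n).exists_norm_le T
    exact ⟨C, hC, fun f hf M hM t ht => hbound _
      ((hf.comp (continuous_finCons_finCons n)).comp (Continuous.prodMk_right t)) M
      (fun x hx => hM _ (finCons_le ht (finCons_le ht hx))) t ht⟩

lemma isControlledBy_strat_cons_zero (hB : IsFilteredBrownian ℱ B P)
    {f : (Fin 1 → ℝ≥0) → ℝ} (hf : Continuous f) (s : ℝ≥0) :
    IsControlledBy ℱ B (fun t => strat P B 0 (fun x => f (Fin.cons t x)) t)
      (stratCorrection P B 0 f) s := by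
  intro ε hε
  have hY := isContinuousAdapted_strat_cons hB hf
  have hY0 (t r : ℝ≥0) : strat P B 0 (fun x => f (Fin.cons t x)) t ∈ pastL4 ℱ P r :=
    (isVolterraOp_strat hB 0).mem _
      ((hf.comp (continuous_finCons 0)).comp (Continuous.prodMk_right t)) r
  obtain ⟨δ, hδ, hmod⟩ := exists_modulus hY.continuous s hε
  refine ⟨δ, hδ, fun a b hab hb hd => ⟨_, 0, sub_mem (hY0 b a) (hY0 a a), ?_, ?_, ?_⟩⟩
  · refine hmod b hb a (hab.trans hb) ?_
    rwa [abs_of_nonneg (sub_nonneg.2 (NNReal.coe_le_coe.2 hab))]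
  · rw [norm_zero]
    positivity
  · simp only [stratCorrection, mulIncr_zero hB hab, add_zero]

lemma continuous_strat_cons_cons (hB : IsFilteredBrownian ℱ B P) (n : ℕ)
    {f : (Fin (n + 2) → ℝ≥0) → ℝ} (hf : Continuous f) :
    Continuous fun p : ℝ≥0 × ℝ≥0 => strat P B n
      (fun x => f (Fin.cons p.1 (Fin.cons p.2 x : Fin (n + 1) → ℝ≥0))) p.2 := by
  have hcons : Continuous (Function.uncurry fun (p : ℝ≥0 × ℝ≥0) (x : Fin n → ℝ≥0) =>
      f (Fin.cons p.1 (Fin.cons p.2 x : Fin (n + 1) → ℝ≥0))) :=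
    hf.comp (Continuous.finCons (A := fun _ => ℝ≥0) (continuous_fst.comp continuous_fst)
      (Continuous.finCons (A := fun _ => ℝ≥0) (continuous_snd.comp continuous_fst)
        continuous_snd))
  exact ((isVolterraOp_strat hB n).continuous hcons).comp (continuous_id.prodMk continuous_snd)

lemma isControlledBy_strat_cons_succ (hB : IsFilteredBrownian ℱ B P) (n : ℕ)
    {f : (Fin (n + 2) → ℝ≥0) → ℝ} (hf : Continuous f) (s : ℝ≥0) :
    IsControlledBy ℱ B (fun t => strat P B (n + 1) (fun x => f (Fin.cons t x)) t)
      (stratCorrection P B (n + 1) f) s := by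
  intro ε hε
  -- `G₁` and `G₂` separate the outermost variable of the integrand from the time of integration.
  set G₁ : ℝ≥0 × ℝ≥0 → Lp ℝ 4 P :=
    fun p => strat P B (n + 1) (fun x => f (Fin.cons p.1 x)) p.2
  set G₂ : ℝ≥0 × ℝ≥0 → Lp ℝ 4 P := fun p => strat P B n
    (fun x => f (Fin.cons p.1 (Fin.cons p.2 x : Fin (n + 1) → ℝ≥0))) p.2
  have hf₁ (u : ℝ≥0) : Continuous fun x : Fin (n + 1) → ℝ≥0 => f (Fin.cons u x) :=
    (hf.comp (continuous_finCons (n + 1))).comp (Continuous.prodMk_right u)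
  have hG₁c : Continuous G₁ := (isVolterraOp_strat hB (n + 1)).continuous
    (F := fun u x => f (Fin.cons u x)) (hf.comp (continuous_finCons (n + 1)))
  have hG₁m (u r : ℝ≥0) : G₁ (u, r) ∈ pastL4 ℱ P r :=
    (isVolterraOp_strat hB (n + 1)).mem _ (hf₁ u) r
  obtain ⟨C, hC, hbound⟩ := exists_norm_stratCorrection_le (P := P) hB n s
  obtain ⟨M, hM⟩ := (isCompact_cube (n + 2) s).exists_bound_of_continuousOn hf.continuousOn
  have hCM : 0 ≤ C * M := mul_nonneg hC ((norm_nonneg _).trans (hM 0 fun _ => zero_le))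
  obtain ⟨δ₁, hδ₁, hmod₁⟩ := exists_modulus_prod hG₁c s hε
  obtain ⟨δ₂, hδ₂, hmod₂⟩ := exists_modulus_prod (continuous_strat_cons_cons hB n hf) s
    (show 0 < ε / 4 by positivity)
  refine ⟨min (min δ₁ δ₂) ((ε / (C * M + 1)) ^ 2), by positivity, fun a b hab hb hd => ?_⟩
  have ha : a ≤ s := hab.trans hb
  have hba : |(b : ℝ) - a| = b - a := abs_of_nonneg (sub_nonneg.2 (NNReal.coe_le_coe.2 hab))
  simp only [le_min_iff] at hd
  refine ⟨G₁ (b, a) - G₁ (a, a), _, isCellExpansion_of_ito_add_timeInt hB (K := C * M)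
    (W := fun r => G₂ (b, r)) (U := stratCorrection P B n fun x => f (Fin.cons b x)) hab hε
    ?_ (sub_mem (hG₁m b a) (hG₁m a a))
    (hmod₁ b hb a ha a ha a ha (hba.trans_le hd.1.1) (by simpa using hδ₁.le))
    ((isContinuousAdapted_stratCorrection hB hf).mem a)
    (isContinuousAdapted_strat_cons hB (hf₁ b)) (fun r har hrb => ?_)
    (isContinuousAdapted_stratCorrection hB (hf₁ b)).continuous
    (fun r _ hrb => hbound _ (hf₁ b) M (fun x hx => hM _ (finCons_le hb hx)) r (hrb.trans hb)) ?_⟩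
  · have hfrozen (t : ℝ≥0) : G₁ (b, t) = ito B (fun r => G₂ (b, r)) t
        + (1 / 2 : ℝ) • timeInt (stratCorrection P B n fun x => f (Fin.cons b x)) t :=
      strat_succ n _ t
    change G₁ (b, b) - G₁ (a, a) = _
    rw [hfrozen b, hfrozen a]
    module
  · refine hmod₂ b hb r (hrb.trans hb) a ha a ha (hba.trans_le hd.1.2) ?_
    rw [abs_of_nonneg (sub_nonneg.2 (NNReal.coe_le_coe.2 har))]
    exact (sub_le_sub_right (NNReal.coe_le_coe.2 hrb) _).trans hd.1.2
  · have hsqrt : √((b : ℝ) - a) ≤ ε / (C * M + 1) := (Real.sqrt_le_left (by positivity)).2 hd.2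
    rw [le_div_iff₀ (by positivity)] at hsqrt
    nlinarith [Real.sqrt_nonneg ((b : ℝ) - a)]

lemma isStratonovichIntegral_strat (hB : IsFilteredBrownian ℱ B P) (n : ℕ)
    {f : (Fin (n + 1) → ℝ≥0) → ℝ} (hf : Continuous f) (s : ℝ≥0) :
    IsStratonovichIntegral B P s (fun t ω => strat P B n (fun x => f (Fin.cons t x)) t ω)
      (strat P B (n + 1) f s) := by
  rw [strat_succ]
  refine isStratonovichIntegral_of_isControlledBy hB (isContinuousAdapted_strat_cons hB hf)
    (isContinuousAdapted_stratCorrection hB hf) ?_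
  cases n with
  | zero => exact isControlledBy_strat_cons_zero hB hf s
  | succ n => exact isControlledBy_strat_cons_succ hB n hf s

theorem isIteratedStratonovich_strat (hB : IsFilteredBrownian ℱ B P) (n : ℕ)
    {f : (Fin n → ℝ≥0) → ℝ} (hf : Continuous f) (s : ℝ≥0) :
    IsIteratedStratonovich B P n f s (strat P B n f s) := by
  induction n generalizing s with
  | zero => exact Lp.coeFn_const 4 P (f Fin.elim0)
  | succ n ih =>
    exact ⟨_, fun t _ => ih ((hf.comp (continuous_finCons n)).comp (Continuous.prodMk_right t)) t,
      isStratonovichIntegral_strat hB n hf s⟩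

lemma expect_strat_zero (f : (Fin 0 → ℝ≥0) → ℝ) (s : ℝ≥0) :
    expect P (strat P B 0 f s) = f Fin.elim0 := by
  rw [strat, expect_apply, integral_congr_ae (Lp.coeFn_const 4 P (f Fin.elim0))]
  simp

lemma expect_strat_add_two (hB : IsFilteredBrownian ℱ B P) (n : ℕ)
    {f : (Fin (n + 2) → ℝ≥0) → ℝ} (hf : Continuous f) (s : ℝ≥0) :
    expect P (strat P B (n + 2) f s) = 1 / 2 * timeInt (fun t => expect P (strat P B n
      (fun x => f (Fin.cons t (Fin.cons t x : Fin (n + 1) → ℝ≥0))) t)) s := by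
  rw [strat_succ, map_add, expect_ito hB (isContinuousAdapted_strat_cons hB hf), map_smul,
    expect_timeInt (isContinuousAdapted_stratCorrection hB hf).continuous, zero_add, smul_eq_mul]
  rfl

lemma expect_strat_four (hB : IsFilteredBrownian ℱ B P)
    {f : (Fin 4 → ℝ≥0) → ℝ} (hf : Continuous f) (s : ℝ≥0) :
    expect P (strat P B 4 f s)
      = 1 / 4 * timeInt (fun t => timeInt (fun r => f ![t, t, r, r]) t) s := by
  have hinner (t : ℝ≥0) :
      expect P (strat P B 2 (fun x => f (Fin.cons t (Fin.cons t x : Fin 3 → ℝ≥0))) t)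
        = 1 / 2 * timeInt (fun r => f ![t, t, r, r]) t := by
    have hcons : Continuous fun x : Fin 2 → ℝ≥0 => f (Fin.cons t (Fin.cons t x : Fin 3 → ℝ≥0)) :=
      (hf.comp (continuous_finCons_finCons 2)).comp (Continuous.prodMk_right t)
    rw [expect_strat_add_two hB 0 hcons]
    have hdiag (r : ℝ≥0) : (Fin.cons t (Fin.cons t (Fin.cons r (Fin.cons r Fin.elim0 :
        Fin 1 → ℝ≥0) : Fin 2 → ℝ≥0) : Fin 3 → ℝ≥0) : Fin 4 → ℝ≥0) = ![t, t, r, r] := by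
      ext i
      fin_cases i <;> rfl
    simp only [expect_strat_zero, hdiag]
  rw [expect_strat_add_two hB 2 hf]
  simp only [hinner]
  rw [timeInt, timeInt, intervalIntegral.integral_const_mul]
  ring

end Existence

/-! ### Uniqueness of the iterated Stratonovich integrals -/

section Uniqueness

variable {Ω : Type*}

lemma aestronglyMeasurable_trapezoidSum [MeasurableSpace Ω] {P : Measure Ω}
    {B Y : ℝ≥0 → Ω → ℝ} (hB : ∀ t, AEStronglyMeasurable (B t) P) {k : ℕ} {τ : ℕ → ℝ≥0}
    (hY : ∀ i ≤ k, AEStronglyMeasurable (Y (τ i)) P) :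
    AEStronglyMeasurable (trapezoidSum B Y k τ) P := by
  refine Finset.aestronglyMeasurable_fun_sum _ fun i hi => ?_
  have hik : i < k := Finset.mem_range.1 hi
  simp only [div_eq_mul_inv]
  exact (((hY i hik.le).add (hY (i + 1) hik)).mul_const _).mul ((hB _).sub (hB _))

variable [MeasurableSpace Ω] {P : Measure Ω} {B B' : ℝ≥0 → Ω → ℝ}

lemma trapezoidSum_congr (hB : ∀ t, B t =ᵐ[P] B' t) {Y Y' : ℝ≥0 → Ω → ℝ} {k : ℕ} {τ : ℕ → ℝ≥0}
    (hY : ∀ i ≤ k, Y (τ i) =ᵐ[P] Y' (τ i)) :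
    trapezoidSum B Y k τ =ᵐ[P] trapezoidSum B' Y' k τ := by
  have hae : ∀ᵐ ω ∂P, ∀ i ∈ Finset.range (k + 1),
      Y (τ i) ω = Y' (τ i) ω ∧ B (τ i) ω = B' (τ i) ω := by
    rw [Finset.eventually_all]
    exact fun i hi => (hY i (Nat.lt_succ_iff.1 (Finset.mem_range.1 hi))).and (hB (τ i))
  filter_upwards [hae] with ω hω
  refine Finset.sum_congr rfl fun i hi => ?_
  have hik := Finset.mem_range.1 hi
  obtain ⟨hYi, hBi⟩ := hω i (Finset.mem_range.2 (by omega))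
  obtain ⟨hYi', hBi'⟩ := hω (i + 1) (Finset.mem_range.2 (by omega))
  rw [hYi, hBi, hYi', hBi']

lemma exists_partition (s : ℝ≥0) {δ : ℝ} (hδ : 0 < δ) :
    ∃ (k : ℕ) (τ : ℕ → ℝ≥0), Monotone τ ∧ τ 0 = 0 ∧ τ k = s ∧
      ∀ i < k, (τ (i + 1) : ℝ) - τ i ≤ δ := by
  obtain ⟨n, hn⟩ := exists_nat_one_div_lt hδ
  obtain ⟨N, hN⟩ := exists_nat_ge (s * (n + 1))
  refine ⟨N, fun i => min (gridPt n i) s, fun i j h => min_le_min (gridPt_mono n h) le_rfl,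
    by simp [gridPt_zero], ?_, fun i _ => ?_⟩
  · refine min_eq_right ?_
    rw [gridPt, le_div_iff₀ (by positivity)]
    exact hN
  · have hstep : min (gridPt n (i + 1)) s ≤ min (gridPt n i) s + 1 / (n + 1) := by
      rw [gridPt_succ, min_add]
      exact min_le_min le_rfl le_self_add
    have hstep' : ((min (gridPt n (i + 1)) s : ℝ≥0) : ℝ)
        ≤ (min (gridPt n i) s : ℝ≥0) + 1 / (n + 1) := by
      exact_mod_cast hstep
    linarith

lemma IsStratonovichIntegral.congr (hB : ∀ t, B t =ᵐ[P] B' t) {s : ℝ≥0} {Y : ℝ≥0 → Ω → ℝ}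
    {I : Ω → ℝ} (h : IsStratonovichIntegral B P s Y I) : IsStratonovichIntegral B' P s Y I := by
  refine ⟨h.1, fun ε hε => ?_⟩
  obtain ⟨δ, hδ, hle⟩ := h.2 ε hε
  refine ⟨δ, hδ, fun k τ hτ hτ0 hτk hmesh => ?_⟩
  refine le_of_eq_of_le (eLpNorm_congr_ae ?_) (hle k τ hτ hτ0 hτk hmesh)
  filter_upwards [trapezoidSum_congr (Y := Y) (k := k) (τ := τ) hB fun _ _ => EventuallyEq.rfl]
    with ω hω
  rw [hω]

lemma IsStratonovichIntegral.unique (hBm : ∀ t, AEStronglyMeasurable (B t) P) {s : ℝ≥0}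
    {Y Y' : ℝ≥0 → Ω → ℝ} {I I' : Ω → ℝ} (hYm : ∀ t ≤ s, AEStronglyMeasurable (Y t) P)
    (hY : ∀ t ≤ s, Y t =ᵐ[P] Y' t) (h : IsStratonovichIntegral B P s Y I)
    (h' : IsStratonovichIntegral B P s Y' I') : I =ᵐ[P] I' := by
  suffices hnorm : eLpNorm (I - I') 2 P = 0 by
    have hae := (eLpNorm_eq_zero_iff (h.1.1.sub h'.1.1) (by norm_num)).1 hnorm
    filter_upwards [hae] with ω hω
    exact sub_eq_zero.1 hω
  refine le_antisymm (ENNReal.le_of_forall_pos_le_add fun ε hε _ => ?_) zero_le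
  have hε2 : (0 : ℝ) < ε / 2 := by positivity
  obtain ⟨δ, hδ, hle⟩ := h.2 (ε / 2) hε2
  obtain ⟨δ', hδ', hle'⟩ := h'.2 (ε / 2) hε2
  obtain ⟨k, τ, hτ, hτ0, hτk, hmesh⟩ := exists_partition s (lt_min hδ hδ')
  have hτs : ∀ i ≤ k, τ i ≤ s := fun i hi => hτk ▸ hτ hi
  have hS : AEStronglyMeasurable (trapezoidSum B Y k τ) P :=
    aestronglyMeasurable_trapezoidSum hBm fun i hi => hYm _ (hτs i hi)
  have hSS' : trapezoidSum B Y k τ =ᵐ[P] trapezoidSum B Y' k τ :=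
    trapezoidSum_congr (fun _ => EventuallyEq.rfl) fun i hi => hY _ (hτs i hi)
  have hdiff : I - I' =ᵐ[P] fun ω =>
      (trapezoidSum B Y' k τ ω - I' ω) - (trapezoidSum B Y k τ ω - I ω) := by
    filter_upwards [hSS'] with ω hω
    rw [hω, Pi.sub_apply]
    ring
  calc eLpNorm (I - I') 2 P
      ≤ eLpNorm (fun ω => trapezoidSum B Y' k τ ω - I' ω) 2 P
          + eLpNorm (fun ω => trapezoidSum B Y k τ ω - I ω) 2 P := by
        rw [eLpNorm_congr_ae hdiff]
        exact eLpNorm_sub_le ((hS.congr hSS').sub h'.1.1) (hS.sub h.1.1) (by norm_num)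
    _ ≤ ENNReal.ofReal (ε / 2) + ENNReal.ofReal (ε / 2) :=
        add_le_add (hle' k τ hτ hτ0 hτk fun i hi => (hmesh i hi).trans (min_le_right _ _))
          (hle k τ hτ hτ0 hτk fun i hi => (hmesh i hi).trans (min_le_left _ _))
    _ = 0 + ε := by
        rw [← ENNReal.ofReal_add hε2.le hε2.le, add_halves, ENNReal.ofReal_coe_nnreal, zero_add]

lemma IsIteratedStratonovich.aestronglyMeasurable {n : ℕ} {f : (Fin n → ℝ≥0) → ℝ} {s : ℝ≥0}
    {I : Ω → ℝ} (h : IsIteratedStratonovich B P n f s I) : AEStronglyMeasurable I P := by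
  cases n with
  | zero => exact aestronglyMeasurable_const.congr (EventuallyEq.symm h)
  | succ n =>
    obtain ⟨Y, -, hI⟩ := h
    exact hI.1.1

lemma IsIteratedStratonovich.unique (hBm : ∀ t, AEStronglyMeasurable (B t) P) {n : ℕ}
    {f : (Fin n → ℝ≥0) → ℝ} {s : ℝ≥0} {I I' : Ω → ℝ} (h : IsIteratedStratonovich B P n f s I)
    (h' : IsIteratedStratonovich B P n f s I') : I =ᵐ[P] I' := by
  induction n generalizing s I I' with
  | zero => exact EventuallyEq.trans h (EventuallyEq.symm h')
  | succ n ih =>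
    obtain ⟨Y, hY, hI⟩ := h
    obtain ⟨Y', hY', hI'⟩ := h'
    exact IsStratonovichIntegral.unique hBm (fun t ht => (hY t ht).aestronglyMeasurable)
      (fun t ht => ih (hY t ht) (hY' t ht)) hI hI'

lemma antitone_finCons {n : ℕ} {t : ℝ≥0} {x : Fin n → ℝ≥0} (hx : Antitone x)
    (hxt : ∀ i, x i ≤ t) : Antitone (Fin.cons t x : Fin (n + 1) → ℝ≥0) := by
  intro i j
  refine Fin.cases ?_ (fun i => ?_) i <;> refine Fin.cases ?_ (fun j => ?_) j
  · exact fun _ => le_rfl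
  · exact fun _ => by simpa only [Fin.cons_succ, Fin.cons_zero] using hxt j
  · exact fun hij => absurd hij (not_le.2 (Fin.succ_pos i))
  · exact fun hij => by simpa only [Fin.cons_succ] using hx (Fin.succ_le_succ_iff.1 hij)

lemma IsIteratedStratonovich.congr (hB : ∀ t, B t =ᵐ[P] B' t) {n : ℕ}
    {f g : (Fin n → ℝ≥0) → ℝ} {s : ℝ≥0} {I : Ω → ℝ}
    (hfg : ∀ x : Fin n → ℝ≥0, Antitone x → (∀ i, x i ≤ s) → f x = g x)
    (h : IsIteratedStratonovich B P n f s I) : IsIteratedStratonovich B' P n g s I := by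
  induction n generalizing s I with
  | zero =>
    have hI : I =ᵐ[P] fun _ => f Fin.elim0 := h
    rw [hfg Fin.elim0 (fun i => i.elim0) (fun i => i.elim0)] at hI
    exact hI
  | succ n ih =>
    obtain ⟨Y, hY, hI⟩ := h
    exact ⟨Y, fun t ht => ih (fun x hx hxt => hfg _ (antitone_finCons hx hxt)
      (finCons_le ht fun i => (hxt i).trans ht)) (hY t ht), hI.congr hB⟩

end Uniqueness

/-! ### Double integrals of powers over a triangle -/

section Triangle

lemma betaFun_eq_beta {a b : ℝ} (ha : 0 < a) (hb : 0 < b) : betaFun a b = beta a b := by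
  have hreal : (betaFun a b : ℂ) = Complex.betaIntegral b a := by
    rw [betaFun, ← intervalIntegral.integral_ofReal, Complex.betaIntegral]
    refine intervalIntegral.integral_congr fun t ht => ?_
    rw [Set.uIcc_of_le zero_le_one] at ht
    rw [Complex.ofReal_mul, Complex.ofReal_cpow ht.1, Complex.ofReal_cpow (sub_nonneg.2 ht.2)]
    push_cast
    exact mul_comm _ _
  rw [beta_eq_betaIntegralReal a b ha hb, Complex.betaIntegral_symm, ← hreal, Complex.ofReal_re]

lemma betaFun_one_right {a : ℝ} (ha : 0 < a) : betaFun a 1 = 1 / a := by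
  rw [betaFun_eq_beta ha one_pos, beta, Real.Gamma_one, mul_one, Real.Gamma_add_one ha.ne',
    div_mul_cancel_right₀ (Real.Gamma_pos_of_pos ha).ne', one_div]

lemma betaFun_self {a : ℝ} (ha : 0 < a) : betaFun a a = 2 * betaFun a (a + 1) := by
  rw [betaFun_eq_beta ha ha, betaFun_eq_beta ha (add_pos ha one_pos), beta, beta, ← add_assoc,
    Real.Gamma_add_one ha.ne', Real.Gamma_add_one (add_pos ha ha).ne']
  field_simp
  ring

lemma integral_triangle_swap {E : Type*} [NormedAddCommGroup E] [NormedSpace ℝ E] {g : ℝ × ℝ → E}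
    (hg : Continuous g) {T : ℝ} (hT : 0 ≤ T) :
    ∫ t in (0 : ℝ)..T, ∫ r in (0 : ℝ)..t, g (t, r)
      = ∫ r in (0 : ℝ)..T, ∫ t in r..T, g (t, r) := by
  set S : Set (ℝ × ℝ) := {x | x.2 ≤ x.1}
  have hint : IntegrableOn (fun t r => S.indicator g (t, r)).uncurry
      (Set.uIoc 0 T ×ˢ Set.uIoc 0 T) := by
    rw [Set.uIoc_of_le hT]
    have hIcc : IntegrableOn g (Set.Icc 0 T ×ˢ Set.Icc 0 T) :=
      hg.continuousOn.integrableOn_compact (isCompact_Icc.prod isCompact_Icc)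
    exact (hIcc.mono_set (Set.prod_mono Set.Ioc_subset_Icc_self Set.Ioc_subset_Icc_self)).indicator
      (measurableSet_le measurable_snd measurable_fst)
  calc ∫ t in (0 : ℝ)..T, ∫ r in (0 : ℝ)..t, g (t, r)
      = ∫ t in (0 : ℝ)..T, ∫ r in (0 : ℝ)..T, S.indicator g (t, r) := by
        refine intervalIntegral.integral_congr fun t ht => ?_
        rw [Set.uIcc_of_le hT] at ht
        exact (intervalIntegral.integral_indicator (f := fun r => g (t, r)) ht).symm
    _ = ∫ r in (0 : ℝ)..T, ∫ t in (0 : ℝ)..T, S.indicator g (t, r) :=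
        intervalIntegral_intervalIntegral_swap hint
    _ = ∫ r in (0 : ℝ)..T, ∫ t in r..T, g (t, r) := by
        refine intervalIntegral.integral_congr_Ioo_of_le hT fun r hr => ?_
        have hIci : Set.Ioc 0 T ∩ Set.Ici r = Set.Icc r T := by
          ext t
          exact ⟨fun h => ⟨h.2, h.1.2⟩, fun h => ⟨⟨hr.1.trans_le h.1, h.2⟩, h.1⟩⟩
        rw [intervalIntegral.integral_of_le hT, intervalIntegral.integral_of_le hr.2.le,
          ← integral_Icc_eq_integral_Ioc (x := r), ← hIci,
          ← setIntegral_indicator (f := fun t => g (t, r)) measurableSet_Ici]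
        rfl

lemma integral_sub_rpow_mul_sub_rpow {p m r T : ℝ} (hrT : r < T) :
    ∫ t in r..T, (T - t) ^ p * (t - r) ^ m
      = (T - r) ^ (p + m + 1) * betaFun (p + 1) (m + 1) := by
  have hd : 0 < T - r := sub_pos.2 hrT
  have hsubst := intervalIntegral.smul_integral_comp_mul_add (a := 0) (b := 1)
    (fun t => (T - t) ^ p * (t - r) ^ m) (T - r) r
  simp only [mul_zero, zero_add, mul_one, sub_add_cancel, smul_eq_mul, add_sub_cancel_right]
    at hsubst
  rw [← hsubst, betaFun, ← intervalIntegral.integral_const_mul,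
    ← intervalIntegral.integral_const_mul]
  refine intervalIntegral.integral_congr fun w hw => ?_
  rw [Set.uIcc_of_le zero_le_one] at hw
  simp only [add_sub_cancel_right]
  rw [show T - ((T - r) * w + r) = (T - r) * (1 - w) by ring,
    Real.mul_rpow hd.le (sub_nonneg.2 hw.2), Real.mul_rpow hd.le hw.1, Real.rpow_add hd,
    Real.rpow_add hd, Real.rpow_one]
  ring

lemma integral_triangle_rpow {p q m T : ℝ} (hp : 0 ≤ p) (hq : 0 ≤ q) (hm : 0 ≤ m) (hT : 0 ≤ T) :
    ∫ t in (0 : ℝ)..T, ∫ r in (0 : ℝ)..t, (T - t) ^ p * (T - r) ^ q * (t - r) ^ m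
      = T ^ (p + q + m + 2) / (p + q + m + 2) * betaFun (p + 1) (m + 1) := by
  have hcont : Continuous fun x : ℝ × ℝ => (T - x.1) ^ p * (T - x.2) ^ q * (x.1 - x.2) ^ m :=
    (((continuous_const.sub continuous_fst).rpow_const fun _ => .inr hp).mul
      ((continuous_const.sub continuous_snd).rpow_const fun _ => .inr hq)).mul
      ((continuous_fst.sub continuous_snd).rpow_const fun _ => .inr hm)
  have hinner : ∫ r in (0 : ℝ)..T, ∫ t in r..T, (T - t) ^ p * (T - r) ^ q * (t - r) ^ m
      = ∫ r in (0 : ℝ)..T, (T - r) ^ (p + q + m + 1) * betaFun (p + 1) (m + 1) := by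
    refine intervalIntegral.integral_congr_Ioo_of_le hT fun r hr => ?_
    simp only [mul_right_comm _ ((T - r) ^ q) _, intervalIntegral.integral_mul_const]
    rw [integral_sub_rpow_mul_sub_rpow hr.2, mul_right_comm, ← Real.rpow_add (sub_pos.2 hr.2),
      show p + m + 1 + q = p + q + m + 1 by ring]
  rw [integral_triangle_swap hcont hT, hinner, intervalIntegral.integral_mul_const,
    intervalIntegral.integral_comp_sub_left (fun u => u ^ (p + q + m + 1)) T, sub_self, sub_zero,
    integral_rpow (.inl (by linarith)), Real.zero_rpow (by positivity), sub_zero,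
    show p + q + m + 1 + 1 = p + q + m + 2 by ring]

lemma timeInt_timeInt_eq {F : ℝ≥0 → ℝ≥0 → ℝ} {w : ℝ → ℝ → ℝ} (T : ℝ≥0)
    (h : ∀ t r : ℝ≥0, r ≤ t → t ≤ T → F t r = w t r) :
    timeInt (fun t => timeInt (fun r => F t r) t) T
      = ∫ t in (0 : ℝ)..T, ∫ r in (0 : ℝ)..t, w t r := by
  refine intervalIntegral.integral_congr fun t ht => ?_
  rw [Set.uIcc_of_le T.coe_nonneg] at ht
  simp only [timeInt, Real.coe_toNNReal t ht.1]
  refine intervalIntegral.integral_congr fun r hr => ?_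
  rw [Set.uIcc_of_le ht.1] at hr
  have hF := h t.toNNReal r.toNNReal (Real.toNNReal_le_toNNReal hr.2)
    (Real.toNNReal_le_iff_le_coe.2 ht.2)
  simpa only [Real.coe_toNNReal t ht.1, Real.coe_toNNReal r hr.1] using hF

end Triangle

/-! ### Index maps of length two and four -/

section IndexMaps

/-- The position of the coefficient function of `κ` in the list `orderFourFun`. It is read off the
multiset of orders of differentiation: `κ.count 0` for `G`, and the largest order for `V`. -/
def IndexMap.shape (κ : IndexMap 4) : Fin 7 :=
  if κ.count 0 = 4 then 0
  else if κ.count 0 = 3 then 1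
  else if κ.count 0 = 2 then (if ∃ a : Fin 4, κ.count (a + 1) = 2 then 2 else 3)
  else if ∃ a : Fin 4, κ.count (a + 1) = 3 then 4
  else if ∃ a : Fin 4, κ.count (a + 1) = 2 then 5 else 6

lemma IndexMap.count_zero_eq (κ : IndexMap 4) :
    κ.count 0 = (![4, 3, 2, 2, 1, 1, 1] : Fin 7 → ℕ) κ.shape := by
  revert κ
  decide

lemma IndexMap.exists_perm_count_succ_eq (κ : IndexMap 4) :
    ∃ σ : Equiv.Perm (Fin 4), ∀ a : Fin 4, κ.count (σ a + 1) =
      (![![0, 0, 0, 0], ![1, 0, 0, 0], ![2, 0, 0, 0], ![1, 1, 0, 0], ![3, 0, 0, 0], ![2, 1, 0, 0],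
        ![1, 1, 1, 0]] : Fin 7 → Fin 4 → ℕ) κ.shape a := by
  revert κ
  decide

lemma coeffFun_four (G V : ℝ → ℝ) (κ : IndexMap 4) :
    coeffFun G V κ = orderFourFun G V κ.shape := by
  obtain ⟨σ, hσ⟩ := κ.exists_perm_count_succ_eq
  funext x
  rw [coeffFun, ← Equiv.prod_comp σ, κ.count_zero_eq]
  simp only [hσ]
  generalize κ.shape = s
  fin_cases s <;> simp only [orderFourFun, Fin.prod_univ_four, Fin.zero_eta, Fin.mk_one,
    Fin.reduceFinMk, Matrix.cons_val, Matrix.cons_val_zero, Matrix.cons_val_one,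
    iteratedDeriv_zero, iteratedDeriv_one] <;> ring

lemma coeffFun_two (G V : ℝ → ℝ) (κ : IndexMap 2) :
    ∃ β : Fin 2, coeffFun G V κ = orderTwoFun G V β := by
  have hcount : (κ.count 0 = 2 ∧ κ.count 1 = 0 ∧ κ.count 2 = 0) ∨
      (κ.count 0 = 1 ∧ κ.count 1 = 1 ∧ κ.count 2 = 0) := by
    revert κ
    decide
  rcases hcount with ⟨h0, h1, h2⟩ | ⟨h0, h1, h2⟩
  · refine ⟨0, funext fun x => ?_⟩
    simp only [coeffFun, orderTwoFun, Fin.prod_univ_two, Fin.val_zero, Fin.val_one, zero_add,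
      Nat.reduceAdd, h0, h1, h2, iteratedDeriv_zero, Matrix.cons_val_zero]
    ring
  · refine ⟨1, funext fun x => ?_⟩
    simp only [coeffFun, orderTwoFun, Fin.prod_univ_two, Fin.val_zero, Fin.val_one, zero_add,
      Nat.reduceAdd, h0, h1, h2, iteratedDeriv_zero, iteratedDeriv_one, Matrix.cons_val_zero,
      Matrix.cons_val_one]
    ring

lemma exists_shape_eq (α : Fin 7) : ∃ κ : IndexMap 4, κ.shape = α := by
  revert α
  decide

/-- The index maps whose kernel product does not vanish on the double diagonal
`t₁ = t₂`, `t₃ = t₄`: neither `K(t₁, t₂)` nor `K(t₃, t₄)` is one of its factors. -/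
def IndexMap.NonvanishingOnDiagonal (κ : IndexMap 4) : Prop := (κ 1 : ℕ) = 0 ∧ (κ 3 : ℕ) ≠ 3

instance : DecidablePred IndexMap.NonvanishingOnDiagonal :=
  fun κ => inferInstanceAs (Decidable ((κ 1 : ℕ) = 0 ∧ (κ 3 : ℕ) ≠ 3))

lemma card_shape_eq_and_nonvanishingOnDiagonal (α : Fin 7) :
    (Finset.univ.filter fun κ : IndexMap 4 => κ.shape = α ∧ κ.NonvanishingOnDiagonal).card
      = (![1, 4, 2, 2, 0, 0, 0] : Fin 7 → ℕ) α := by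
  revert α
  decide

lemma IndexMap.count_zero_eq_of_nonvanishingOnDiagonal (κ : IndexMap 4)
    (hκ : κ.NonvanishingOnDiagonal) :
    κ.count 0 = 2 + (if κ 2 = 0 then 1 else 0) + (if κ 3 = 0 then 1 else 0) := by
  revert κ
  decide

end IndexMaps

/-! ### The kernel products -/

section Kernel

/-- The kernel `(t - r)_+^{H - 1/2}`, which extends `volterraKernel` continuously to all pairs. -/
def posKernel (H : ℝ) (t r : ℝ≥0) : ℝ := ((t - r : ℝ≥0) : ℝ) ^ (H - 1 / 2)

lemma continuous_posKernel {H : ℝ} (hH : 1 / 2 < H) {α : Type*} [TopologicalSpace α]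
    {f g : α → ℝ≥0} (hf : Continuous f) (hg : Continuous g) :
    Continuous fun x => posKernel H (f x) (g x) :=
  (NNReal.continuous_coe.comp (hf.sub hg)).rpow_const fun _ => .inr (by linarith)

lemma posKernel_eq (H : ℝ) {t r : ℝ≥0} (h : r ≤ t) : posKernel H t r = volterraKernel H t r := by
  rw [posKernel, volterraKernel, NNReal.coe_sub h]

lemma posKernel_self {H : ℝ} (hH : 1 / 2 < H) (t : ℝ≥0) : posKernel H t t = 0 := by
  rw [posKernel, tsub_self, NNReal.coe_zero, Real.zero_rpow (by linarith)]

lemma posKernel_pow (H : ℝ) {t r : ℝ≥0} (h : r ≤ t) (k : ℕ) :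
    posKernel H t r ^ k = ((t : ℝ) - r) ^ (k * (H - 1 / 2)) := by
  have hnonneg : (0 : ℝ) ≤ (t : ℝ) - r := sub_nonneg.2 (NNReal.coe_le_coe.2 h)
  rw [posKernel_eq H h, volterraKernel, mul_comm, Real.rpow_mul_natCast hnonneg]

/-- The product of the kernels `posKernel` along an index map. -/
def posKernelProd (H : ℝ) (T : ℝ≥0) {n : ℕ} (κ : IndexMap n) (t : Fin n → ℝ≥0) : ℝ :=
  ∏ l : Fin n,
    posKernel H ((Fin.cons T t : Fin (n + 1) → ℝ≥0) (Fin.castLE (by omega) (κ l))) (t l)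

lemma continuous_posKernelProd {H : ℝ} (hH : 1 / 2 < H) (T : ℝ≥0) {n : ℕ} (κ : IndexMap n) :
    Continuous (posKernelProd H T κ) := by
  have hcons : Continuous fun t : Fin n → ℝ≥0 => (Fin.cons T t : Fin (n + 1) → ℝ≥0) :=
    Continuous.finCons (A := fun _ => ℝ≥0) continuous_const continuous_id
  exact continuous_finsetProd _ fun l _ =>
    continuous_posKernel hH ((continuous_apply _).comp hcons) (continuous_apply l)

lemma posKernelProd_eq (H : ℝ) {T : ℝ≥0} {n : ℕ} (κ : IndexMap n) {t : Fin n → ℝ≥0}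
    (ht : Antitone t) (hT : ∀ i, t i ≤ T) : posKernelProd H T κ t = kernelProd H T κ t := by
  refine Finset.prod_congr rfl fun l _ => posKernel_eq H ?_
  have hκ : Fin.castLE (by omega) (κ l) ≤ l.castSucc := Nat.lt_succ_iff.1 (κ l).2
  calc t l = (Fin.cons T t : Fin (n + 1) → ℝ≥0) l.succ := rfl
    _ ≤ (Fin.cons T t : Fin (n + 1) → ℝ≥0) (Fin.castLE (by omega) (κ l)) :=
        antitone_finCons ht hT (hκ.trans l.castSucc_lt_succ.le)

lemma posKernelProd_diag_eq_mul {H : ℝ} (hH : 1 / 2 < H) (T : ℝ≥0) (κ : IndexMap 4)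
    (t r : ℝ≥0) :
    posKernelProd H T κ ![t, t, r, r] =
      posKernel H T t * (if κ 1 = 0 then posKernel H T t else 0) *
        (if κ 2 = 0 then posKernel H T r else posKernel H t r) *
        (if κ 3 = 0 then posKernel H T r else if κ 3 = 3 then 0 else posKernel H t r) := by
  have hself := posKernel_self hH
  have hfst : ∀ j : Fin 1, posKernel H ((Fin.cons T ![t, t, r, r] : Fin 5 → ℝ≥0)
      (Fin.castLE (by omega) j)) t = posKernel H T t := by
    intro j
    fin_cases j
    rfl
  have hsnd : ∀ j : Fin 2, posKernel H ((Fin.cons T ![t, t, r, r] : Fin 5 → ℝ≥0)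
      (Fin.castLE (by omega) j)) t = if j = 0 then posKernel H T t else 0 := by
    intro j
    fin_cases j
    exacts [rfl, hself t]
  have hthd : ∀ j : Fin 3, posKernel H ((Fin.cons T ![t, t, r, r] : Fin 5 → ℝ≥0)
      (Fin.castLE (by omega) j)) r = if j = 0 then posKernel H T r else posKernel H t r := by
    intro j
    fin_cases j <;> rfl
  have hfth : ∀ j : Fin 4, posKernel H ((Fin.cons T ![t, t, r, r] : Fin 5 → ℝ≥0)
      (Fin.castLE (by omega) j)) r =
        if j = 0 then posKernel H T r else if j = 3 then 0 else posKernel H t r := by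
    intro j
    fin_cases j
    exacts [rfl, rfl, rfl, hself r]
  rw [posKernelProd, Fin.prod_univ_four]
  exact congrArg₂ (· * ·) (congrArg₂ (· * ·) (congrArg₂ (· * ·) (hfst _) (hsnd _)) (hthd _))
    (hfth _)

lemma posKernelProd_diag {H : ℝ} (hH : 1 / 2 < H) (T : ℝ≥0) (κ : IndexMap 4) (t r : ℝ≥0) :
    posKernelProd H T κ ![t, t, r, r] = if κ.NonvanishingOnDiagonal then
      posKernel H T t ^ 2 * posKernel H T r ^ (κ.count 0 - 2) * posKernel H t r ^ (4 - κ.count 0)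
      else 0 := by
  rw [posKernelProd_diag_eq_mul hH]
  have hfst : (κ 1 : ℕ) = 0 ↔ κ 1 = 0 := Fin.val_eq_zero_iff
  have hthd : (κ 3 : ℕ) = 3 ↔ κ 3 = 3 := Fin.val_eq_val (κ 3) 3
  by_cases hκ : κ.NonvanishingOnDiagonal
  · rw [if_pos hκ, κ.count_zero_eq_of_nonvanishingOnDiagonal hκ, if_pos (hfst.1 hκ.1),
      if_neg (mt hthd.2 hκ.2)]
    by_cases h2 : κ 2 = 0 <;> by_cases h3 : κ 3 = 0 <;>
      simp only [h2, h3, if_true, if_false, Nat.reduceAdd, Nat.reduceSub] <;> ring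
  · rw [if_neg hκ]
    by_cases h1 : κ 1 = 0
    · have h3 : κ 3 = 3 := by
        by_contra h3
        exact hκ ⟨hfst.2 h1, mt hthd.1 h3⟩
      have h30 : κ 3 ≠ 0 := by
        rw [h3]
        decide
      rw [if_neg h30, if_pos h3, mul_zero]
    · rw [if_neg h1, mul_zero, zero_mul, zero_mul]

lemma timeInt_posKernel_pow {H : ℝ} (hH : 1 / 2 < H) (T : ℝ≥0) (i j k : ℕ) :
    timeInt (fun t => timeInt
        (fun r => posKernel H T t ^ i * posKernel H T r ^ j * posKernel H t r ^ k) t) T =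
      (T : ℝ) ^ ((i + j + k) * (H - 1 / 2) + 2) / ((i + j + k) * (H - 1 / 2) + 2) *
        betaFun (i * (H - 1 / 2) + 1) (k * (H - 1 / 2) + 1) := by
  have hnonneg : ∀ m : ℕ, 0 ≤ m * (H - 1 / 2) := fun m =>
    mul_nonneg m.cast_nonneg (by linarith)
  rw [timeInt_timeInt_eq (w := fun t r => ((T : ℝ) - t) ^ (i * (H - 1 / 2)) *
      ((T : ℝ) - r) ^ (j * (H - 1 / 2)) * (t - r) ^ (k * (H - 1 / 2))) T fun t r hrt htT => by
      rw [posKernel_pow H htT, posKernel_pow H (hrt.trans htT), posKernel_pow H hrt],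
    integral_triangle_rpow (hnonneg i) (hnonneg j) (hnonneg k) T.coe_nonneg]
  simp only [add_mul]

lemma timeInt_posKernelProd_diag {H : ℝ} (hH : 1 / 2 < H) (T : ℝ≥0) (κ : IndexMap 4) :
    timeInt (fun t => timeInt (fun r => posKernelProd H T κ ![t, t, r, r]) t) T =
      if κ.NonvanishingOnDiagonal then (T : ℝ) ^ (4 * H) / (4 * H) *
        betaFun (2 * H) ((4 - κ.count 0 : ℕ) * (H - 1 / 2) + 1) else 0 := by
  simp only [posKernelProd_diag hH]
  split_ifs with hκ
  · have hcount : 2 ≤ κ.count 0 ∧ κ.count 0 ≤ 4 := by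
      rw [κ.count_zero_eq_of_nonvanishingOnDiagonal hκ]
      split_ifs <;> simp
    have hdegree : ((2 : ℕ) + (κ.count 0 - 2 : ℕ) + (4 - κ.count 0 : ℕ) : ℝ) = 4 := by
      norm_cast
      omega
    rw [timeInt_posKernel_pow hH, hdegree, Nat.cast_ofNat,
      show 4 * (H - 1 / 2) + 2 = 4 * H by ring, show 2 * (H - 1 / 2) + 1 = 2 * H by ring]
  · simp only [timeInt, intervalIntegral.integral_zero]

end Kernel

/-! ### The signature components of order four -/

lemma coeffSet_five_diff_three {G V : ℝ → ℝ}
    (h : ∀ (α : Fin 7) (β : Fin 2), orderFourFun G V α ≠ orderTwoFun G V β) :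
    coeffSet G V 5 \ coeffSet G V 3 = Set.range (orderFourFun G V) := by
  have h5 : evenOrders 5 = {2, 4} := by decide
  have h3 : evenOrders 3 = {2} := by decide
  ext φ
  constructor
  · rintro ⟨⟨n, hn, κ, rfl⟩, hφ⟩
    rw [h5, Finset.mem_insert, Finset.mem_singleton] at hn
    obtain rfl | rfl := hn
    · exact absurd ⟨2, by rw [h3]; exact Finset.mem_singleton_self 2, κ, rfl⟩ hφ
    · exact ⟨κ.shape, (coeffFun_four G V κ).symm⟩
  · rintro ⟨α, rfl⟩
    obtain ⟨κ, rfl⟩ := exists_shape_eq α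
    refine ⟨⟨4, by rw [h5]; decide, κ, coeffFun_four G V κ⟩, ?_⟩
    rintro ⟨n, hn, μ, hμ⟩
    rw [h3, Finset.mem_singleton] at hn
    subst hn
    obtain ⟨β, hβ⟩ := coeffFun_two G V μ
    exact h κ.shape β (hμ.symm.trans hβ)

section Expectation

variable {H : ℝ} {G V : ℝ → ℝ} {α : Fin 7}

lemma coeffFun_eq_orderFourFun_iff
    (hα : ∀ β : Fin 7, β ≠ α → orderFourFun G V α ≠ orderFourFun G V β) (κ : IndexMap 4) :
    coeffFun G V κ = orderFourFun G V α ↔ κ.shape = α := by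
  rw [coeffFun_four]
  exact ⟨fun h => by_contra fun hne => hα κ.shape hne h.symm, fun h => by rw [h]⟩

lemma orderFourValue_eq (hH : 1 / 2 < H) (T : ℝ≥0) (α : Fin 7) :
    orderFourValue H T α = ((![1, 4, 2, 2, 0, 0, 0] : Fin 7 → ℕ) α : ℕ) *
      ((T : ℝ) ^ (4 * H) / (4 * H) * betaFun (2 * H)
        ((4 - (![4, 3, 2, 2, 1, 1, 1] : Fin 7 → ℕ) α : ℕ) * (H - 1 / 2) + 1) / 4) := by
  have hpos : 0 < 2 * H := by linarith
  have hzero : ((4 - 4 : ℕ) : ℝ) * (H - 1 / 2) + 1 = 1 := by simp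
  have hone : ((4 - 3 : ℕ) : ℝ) * (H - 1 / 2) + 1 = H + 1 / 2 := by
    norm_num
    ring
  have htwo : ((4 - 2 : ℕ) : ℝ) * (H - 1 / 2) + 1 = 2 * H := by
    norm_num
    ring
  have hself : betaFun (2 * H) (2 * (H + 1 / 2)) = betaFun (2 * H) (2 * H) / 2 := by
    rw [betaFun_self hpos, show 2 * (H + 1 / 2) = 2 * H + 1 by ring]
    ring
  fin_cases α <;> simp only [orderFourValue, Fin.zero_eta, Fin.mk_one, Fin.reduceFinMk,
    Matrix.cons_val, Matrix.cons_val_zero, Matrix.cons_val_one, hzero, hone, htwo, hself,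
    betaFun_one_right hpos, Nat.cast_zero, zero_mul] <;> push_cast <;> field_simp <;> ring

lemma sum_shape_eq_orderFourValue (hH : 1 / 2 < H) (T : ℝ≥0) (α : Fin 7) :
    ∑ κ : IndexMap 4, (if κ.shape = α then
      timeInt (fun t => timeInt (fun r => posKernelProd H T κ ![t, t, r, r]) t) T / 4 else 0) =
        orderFourValue H T α := by
  have hterm : ∀ κ : IndexMap 4, (if κ.shape = α then
      timeInt (fun t => timeInt (fun r => posKernelProd H T κ ![t, t, r, r]) t) T / 4 else 0) =
        if κ.shape = α ∧ κ.NonvanishingOnDiagonal then (T : ℝ) ^ (4 * H) / (4 * H) * betaFun (2 * H)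
          ((4 - (![4, 3, 2, 2, 1, 1, 1] : Fin 7 → ℕ) α : ℕ) * (H - 1 / 2) + 1) / 4 else 0 := by
    intro κ
    rw [timeInt_posKernelProd_diag hH, κ.count_zero_eq]
    by_cases hshape : κ.shape = α <;> by_cases hκ : κ.NonvanishingOnDiagonal <;>
      simp only [hshape, hκ, and_true, and_false, if_true, if_false, zero_div]
  rw [Finset.sum_congr rfl fun κ _ => hterm κ, ← Finset.sum_filter, Finset.sum_const,
    card_shape_eq_and_nonvanishingOnDiagonal, nsmul_eq_mul]
  exact (orderFourValue_eq hH T α).symm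

variable {Ω : Type*} [MeasurableSpace Ω] {P : Measure Ω} {B : ℝ≥0 → Ω → ℝ}

lemma exists_isIteratedStratonovich_kernelProd (hB : IsPreBrownianReal B P) (hH : 1 / 2 < H)
    (T : ℝ≥0) :
    ∃ J : (n : ℕ) → IndexMap n → Ω → ℝ,
      (∀ n (κ : IndexMap n), IsIteratedStratonovich B P n (kernelProd H T κ) T (J n κ) ∧
        Integrable (J n κ) P) ∧
      ∀ κ : IndexMap 4, ∫ ω, J 4 κ ω ∂P =
        timeInt (fun t => timeInt (fun r => posKernelProd H T κ ![t, t, r, r]) t) T / 4 := by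
  have : IsProbabilityMeasure P := hB.isGaussianProcess.isProbabilityMeasure
  have hBm : ∀ t, AEMeasurable (B t) P := fun t => hB.aemeasurable t
  have hmod : ∀ t, B t =ᵐ[P] (hBm t).mk (B t) := fun t => (hBm t).ae_eq_mk
  have hfiltered := isFilteredBrownian_natural (hB.congr hmod) fun t => (hBm t).measurable_mk
  have hcont : ∀ {n} (κ : IndexMap n), Continuous (posKernelProd H T κ) :=
    continuous_posKernelProd hH T
  refine ⟨fun n κ => strat P (fun t => (hBm t).mk (B t)) n (posKernelProd H T κ) T,
    fun n κ => ⟨?_, integrable_coeFn_Lp_four _⟩, fun κ => ?_⟩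
  · exact (isIteratedStratonovich_strat hfiltered n (hcont κ) T).congr
      (fun t => (hmod t).symm) fun x hx hxT => posKernelProd_eq H κ hx hxT
  · rw [← expect_apply, expect_strat_four hfiltered (hcont κ), one_div, inv_mul_eq_div]

open Classical in
lemma ae_eq_sum_of_isSignatureComponent
    {T : ℝ≥0} {N : ℕ} {Γ : Ω → ℝ} {J : IndexMap 4 → Ω → ℝ} (hBm : ∀ t, AEStronglyMeasurable (B t) P)
    (hα : ∀ β : Fin 7, β ≠ α → orderFourFun G V α ≠ orderFourFun G V β)
    (hα₂ : ∀ β : Fin 2, orderFourFun G V α ≠ orderTwoFun G V β)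
    (hN : evenOrders N = {2, 4})
    (hJ : ∀ κ, IsIteratedStratonovich B P 4 (kernelProd H T κ) T (J κ))
    (hΓ : IsSignatureComponent B P H T G V N (orderFourFun G V α) Γ) :
    Γ =ᵐ[P] fun ω => ∑ κ : IndexMap 4, if κ.shape = α then J κ ω else 0 := by
  obtain ⟨J', hJ', hΓ⟩ := hΓ
  have htwo : ∀ κ : IndexMap 2, coeffFun G V κ ≠ orderFourFun G V α := fun κ h => by
    obtain ⟨β, hβ⟩ := coeffFun_two G V κ
    exact hα₂ β (h.symm.trans hβ)
  have hunique : ∀ κ : IndexMap 4, J' 4 κ =ᵐ[P] J κ := fun κ =>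
    (hJ' 4 (by rw [hN]; decide) κ).unique hBm (hJ κ)
  filter_upwards [hΓ, ae_all_iff.2 hunique] with ω hω hJω
  rw [hω, hN, Finset.sum_pair (by decide),
    Finset.sum_eq_zero (s := (Finset.univ : Finset (IndexMap 2))) fun κ _ => if_neg (htwo κ),
    zero_add]
  simp only [coeffFun_eq_orderFourFun_iff hα, hJω]

lemma integral_signatureComponent (hB : IsPreBrownianReal B P) (hH : 1 / 2 < H) (T : ℝ≥0)
    (hα : ∀ β : Fin 7, β ≠ α → orderFourFun G V α ≠ orderFourFun G V β)
    (hα₂ : ∀ β : Fin 2, orderFourFun G V α ≠ orderTwoFun G V β) {N : ℕ}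
    (hN : evenOrders N = {2, 4}) :
    (∃ Γ, IsSignatureComponent B P H T G V N (orderFourFun G V α) Γ) ∧
      ∀ Γ, IsSignatureComponent B P H T G V N (orderFourFun G V α) Γ →
        Integrable Γ P ∧ ∫ ω, Γ ω ∂P = orderFourValue H T α := by
  obtain ⟨J, hJ, hexpect⟩ := exists_isIteratedStratonovich_kernelProd hB hH T
  refine ⟨⟨_, J, fun n _ κ => (hJ n κ).1, EventuallyEq.rfl⟩, fun Γ hΓ => ?_⟩
  have hsum : Γ =ᵐ[P] fun ω => ∑ κ : IndexMap 4, if κ.shape = α then J 4 κ ω else 0 :=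
    ae_eq_sum_of_isSignatureComponent (fun t => (hB.aemeasurable t).aestronglyMeasurable) hα hα₂
      hN (fun κ => (hJ 4 κ).1) hΓ
  have hint : ∀ κ : IndexMap 4,
      Integrable (fun ω => if κ.shape = α then J 4 κ ω else 0) P := fun κ => by
    split_ifs
    exacts [(hJ 4 κ).2, integrable_zero _ _ _]
  refine ⟨(integrable_finsetSum _ fun κ _ => hint κ).congr hsum.symm, ?_⟩
  rw [integral_congr_ae hsum, integral_finsetSum _ fun κ _ => hint κ,
    ← sum_shape_eq_orderFourValue hH T α]
  refine Finset.sum_congr rfl fun κ _ => ?_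
  split_ifs
  exacts [hexpect κ, integral_zero _ _]

end Expectation

end VolterraSignature

end

theorem lemma5p1_general {Ω : Type*} [MeasurableSpace Ω] (P : Measure Ω) (B : ℝ≥0 → Ω → ℝ)
    (hB : IsPreBrownianReal B P) (H : ℝ) (hH : 1 / 2 < H) (T : ℝ≥0)
    (G V : ℝ → ℝ) (_hG : ContDiff ℝ 4 G) (_hV : ContDiff ℝ 3 V) :
    ((∀ (α : Fin 7) (β : Fin 2),
        VolterraSignature.orderFourFun G V α ≠ VolterraSignature.orderTwoFun G V β) →
      VolterraSignature.coeffSet G V 5 \ VolterraSignature.coeffSet G V 3 =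
        Set.range (VolterraSignature.orderFourFun G V)) ∧
    (∀ α : Fin 7,
      (∀ β : Fin 7, β ≠ α →
        VolterraSignature.orderFourFun G V α ≠ VolterraSignature.orderFourFun G V β) →
      (∀ β : Fin 2,
        VolterraSignature.orderFourFun G V α ≠ VolterraSignature.orderTwoFun G V β) →
      ∀ N : ℕ, N = 4 ∨ N = 5 →
        (∃ Γ : Ω → ℝ, VolterraSignature.IsSignatureComponent B P H T G V N
          (VolterraSignature.orderFourFun G V α) Γ) ∧
        ∀ Γ : Ω → ℝ, VolterraSignature.IsSignatureComponent B P H T G V N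
            (VolterraSignature.orderFourFun G V α) Γ →
          Integrable Γ P ∧
            ∫ ω, Γ ω ∂P = VolterraSignature.orderFourValue H T α) := by
  have hN45 : ∀ N : ℕ, N = 4 ∨ N = 5 → VolterraSignature.evenOrders N = {2, 4} := by
    rintro N (rfl | rfl) <;> decide
  exact ⟨VolterraSignature.coeffSet_five_diff_three, fun α hα hα₂ N hN =>
    VolterraSignature.integral_signatureComponent hB hH T hα hα₂ (hN45 N hN)⟩

theorem lemma5p1 {Ω : Type*} [MeasurableSpace Ω] (P : Measure Ω) (B : ℝ≥0 → Ω → ℝ)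
    (hB : IsBrownianReal B P) (H : ℝ) (hH : 1 / 2 < H) (T : ℝ≥0) (hT : 0 < T)
    (G V : ℝ → ℝ) (hG : ContDiff ℝ 4 G) (hV : ContDiff ℝ 3 V) :
    -- the coefficient functions; no function of order four may be one of order two
    ((∀ (α : Fin 7) (β : Fin 2),
        VolterraSignature.orderFourFun G V α ≠ VolterraSignature.orderTwoFun G V β) →
      VolterraSignature.coeffSet G V 5 \ VolterraSignature.coeffSet G V 3 =
        Set.range (VolterraSignature.orderFourFun G V)) ∧
    -- the expectations, for a function that differs from the eight other ones
    (∀ α : Fin 7,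
      (∀ β : Fin 7, β ≠ α →
        VolterraSignature.orderFourFun G V α ≠ VolterraSignature.orderFourFun G V β) →
      (∀ β : Fin 2,
        VolterraSignature.orderFourFun G V α ≠ VolterraSignature.orderTwoFun G V β) →
      ∀ N : ℕ, N = 4 ∨ N = 5 →
        (∃ Γ : Ω → ℝ, VolterraSignature.IsSignatureComponent B P H T G V N
          (VolterraSignature.orderFourFun G V α) Γ) ∧
        ∀ Γ : Ω → ℝ, VolterraSignature.IsSignatureComponent B P H T G V N
            (VolterraSignature.orderFourFun G V α) Γ →
          Integrable Γ P ∧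
            ∫ ω, Γ ω ∂P = VolterraSignature.orderFourValue H T α) := 
  lemma5p1_general P B hB.toIsPreBrownianReal H hH T G V hG hV
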